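/- Let $G$ be a countable group, embedded in a group $H$ with a finite generating set $S$ (take $H=G$ if $G$ is finitely generated), and let $G$ carry the left-invariant metric $d(g,h)=l(g^{-1}h)$, where $l$ is the word length in $H$ with respect to $S$. For a set $T$ with a metric and $k\in\mathbb N$, let $\mathrm{VR}_k T$ be the simplicial set whose $q$-simplices are the tuples $(t_0,\dots,t_q)\in T^{q+1}$ with $d(t_i,t_j)\le k$ for all $i,j$; faces delete, and degeneracies repeat, an entry. Let $\pi_q$ of a simplicial set be the $q$-th homotopy group (for $q=0$, set) of its geometric realization. For $k\le l$, say that $\pi_q(\mathrm{VR}_kT)$ vanishes in $\pi_q(\mathrm{VR}_lT)$ if the map induced by the inclusion is trivial for every base point. A non-empty $T$ is of type $F_m$ if for every $q=0,\dots,m-1$ and every $k$ there is $l\ge k$ such that $\pi_q(\mathrm{VR}_kT)$ vanishes in $\pi_q(\mathrm{VR}_lT)$. For a character (homomorphism) $\chi:G\to\mathbb R$ let $G_\chi=\{g\in G:\chi(g)\ge 0\}$ with the metric inherited from $G$; one writes $\chi\in\Sigma^m(G)$ if $G_\chi$ is of type $F_m$. The $\chi$-value of a simplex $\tau=(g_0,\dots,g_q)$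 is $v(\tau)=\min_i\chi(g_i)$, and the $\chi$-value $v(A)$ of a finite simplicial set $A$ of such simplices is the minimum of the values of its simplices. Let $X^{(m)}$ denote the $m$-skeleton, $\mathrm{sd}^n$ the $n$-fold barycentric subdivision, and let $G$ act on $\mathrm{VR}_kG$ by left translation. Theorem. Let $m\ge 0$, let $G$ be of type $F_m$, and let $\chi:G\to\mathbb R$ be a non-zero character. The following are equivalent: (1) $\chi\in\Sigma^m(G)$; (2) there are natural numbers $k_0\le k_1\le\dots\le k_m$ such that $\pi_q(\mathrm{VR}_{k_q}G_\chi)$ vanishes in $\pi_q(\mathrm{VR}_{k_{q+1}}G_\chi)$ for every $q=0,\dots,m-1$; (3) there is $K\ge 0$ such that for every $k\ge K$ there are $n\ge 0$ and a $G$-equivariant simplicial map $\varphi:\mathrm{sd}^n\big((\mathrm{VR}_kG)^{(m)}\big)\to(\mathrm{VR}_kG)^{(m)}$ with $v(\varphi(\mathrm{sd}^n\sigma))>v(\sigma)$ for every simplex $\sigma$ of $(\mathrm{VR}_kG)^{(m)}$, where $\varphi(\mathrm{sd}^n\sigma)$ is the image of the subdivided simplex $\sigma$. -/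

import Mathlib

open CategoryTheory Opposite
open scoped Topology

universe u v

noncomputable section

namespace BNSR

/-! ### Word metrics -/

/-- The word length of `h` with respect to `S`: the least `n` such that `h = x₁^± ⋯ xₙ^±` with
`xᵢ ∈ S`. It is only used when `S` generates `H`, so that the set below is non-empty. -/
def wordLength {H : Type v} [Group H] (S : Set H) (h : H) : ℕ :=
  sInf {n | ∃ w : List H, w.length = n ∧ (∀ x ∈ w, x ∈ S ∨ x⁻¹ ∈ S) ∧ w.prod = h}

/-- The distance `d(g, h) = l(g⁻¹ h)` on `G`, where `l` is the word length with respect to `S` in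
a group `H` that contains `G` via `ι`. -/
def wordDist {G : Type u} [Group G] {H : Type v} [Group H] (S : Set H) (ι : G →* H)
    (g h : G) : ℕ :=
  wordLength S (ι (g⁻¹ * h))

theorem wordDist_mul_left {G : Type u} [Group G] {H : Type v} [Group H] (S : Set H) (ι : G →* H)
    (t g h : G) : wordDist S ι (t * g) (t * h) = wordDist S ι g h := by
  unfold wordDist
  congr 2
  group

/-! ### Vietoris–Rips complexes -/

/-- The free simplicial set on `T`: its `q`-simplices are the `(q + 1)`-tuples of points of `T`,
and a monotone map acts by reindexing (so faces delete, and degeneracies repeat, an entry). -/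
def ESet (T : Type u) : SSet.{u} where
  obj n := Fin (n.unop.len + 1) → T
  map θ := TypeCat.ofHom fun t => t ∘ θ.unop.toOrderHom

/-- The Vietoris–Rips complex of `T` for the value `k`, with respect to the distance `d`. -/
def VR {T : Type u} (d : T → T → ℕ) (k : ℕ) : (ESet T).Subcomplex where
  obj n := {t | ∀ i j : Fin (n.unop.len + 1), d (t i) (t j) ≤ k}
  map θ _ ht i j := ht (θ.unop.toOrderHom i) (θ.unop.toOrderHom j)

theorem VR_mono {T : Type u} (d : T → T → ℕ) {k l : ℕ} (h : k ≤ l) : VR d k ≤ VR d l :=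
  fun _ _ ht i j => (ht i j).trans h

/-! ### Homotopy groups and finiteness properties -/

/-- The map on the `q`-th homotopy group (set, if `q = 0`) induced by a continuous map. -/
def piMap (q : ℕ) {X Y : Type u} [TopologicalSpace X] [TopologicalSpace Y] (f : C(X, Y)) (x : X) :
    π_ q X x → π_ q Y (f x) :=
  Quotient.map
    (fun γ => ⟨f.comp γ.1, fun y hy => congrArg f (γ.2 y hy)⟩)
    (fun _ _ h => ContinuousMap.HomotopicRel.comp_continuousMap h f)

/-- `π_q(VR_k T)` vanishes in `π_q(VR_l T)`, for `k ≤ l`: for each base point of the geometric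
realization `|VR_k T|`, the map induced by the inclusion `VR_k T ⊆ VR_l T` is trivial. -/
def PiVanishes {T : Type u} (d : T → T → ℕ) (q : ℕ) {k l : ℕ} (h : k ≤ l) : Prop :=
  ∀ (x : SSet.toTop.obj (VR d k : SSet.{u})) (a : π_ q (SSet.toTop.obj (VR d k : SSet.{u})) x),
    piMap q (SSet.toTop.map (SSet.Subcomplex.homOfLE (VR_mono d h))).hom x a =
      (⟦GenLoop.const⟧ : π_ q _ _)

/-- A (non-empty) space `T` with distance `d` is of type `F_m`: the direct system
`π_q(VR_k T)`, `k = 0, 1, 2, …`, is essentially trivial for `q = 0, …, m - 1`. -/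
def IsTypeF {T : Type u} (d : T → T → ℕ) (m : ℕ) : Prop :=
  ∀ q < m, ∀ k : ℕ, ∃ (l : ℕ) (h : k ≤ l), PiVanishes d q h

/-! ### Characters -/

/-- The subset `G_χ` of elements of non-negative `χ`-value. -/
abbrev Pos {G : Type u} [Group G] (χ : Additive G →+ ℝ) : Type u :=
  {g : G // 0 ≤ χ (Additive.ofMul g)}

/-- The distance on `G_χ` that is inherited from `G`. -/
def posDist {G : Type u} [Group G] (d : G → G → ℕ) (χ : Additive G →+ ℝ) (a b : Pos χ) : ℕ :=
  d a.1 b.1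

/-- The `χ`-value of a simplex `(g₀, …, g_q)`: the minimum of the `χ(gᵢ)`. -/
def val {G : Type u} [Group G] (χ : Additive G →+ ℝ) {q : ℕ} (τ : Fin (q + 1) → G) : ℝ :=
  Finset.univ.inf' Finset.univ_nonempty fun i => χ (Additive.ofMul (τ i))

/-! ### Skeleta, subdivisions, and equivariant maps -/

/-- The `m`-skeleton of `X`, generated by the simplices of dimension at most `m`
(Mathlib's `X.skeleton n` is generated by those of dimension `< n`). -/
abbrev sk (m : ℕ) (X : SSet.{u}) : SSet.{u} := (X.skeleton (m + 1) : SSet.{u})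

theorem skeleton_le_preimage {X Y : SSet.{u}} (f : X ⟶ Y) (n : ℕ) :
    X.skeleton n ≤ (Y.skeleton n).preimage f := by
  refine iSup_le fun i => iSup_le fun x => ?_
  rw [SSet.Subcomplex.ofSimplex_le_iff]
  exact Y.mem_skeleton _ i.2

/-- The map induced on `m`-skeleta by a simplicial map. -/
def skMap (m : ℕ) {X Y : SSet.{u}} (f : X ⟶ Y) : sk m X ⟶ sk m Y :=
  SSet.Subcomplex.homOfLE (skeleton_le_preimage f (m + 1)) ≫
    (Y.skeleton (m + 1)).fromPreimage f

/-- The `n`-fold barycentric subdivision. -/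
def sdIter : ℕ → SSet.{u} ⥤ SSet.{u}
  | 0 => 𝟭 _
  | n + 1 => sdIter n ⋙ SSet.sd

/-- Left translation by `t`, as a simplicial automorphism of `VR_k G`. -/
def translate {G : Type u} [Group G] {H : Type v} [Group H] (S : Set H) (ι : G →* H) (k : ℕ)
    (t : G) : (VR (wordDist S ι) k : SSet.{u}) ⟶ (VR (wordDist S ι) k : SSet.{u}) where
  app n := TypeCat.ofHom fun τ => ⟨fun i => t * τ.1 i, fun i j => by
    rw [wordDist_mul_left]
    exact τ.2 i j⟩

/-- A map from the `n`-fold subdivision of `(VR_k G)^(m)` to `(VR_k G)^(m)` is `G`-equivariant. -/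
def IsEquivariant {G : Type u} [Group G] {H : Type v} [Group H] (S : Set H) (ι : G →* H)
    {m k n : ℕ}
    (φ : (sdIter n).obj (sk m (VR (wordDist S ι) k : SSet.{u})) ⟶
      sk m (VR (wordDist S ι) k : SSet.{u})) : Prop :=
  ∀ t : G, (sdIter n).map (skMap m (translate S ι k t)) ≫ φ = φ ≫ skMap m (translate S ι k t)

section

open scoped Simplicial

/-- The vertices `(g₀, …, g_q)` of a `q`-simplex of `(VR_k T)^(m)`. -/
def verts {T : Type u} {d : T → T → ℕ} {m k q : ℕ} (σ : (sk m (VR d k : SSet.{u})) _⦋q⦌) :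
    Fin (q + 1) → T :=
  σ.1.1

/-- `v(φ ∘ σ) > v(σ)` for every simplex `σ` of `(VR_k G)^(m)`. Here `σ` is viewed as a map
`Δ^q → (VR_k G)^(m)`, so that `φ ∘ σ` is defined on the `n`-fold subdivision of `Δ^q`, and
`v(φ ∘ σ)` is the minimum of the values of the simplices `τ` in the (finite) image of `φ ∘ σ`. -/
def RaisesVal {G : Type u} [Group G] (d : G → G → ℕ) (χ : Additive G →+ ℝ) {m k n : ℕ}
    (φ : (sdIter n).obj (sk m (VR d k : SSet.{u})) ⟶ sk m (VR d k : SSet.{u})) : Prop :=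
  ∀ (q : ℕ) (σ : (sk m (VR d k : SSet.{u})) _⦋q⦌) (p : ℕ)
    (τ : ((sdIter n).obj (Δ[q] : SSet.{u})) _⦋p⦌),
    val χ (verts σ) < val χ (verts (((sdIter n).map (SSet.yonedaEquiv.symm σ) ≫ φ).app (op ⦋p⦌) τ))

end

end BNSR

end

/-!
# Characterizations of `χ ∈ Σ^m(G)`

The vanishing of homotopy groups is first made combinatorial. Vertices of a Vietoris–Rips complex
are points of `T`, so a map from a compact space to its realization is given by barycentric
coordinates: a continuous family of probability measures on `T` supported on a finite set, the
supports being sets of small diameter (`IsVRMap`). By `piVanishes_iff`, `π_q(VR_k T)` vanishes in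
`π_q(VR_l T)` if and only if each such family for `k` on the boundary of the `(q + 1)`-simplex extends
to the simplex as a family for `l`. In this language homotopies are straight line homotopies, and
simplicial approximation (`exists_simplicial_approx`, `exists_labels_extending`) amounts to labelling
the vertices of a fine barycentric subdivision by points of `T` such that adjacent vertices have
labels at distance at most `l`. Subdivisions of simplices are treated as order complexes of iterated
posets of chains (`sdP`). They are compared with the iterated subdivisions of simplicial sets by
natural maps in both directions (`sdNerveIter`, `nerveSdIter`), which suffices, as only labels have to
be transported.

From (1) to (2) one chooses the values `k_0, k_1, …` successively (`IsTypeF.exists_sequence`).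

From (2) to (3), the map `φ` is built by induction over the skeleta (`IsRaising.exists_succ`). On the
vertices it is right multiplication by an element `t` with `χ(t) > 0`. If it is defined on the
`q`-skeleton, then the labels on the boundary of a `(q + 1)`-simplex `τ` lie in the half space of
values at least `v(τ) + χ(t)`. This is a translate of `G_χ`, so that the boundary has a filling there,
after further subdivision. As `G` acts freely on simplices, which are tuples, and there are only
finitely many orbits in each dimension, this can be done equivariantly and with the same number of
subdivisions for all simplices. The diameters of the simplices of `VR_k G` play no role here: only the
labels on the faces of the boundary have to be close, which is why every `k ≥ k_m` is admissible.

From (3) to (1), a sphere in `VR_k G_χ` bounds a ball in some `VR_l G`, because `G` is of type `F_m`.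
By finiteness up to translation, `φ` moves points by a bounded amount and raises the value by at least
some `ε > 0` (`exists_push_labelling`). Applying `φ` repeatedly to the ball, one obtains after finitely
many steps a ball in `G_χ`. Each step changes the boundary by a homotopy of bounded size inside `G_χ`,
which is undone by a collar (`exists_pos_extension`, `exists_extension_of_close`). The resulting bound
on diameters does not depend on the number of steps, hence not on the sphere.
-/

noncomputable section

namespace BNSR

open PartialOrder (NonemptyFiniteChains)

/-! ### Order complexes and their barycentric subdivision -/

/-- The geometric realization of the order complex of a finite poset `P`: probability measures on
`P` supported on a chain, with the topology of pointwise convergence. -/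
abbrev OC (P : Type*) [PartialOrder P] [Fintype P] : Type _ :=
  {μ : P → ℝ // (∀ a, 0 ≤ μ a) ∧ ∑ a, μ a = 1 ∧ ∀ a b, μ a ≠ 0 → μ b ≠ 0 → a ≤ b ∨ b ≤ a}

instance (P : Type*) [PartialOrder P] [Finite P] : Finite (NonemptyFiniteChains P) :=
  Finite.of_injective NonemptyFiniteChains.finset fun _ _ h => NonemptyFiniteChains.ext h

instance (P : Type*) [PartialOrder P] [Fintype P] : Fintype (NonemptyFiniteChains P) :=
  Fintype.ofFinite _

section

variable {P : Type*} [PartialOrder P] [Fintype P]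

namespace OC

variable (μ : OC P)

lemma nonneg (a : P) : 0 ≤ μ.1 a := μ.2.1 a

lemma sum_eq : ∑ a, μ.1 a = 1 := μ.2.2.1

lemma comparable {a b : P} (ha : μ.1 a ≠ 0) (hb : μ.1 b ≠ 0) : a ≤ b ∨ b ≤ a := μ.2.2.2 a b ha hb

lemma pos_of_ne {a : P} (ha : μ.1 a ≠ 0) : 0 < μ.1 a := lt_of_le_of_ne (μ.nonneg a) ha.symm

lemma exists_ne : ∃ a, μ.1 a ≠ 0 := by
  by_contra! h
  simpa [h] using μ.sum_eq

/-- The vertex of the order complex given by an element of the poset. -/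
def vertex [DecidableEq P] (a : P) : OC P :=
  ⟨Pi.single a 1, fun b => by by_cases h : b = a <;> simp [h],
    by simp, fun b c hb hc => by
      have hb' : b = a := by by_contra h; simp [h] at hb
      have hc' : c = a := by by_contra h; simp [h] at hc
      subst hb' hc'; exact Or.inl le_rfl⟩

/-- The smallest weight of an element of the chain `c`. -/
def lo (c : NonemptyFiniteChains P) : ℝ := c.finset.inf' c.nonempty μ.1

open scoped Classical in
/-- The largest weight of an element outside the chain `c` (and `0` if there is none). -/
def hi (c : NonemptyFiniteChains P) : ℝ :=
  Finset.univ.sup' (Finset.univ_nonempty_iff.2 ⟨c.nonempty.choose⟩) fun a =>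
    if a ∈ c.finset then 0 else μ.1 a

/-- The length of the interval of those `t > 0` for which `c` is the superlevel set
`{a | t ≤ μ a}`. -/
def gap (c : NonemptyFiniteChains P) : ℝ := max (μ.lo c - μ.hi c) 0

lemma mem_Ioc_iff (c : NonemptyFiniteChains P) (t : ℝ) :
    t ∈ Set.Ioc (μ.hi c) (μ.lo c) ↔ 0 < t ∧ ∀ a, a ∈ c.finset ↔ t ≤ μ.1 a := by
  classical
  rw [Set.mem_Ioc, hi, lo, Finset.sup'_lt_iff, Finset.le_inf'_iff]
  simp only [Finset.mem_univ, true_implies]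
  constructor
  · rintro ⟨h1, h2⟩
    obtain ⟨b, hb⟩ := c.nonempty
    have h0 : 0 < t := by simpa [hb] using h1 b
    refine ⟨h0, fun a => ⟨h2 a, fun h => ?_⟩⟩
    by_contra hn
    have := h1 a
    simp only [hn, if_false] at this
    exact absurd h (not_le.2 this)
  · rintro ⟨h0, h⟩
    refine ⟨fun a => ?_, fun a ha => (h a).1 ha⟩
    split_ifs with ha
    · exact h0
    · exact not_le.1 fun h' => ha ((h a).2 h')

lemma gap_eq_volume (c : NonemptyFiniteChains P) :
    μ.gap c = MeasureTheory.volume.real (Set.Ioc (μ.hi c) (μ.lo c)) := by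
  rw [Real.volume_real_Ioc, gap]

open scoped Classical in
/-- The layer cake formula: the weight of `a` is the length of the interval of those `t` for which
`a` lies in the superlevel set. -/
lemma sum_gap (a : P) :
    ∑ c : NonemptyFiniteChains P with a ∈ c.finset, μ.gap c = μ.1 a := by
  have hdisj : ((Finset.univ.filter fun c : NonemptyFiniteChains P => a ∈ c.finset) :
      Set (NonemptyFiniteChains P)).PairwiseDisjoint
      fun c => Set.Ioc (μ.hi c) (μ.lo c) := by
    intro c _ c' _ hne
    refine Set.disjoint_left.2 fun t ht ht' => hne ?_
    rw [mem_Ioc_iff] at ht ht'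
    ext b
    rw [ht.2, ht'.2]
  simp only [gap_eq_volume]
  rw [← MeasureTheory.measureReal_biUnion_finset hdisj (fun _ _ => measurableSet_Ioc)
    (fun _ _ => by simp)]
  have : (⋃ c ∈ Finset.univ.filter (fun c : NonemptyFiniteChains P => a ∈ c.finset),
      Set.Ioc (μ.hi c) (μ.lo c)) = Set.Ioc 0 (μ.1 a) := by
    ext t
    simp only [Finset.mem_filter, Finset.mem_univ, true_and, Set.mem_iUnion, exists_prop,
      mem_Ioc_iff]
    constructor
    · rintro ⟨c, hac, h0, h⟩
      exact ⟨h0, (h a).1 hac⟩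
    · rintro ⟨h0, ha⟩
      refine ⟨⟨Finset.univ.filter fun b => t ≤ μ.1 b, ⟨a, by simpa using ha⟩, ?_⟩, by simpa using ha,
        h0, by simp⟩
      rintro ⟨b, hb⟩ ⟨b', hb'⟩
      simp only [Finset.mem_filter, Finset.mem_univ, true_and] at hb hb'
      exact μ.comparable (h0.trans_le hb).ne' (h0.trans_le hb').ne'
  rw [this, Real.volume_real_Ioc_of_le (μ.nonneg a), sub_zero]

lemma gap_nonneg (c : NonemptyFiniteChains P) : 0 ≤ μ.gap c := le_max_right _ _

lemma exists_mem_Ioc {c : NonemptyFiniteChains P} (h : μ.gap c ≠ 0) :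
    ∃ t, 0 < t ∧ ∀ a, a ∈ c.finset ↔ t ≤ μ.1 a := by
  have : μ.hi c < μ.lo c := by
    by_contra hn
    exact h (max_eq_right (by linarith))
  exact ⟨μ.lo c, (μ.mem_Ioc_iff c _).1 ⟨this, le_rfl⟩⟩

open scoped Classical in
lemma sum_card_mul_gap : ∑ c : NonemptyFiniteChains P, (c.finset.card : ℝ) * μ.gap c = 1 := by
  rw [← μ.sum_eq]
  simp_rw [← μ.sum_gap, Finset.sum_filter]
  rw [Finset.sum_comm]
  refine Finset.sum_congr rfl fun c _ => ?_
  rw [← Finset.sum_filter, Finset.sum_const, nsmul_eq_mul]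
  congr 3
  ext; simp

/-- The identification of an order complex with its barycentric subdivision: the layer cake
decomposition of `μ` into uniform measures on its superlevel sets. -/
def lay : OC (NonemptyFiniteChains P) :=
  ⟨fun c => c.finset.card * μ.gap c, fun c => mul_nonneg (Nat.cast_nonneg _) (μ.gap_nonneg c),
    μ.sum_card_mul_gap, fun c c' h h' => by
      obtain ⟨t, -, ht⟩ := μ.exists_mem_Ioc (right_ne_zero_of_mul h)
      obtain ⟨t', -, ht'⟩ := μ.exists_mem_Ioc (right_ne_zero_of_mul h')
      rcases le_total t t' with hl | hl
      · exact Or.inr fun a ha => (ht a).2 (hl.trans ((ht' a).1 ha))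
      · exact Or.inl fun a ha => (ht' a).2 (hl.trans ((ht a).1 ha))⟩

lemma lay_apply (c : NonemptyFiniteChains P) : μ.lay.1 c = c.finset.card * μ.gap c := rfl

lemma ne_zero_of_mem_of_lay_ne {c : NonemptyFiniteChains P} (h : μ.lay.1 c ≠ 0) {a : P}
    (ha : a ∈ c.finset) : μ.1 a ≠ 0 := by
  obtain ⟨t, ht0, ht⟩ := μ.exists_mem_Ioc (right_ne_zero_of_mul h)
  exact (ht0.trans_le ((ht a).1 ha)).ne'

lemma continuous_lay : Continuous (lay : OC P → _) := by
  classical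
  refine Continuous.subtype_mk (continuous_pi fun c => ?_) _
  have h : ∀ a, Continuous fun μ : OC P => μ.1 a := fun a =>
    (continuous_apply a).comp continuous_subtype_val
  refine continuous_const.mul ((Continuous.sub ?_ ?_).max continuous_const)
  · exact Continuous.finset_inf'_apply _ fun a _ => h a
  · refine Continuous.finset_sup'_apply _ fun a _ => ?_
    split_ifs
    · exact continuous_const
    · exact h a

variable (ν : OC (NonemptyFiniteChains P))

open scoped Classical in
/-- The affine map from the barycentric subdivision to the order complex that sends the vertex
of a chain to the barycenter of this chain. -/
def bar : OC P :=
  ⟨fun a => ∑ c with a ∈ c.finset, ν.1 c / c.finset.card,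
    fun a => Finset.sum_nonneg fun c _ => div_nonneg (ν.nonneg c) (Nat.cast_nonneg _), by
      refine Eq.trans ?_ ν.sum_eq
      simp_rw [Finset.sum_filter]
      rw [Finset.sum_comm]
      refine Finset.sum_congr rfl fun c _ => ?_
      have : (c.finset.card : ℝ) ≠ 0 := Nat.cast_ne_zero.2 (Finset.card_pos.2 c.nonempty).ne'
      rw [← Finset.sum_filter, Finset.sum_const, nsmul_eq_mul]
      rw [show (Finset.univ.filter fun a => a ∈ c.finset) = c.finset by ext; simp]
      field_simp, fun a b ha hb => by
      obtain ⟨c, hc, hc0⟩ := Finset.exists_ne_zero_of_sum_ne_zero ha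
      obtain ⟨c', hc', hc0'⟩ := Finset.exists_ne_zero_of_sum_ne_zero hb
      simp only [Finset.mem_filter, Finset.mem_univ, true_and] at hc hc'
      rcases ν.comparable (a := c) (b := c') (fun h => hc0 (by simp [h]))
        (fun h => hc0' (by simp [h])) with h | h
      · exact c'.comparable ⟨a, h hc⟩ ⟨b, hc'⟩
      · exact c.comparable ⟨a, hc⟩ ⟨b, h hc'⟩⟩

open scoped Classical in
lemma bar_apply (a : P) : ν.bar.1 a = ∑ c with a ∈ c.finset, ν.1 c / c.finset.card := rfl

lemma bar_ne_zero {c : NonemptyFiniteChains P} (hc : ν.1 c ≠ 0) {a : P} (ha : a ∈ c.finset) :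
    ν.bar.1 a ≠ 0 := by
  classical
  rw [bar_apply]
  refine (Finset.sum_pos' (fun c _ => div_nonneg (ν.nonneg c) (Nat.cast_nonneg _))
    ⟨c, by simpa using ha, div_pos (ν.pos_of_ne hc) ?_⟩).ne'
  exact Nat.cast_pos.2 (Finset.card_pos.2 c.nonempty)

lemma exists_of_bar_ne_zero {a : P} (ha : ν.bar.1 a ≠ 0) : ∃ c, a ∈ c.finset ∧ ν.1 c ≠ 0 := by
  classical
  obtain ⟨c, hc, hc0⟩ := Finset.exists_ne_zero_of_sum_ne_zero ha
  exact ⟨c, by simpa using hc, fun h => hc0 (by simp [h])⟩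

@[simp]
lemma bar_lay : μ.lay.bar = μ := by
  classical
  refine Subtype.ext (funext fun a => ?_)
  rw [bar_apply, ← μ.sum_gap]
  refine Finset.sum_congr rfl fun c _ => ?_
  have : (c.finset.card : ℝ) ≠ 0 := Nat.cast_ne_zero.2 (Finset.card_pos.2 c.nonempty).ne'
  rw [lay_apply]
  field_simp

/-- The barycenter measure of `ν` gives each element of a chain `c` at least the weight coming from
the chains that contain `c`, and each other element at most the weight coming from the chains that
strictly contain `c`. -/
lemma le_gap_bar (c : NonemptyFiniteChains P) : ν.1 c / c.finset.card ≤ ν.bar.gap c := by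
  classical
  by_cases hc : ν.1 c = 0
  · rw [hc, zero_div]
    exact gap_nonneg _ _
  have h0 : ∀ c' : NonemptyFiniteChains P, 0 ≤ ν.1 c' / c'.finset.card := fun c' =>
    div_nonneg (ν.nonneg c') (Nat.cast_nonneg _)
  set A : ℝ := ∑ c' : NonemptyFiniteChains P with c < c', ν.1 c' / c'.finset.card with hA
  have hA0 : 0 ≤ A := Finset.sum_nonneg fun c' _ => h0 c'
  have hlo : A + ν.1 c / c.finset.card ≤ ν.bar.lo c := by
    refine Finset.le_inf' _ _ fun a ha => ?_
    rw [bar_apply, add_comm, hA, ← Finset.sum_insert (s := Finset.univ.filter fun c' => c < c')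
      (f := fun c' => ν.1 c' / (c'.finset.card : ℝ)) (a := c) (by simp)]
    refine Finset.sum_le_sum_of_subset_of_nonneg (fun c' hc' => ?_) fun c' _ _ => h0 c'
    simp only [Finset.mem_insert, Finset.mem_filter, Finset.mem_univ, true_and] at hc' ⊢
    rcases hc' with rfl | h
    · exact ha
    · exact h.le ha
  have hhi : ν.bar.hi c ≤ A := by
    refine Finset.sup'_le _ _ fun b _ => ?_
    split_ifs with hb
    · exact hA0
    · rw [bar_apply, hA, Finset.sum_filter, Finset.sum_filter]
      refine Finset.sum_le_sum fun c' _ => ?_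
      split_ifs with h1 h2
      · exact le_rfl
      · have : ν.1 c' = 0 := by
          by_contra hne
          rcases ν.comparable hc hne with h | h
          · exact h2 (lt_of_le_of_ne h fun he => hb (he ▸ h1))
          · exact hb (h h1)
        simp [this]
      · exact h0 _
      · exact le_rfl
  exact le_trans (by linarith) (le_max_left _ _)

@[simp]
lemma lay_bar : ν.bar.lay = ν := by
  -- one of two probability measures dominates the other, so they are equal
  have hle : ∀ c, ν.1 c ≤ ν.bar.lay.1 c := fun c => by
    have h : (0 : ℝ) < c.finset.card := Nat.cast_pos.2 (Finset.card_pos.2 c.nonempty)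
    rw [lay_apply, ← div_le_iff₀' h]
    exact ν.le_gap_bar c
  refine Subtype.ext (funext fun c => ?_)
  have := (Finset.sum_eq_sum_iff_of_le (s := Finset.univ) fun c _ => hle c).1
    (by rw [ν.sum_eq, sum_eq])
  exact (this c (Finset.mem_univ c)).symm

end OC

end

/-! ### Iterated barycentric subdivisions of a poset -/

/-- Passing `n` times to the poset of non-empty finite chains. -/
def sdP : ℕ → PartOrd.{u} ⥤ PartOrd.{u}
  | 0 => 𝟭 _
  | n + 1 => sdP n ⋙ PartOrd.nonemptyFiniteChainsFunctor

instance sdPFintype (P : PartOrd.{u}) [Fintype P] : ∀ n, Fintype ((sdP n).obj P)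
  | 0 => inferInstanceAs (Fintype P)
  | n + 1 =>
    letI := sdPFintype P n
    inferInstanceAs (Fintype (NonemptyFiniteChains ((sdP n).obj P)))

lemma NonemptyFiniteChains.exists_max {P : Type*} [PartialOrder P] (c : NonemptyFiniteChains P) :
    ∃ m ∈ c.finset, ∀ a ∈ c.finset, a ≤ m := by
  obtain ⟨m, hm⟩ := c.finset.exists_maximal c.nonempty
  refine ⟨m, hm.prop, fun a ha => ?_⟩
  rcases c.comparable ⟨a, ha⟩ ⟨m, hm.prop⟩ with h | h
  · exact h
  · exact hm.le_of_ge ha h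

/-- The largest element of a chain. -/
def top {P : Type*} [PartialOrder P] (c : NonemptyFiniteChains P) : P :=
  (NonemptyFiniteChains.exists_max c).choose

section top

variable {P Q : Type*} [PartialOrder P] [PartialOrder Q]

lemma top_mem (c : NonemptyFiniteChains P) : top c ∈ c.finset :=
  (NonemptyFiniteChains.exists_max c).choose_spec.1

lemma le_top {c : NonemptyFiniteChains P} {a : P} (ha : a ∈ c.finset) : a ≤ top c :=
  (NonemptyFiniteChains.exists_max c).choose_spec.2 a ha

lemma top_mono {c c' : NonemptyFiniteChains P} (h : c ≤ c') : top c ≤ top c' :=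
  le_top (h (top_mem c))

lemma top_map (c : NonemptyFiniteChains P) (f : P →o Q) : top (c.map f) = f (top c) := by
  refine le_antisymm ?_ (le_top (by simpa using ⟨_, top_mem c, rfl⟩))
  obtain ⟨a, ha, h⟩ := (NonemptyFiniteChains.mem_map_iff _ _ _).1 (top_mem (c.map f))
  rw [← h]
  exact f.monotone (le_top ha)

end top

/-- The iterated last vertex map of a subdivided poset. -/
def lastN {P : PartOrd.{u}} (n : ℕ) : ∀ j, (sdP (n + j)).obj P → (sdP n).obj P
  | 0 => id
  | j + 1 => fun c => lastN n j (top (P := (sdP (n + j)).obj P) c)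

lemma lastN_mono {P : PartOrd.{u}} (n : ℕ) : ∀ j, Monotone (lastN (P := P) n j)
  | 0 => monotone_id
  | j + 1 => fun _ _ h => lastN_mono n j (top_mono (P := (sdP (n + j)).obj P) h)

lemma lastN_map {P Q : PartOrd.{u}} (f : P ⟶ Q) (n : ℕ) : ∀ j (w : (sdP (n + j)).obj P),
    lastN n j (((sdP (n + j)).map f).hom w) = ((sdP n).map f).hom (lastN n j w)
  | 0, _ => rfl
  | j + 1, w => by
    refine Eq.trans (congrArg (lastN n j) ?_) (lastN_map f n j (top (P := (sdP (n + j)).obj P) w))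
    exact top_map (P := (sdP (n + j)).obj P) w _

section faces

variable {P Q : PartOrd.{u}}

/-- A chain of elements in the image of an order embedding is the image of a chain. -/
lemma chain_mem_range {P Q : Type*} [PartialOrder P] [PartialOrder Q] (g : P →o Q)
    (hg : ∀ a b, g a ≤ g b → a ≤ b) (c : NonemptyFiniteChains Q)
    (h : ∀ a ∈ c.finset, a ∈ Set.range g) :
    ∃ c' : NonemptyFiniteChains P, c'.map g = c := by
  classical
  have hinj : Function.Injective g := fun a b hab =>
    le_antisymm (hg _ _ hab.le) (hg _ _ hab.ge)
  refine ⟨⟨c.finset.preimage g hinj.injOn, ?_, ?_⟩, ?_⟩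
  · obtain ⟨a, ha⟩ := c.nonempty
    obtain ⟨b, rfl⟩ := h a ha
    exact ⟨b, by simpa using ha⟩
  · rintro ⟨a, ha⟩ ⟨b, hb⟩
    rw [Finset.mem_preimage] at ha hb
    exact (c.comparable ⟨_, ha⟩ ⟨_, hb⟩).imp (hg _ _) (hg _ _)
  · ext b
    simp only [NonemptyFiniteChains.mem_map_iff, Finset.mem_preimage]
    constructor
    · rintro ⟨a, ha, rfl⟩; exact ha
    · intro hb
      obtain ⟨a, rfl⟩ := h b hb
      exact ⟨a, hb, rfl⟩

lemma sdP_map_reflects (f : P ⟶ Q) (hf : ∀ a b, f.hom a ≤ f.hom b → a ≤ b) :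
    ∀ n (a b : (sdP n).obj P), ((sdP n).map f).hom a ≤ ((sdP n).map f).hom b → a ≤ b
  | 0, a, b, h => hf a b h
  | n + 1, _, b, h => by
    intro x hx
    have hx' : ((sdP n).map f).hom x ∈
        (NonemptyFiniteChains.map (X := (sdP n).obj P) _ ((sdP n).map f).hom).finset :=
      (NonemptyFiniteChains.mem_map_iff _ _ _).2 ⟨x, hx, rfl⟩
    obtain ⟨y, hy, hxy⟩ := (NonemptyFiniteChains.mem_map_iff (X := (sdP n).obj P) b _ _).1 (h hx')
    have : y = x := le_antisymm (sdP_map_reflects f hf n _ _ hxy.le)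
      (sdP_map_reflects f hf n _ _ hxy.ge)
    exact this ▸ hy

lemma sdP_map_injective (f : P ⟶ Q) (hf : ∀ a b, f.hom a ≤ f.hom b → a ≤ b) (n : ℕ) :
    Function.Injective ((sdP n).map f).hom := fun _ _ h =>
  le_antisymm (sdP_map_reflects f hf n _ _ h.le) (sdP_map_reflects f hf n _ _ h.ge)

lemma mem_of_mem_range_sdP_succ (f : P ⟶ Q) (n : ℕ) {c : (sdP (n + 1)).obj Q}
    (hc : c ∈ Set.range ((sdP (n + 1)).map f).hom) {a : (sdP n).obj Q}
    (ha : a ∈ NonemptyFiniteChains.finset (X := (sdP n).obj Q) c) :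
    a ∈ Set.range ((sdP n).map f).hom := by
  obtain ⟨c', rfl⟩ := hc
  obtain ⟨x, -, hx⟩ := (NonemptyFiniteChains.mem_map_iff (X := (sdP n).obj P) c' _ _).1 ha
  exact ⟨x, hx⟩

/-- A subdivided face is a full subcomplex of the subdivision. -/
lemma mem_range_sdP_of_le (f : P ⟶ Q) (hf : ∀ a b, f.hom a ≤ f.hom b → a ≤ b) (n : ℕ)
    {c c' : (sdP (n + 1)).obj Q} (h : c ≤ c')
    (hc : c' ∈ Set.range ((sdP (n + 1)).map f).hom) :
    c ∈ Set.range ((sdP (n + 1)).map f).hom :=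
  chain_mem_range _ (sdP_map_reflects f hf n) c fun _ ha =>
    mem_of_mem_range_sdP_succ f n hc (h ha)

end faces

/-- `P` admits a strictly monotone function with values in `{0, …, p}`, so that its order complex
has dimension at most `p`. -/
def HeightLE (P : Type*) [PartialOrder P] (p : ℕ) : Prop :=
  ∃ r : P → ℕ, StrictMono r ∧ ∀ a, r a ≤ p

lemma HeightLE.card_le {P : Type*} [PartialOrder P] {p : ℕ} (h : HeightLE P p)
    (c : NonemptyFiniteChains P) : c.finset.card ≤ p + 1 := by
  obtain ⟨r, hr, hp⟩ := h
  rw [← Finset.card_range (p + 1)]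
  refine Finset.card_le_card_of_injOn r (fun a _ => ?_) fun a ha b hb hab => ?_
  · simpa [Nat.lt_succ_iff] using hp a
  · rcases c.comparable ⟨a, ha⟩ ⟨b, hb⟩ with h | h
    · by_contra hne
      exact (hr (lt_of_le_of_ne h hne)).ne hab
    · by_contra hne
      exact (hr (lt_of_le_of_ne h (Ne.symm hne))).ne' hab

lemma HeightLE.chains {P : Type*} [PartialOrder P] {p : ℕ} (h : HeightLE P p) :
    HeightLE (NonemptyFiniteChains P) p := by
  refine ⟨fun c => c.finset.card - 1, fun c c' hc => ?_, fun c => ?_⟩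
  · have h1 := Finset.card_lt_card (s := c.finset) (t := c'.finset) hc
    have h2 := Finset.card_pos.2 c.nonempty
    dsimp only
    omega
  · have := h.card_le c
    dsimp only
    omega

lemma HeightLE.sdP {P : PartOrd.{u}} {p : ℕ} (h : HeightLE P p) :
    ∀ n, HeightLE ((sdP n).obj P) p
  | 0 => h
  | n + 1 => HeightLE.chains (HeightLE.sdP h n)

section geometry

variable {P : PartOrd.{u}} [Fintype P]

/-- The iterated layer cake map. -/
def layN : ∀ n, OC P → OC ((sdP n).obj P)
  | 0 => id
  | n + 1 => fun μ => OC.lay (layN n μ)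

/-- The affine map from the `n`-fold subdivision that sends vertices to iterated barycenters. -/
def barN : ∀ n, OC ((sdP n).obj P) → OC P
  | 0 => id
  | n + 1 => fun ν => barN n (OC.bar (P := (sdP n).obj P) ν)

/-- The affine map between iterated subdivisions that sends vertices to iterated barycenters. -/
def barFrom (n : ℕ) : ∀ j, OC ((sdP (n + j)).obj P) → OC ((sdP n).obj P)
  | 0 => id
  | j + 1 => fun ν => barFrom n j (OC.bar (P := (sdP (n + j)).obj P) ν)

open scoped Classical in
/-- The position of a vertex of the `n`-fold subdivision. -/
def pos (n : ℕ) (w : (sdP n).obj P) : OC P := barN n (OC.vertex w)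

lemma continuous_layN : ∀ n, Continuous (layN (P := P) n)
  | 0 => continuous_id
  | n + 1 => OC.continuous_lay.comp (continuous_layN n)

lemma barN_layN : ∀ n (μ : OC P), barN n (layN n μ) = μ
  | 0, _ => rfl
  | n + 1, μ => (congrArg (barN n) (OC.bar_lay (layN n μ))).trans (barN_layN n μ)

lemma layN_barN : ∀ n (ν : OC ((sdP n).obj P)), layN n (barN n ν) = ν
  | 0, _ => rfl
  | n + 1, ν => (congrArg OC.lay (layN_barN n (OC.bar (P := (sdP n).obj P) ν))).trans
      (OC.lay_bar (P := (sdP n).obj P) ν)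

lemma barN_add (n : ℕ) : ∀ j (ν : OC ((sdP (n + j)).obj P)),
    barN (n + j) ν = barN n (barFrom n j ν)
  | 0, _ => rfl
  | j + 1, ν => barN_add n j (OC.bar (P := (sdP (n + j)).obj P) ν)

lemma barFrom_ne_zero (n : ℕ) : ∀ j (ν : OC ((sdP (n + j)).obj P)) (w : (sdP (n + j)).obj P),
    ν.1 w ≠ 0 → (barFrom n j ν).1 (lastN n j w) ≠ 0
  | 0, _, _, h => h
  | j + 1, ν, w, h => barFrom_ne_zero n j (OC.bar (P := (sdP (n + j)).obj P) ν) _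
      (OC.bar_ne_zero (P := (sdP (n + j)).obj P) ν h (top_mem (P := (sdP (n + j)).obj P) w))

/-- A vertex of a finer subdivision lies in the open star of its iterated last vertex. -/
lemma layN_pos_ne_zero (n j : ℕ) (w : (sdP (n + j)).obj P) :
    (layN n (pos (n + j) w)).1 (lastN n j w) ≠ 0 := by
  classical
  rw [pos, barN_add, layN_barN]
  exact barFrom_ne_zero n j _ w (by simp [OC.vertex])

open scoped Classical in
lemma barN_apply : ∀ n (ν : OC ((sdP n).obj P)) (a : P),
    (barN n ν).1 a = ∑ w, ν.1 w * (pos n w).1 a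
  | 0, ν, a => by
    have key : ∀ ν : OC P, ν.1 a = ∑ w : P, ν.1 w * (OC.vertex w).1 a := fun ν => by
      rw [Finset.sum_eq_single a (fun w _ hw => by simp [OC.vertex, Ne.symm hw]) (by simp)]
      simp [OC.vertex]
    exact key ν
  | n + 1, ν, a => by
    have key : ∀ ν : OC (NonemptyFiniteChains ((sdP n).obj P)), (barN n ν.bar).1 a =
        ∑ c : NonemptyFiniteChains ((sdP n).obj P),
          ν.1 c * ((∑ w ∈ c.finset, (pos n w).1 a) / c.finset.card) := by
      intro ν
      rw [barN_apply n]
      simp_rw [OC.bar_apply, Finset.sum_filter, Finset.sum_mul]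
      rw [Finset.sum_comm]
      refine Finset.sum_congr rfl fun c _ => ?_
      rw [Finset.sum_div, Finset.mul_sum, ← Finset.sum_filter_add_sum_filter_not Finset.univ
        (fun w => w ∈ c.finset), add_eq_left.2]
      · refine Finset.sum_congr (by ext; simp) fun w hw => ?_
        rw [if_pos hw]; ring
      · refine Finset.sum_eq_zero fun w hw => ?_
        rw [if_neg (by simpa using hw), zero_mul]
    refine (key ν).trans (Finset.sum_congr rfl fun c _ => ?_)
    congr 1
    refine Eq.trans ?_ (key (OC.vertex c)).symm
    rw [Finset.sum_eq_single c]
    · simp [OC.vertex]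
    · intro c' _ hne; simp [OC.vertex, hne]
    · simp

lemma pos_succ (n : ℕ) (c : NonemptyFiniteChains ((sdP n).obj P)) (a : P) :
    (pos (n + 1) (P := P) c).1 a = (∑ w ∈ c.finset, (pos n w).1 a) / c.finset.card := by
  classical
  have h : (pos (n + 1) (P := P) c).1 a = (barN n (OC.vertex c).bar).1 a := rfl
  rw [h, barN_apply, Finset.sum_div, ← Finset.sum_subset (Finset.subset_univ c.finset)]
  · refine Finset.sum_congr rfl fun w hw => ?_
    rw [OC.bar_apply, Finset.sum_eq_single c]
    · simp [OC.vertex]; ring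
    · intro c' _ hne; simp [OC.vertex, hne]
    · simp [hw]
  · intro w _ hw
    rw [OC.bar_apply, Finset.sum_eq_zero, zero_mul]
    intro c' hc'
    have : c' ≠ c := by rintro rfl; simp [hw] at hc'
    simp [OC.vertex, this]

/-- The barycenter of a subset of a finite set of `m ≤ p + 1` reals is close to the barycenter of
the whole set. -/
lemma abs_average_sub_le {ι : Type*} {s t : Finset ι} (hs : s.Nonempty) (hst : s ⊆ t) {p : ℕ}
    (hp : t.card ≤ p + 1) {f : ι → ℝ} {M : ℝ} (hM : ∀ i ∈ t, ∀ j ∈ t, |f i - f j| ≤ M) :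
    |(∑ i ∈ s, f i) / s.card - (∑ i ∈ t, f i) / t.card| ≤ p / (p + 1) * M := by
  classical
  have hs0 : (0 : ℝ) < s.card := Nat.cast_pos.2 hs.card_pos
  have ht0 : (0 : ℝ) < t.card := Nat.cast_pos.2 (hs.mono hst).card_pos
  have hp' : (t.card : ℝ) ≤ p + 1 := by exact_mod_cast hp
  have hM0 : 0 ≤ M := by
    obtain ⟨i, hi⟩ := hs
    exact (abs_nonneg _).trans (hM i (hst hi) i (hst hi))
  have hone : ∀ i ∈ s, |f i - (∑ j ∈ t, f j) / t.card| ≤ p / (p + 1) * M := by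
    intro i hi
    have h1 : f i - (∑ j ∈ t, f j) / t.card = (∑ j ∈ t.erase i, (f i - f j)) / t.card := by
      rw [Finset.sum_erase _ (by simp), Finset.sum_sub_distrib, Finset.sum_const, nsmul_eq_mul]
      field_simp
    rw [h1, abs_div, abs_of_pos ht0, div_le_iff₀ ht0]
    calc |∑ j ∈ t.erase i, (f i - f j)| ≤ ∑ j ∈ t.erase i, |f i - f j| :=
          Finset.abs_sum_le_sum_abs _ _
      _ ≤ ∑ _j ∈ t.erase i, M := Finset.sum_le_sum fun j hj =>
          hM i (hst hi) j (Finset.mem_of_mem_erase hj)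
      _ = (t.card - 1) * M := by
          rw [Finset.sum_const, Finset.card_erase_of_mem (hst hi), nsmul_eq_mul,
            Nat.cast_sub (Finset.card_pos.2 ⟨i, hst hi⟩)]
          simp
      _ ≤ p / (p + 1) * M * t.card := by
          have : ((t.card : ℝ) - 1) ≤ p / (p + 1) * t.card := by
            rw [div_mul_eq_mul_div, le_div_iff₀ (by positivity)]
            nlinarith
          nlinarith
  have h2 : (∑ i ∈ s, f i) / s.card - (∑ i ∈ t, f i) / t.card =
      (∑ i ∈ s, (f i - (∑ j ∈ t, f j) / t.card)) / s.card := by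
    rw [Finset.sum_sub_distrib, Finset.sum_const, nsmul_eq_mul]
    field_simp
  rw [h2, abs_div, abs_of_pos hs0, div_le_iff₀ hs0]
  calc |∑ i ∈ s, (f i - (∑ j ∈ t, f j) / t.card)|
      ≤ ∑ i ∈ s, |f i - (∑ j ∈ t, f j) / t.card| := Finset.abs_sum_le_sum_abs _ _
    _ ≤ ∑ _i ∈ s, p / (p + 1) * M := Finset.sum_le_sum hone
    _ = p / (p + 1) * M * s.card := by rw [Finset.sum_const, nsmul_eq_mul, mul_comm]

/-- Barycentric subdivision shrinks the edges of a `p`-dimensional complex by `p / (p + 1)`. -/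
lemma abs_pos_sub_pos_le {p : ℕ} (hP : HeightLE P p) (a : P) :
    ∀ n (w w' : (sdP n).obj P), w ≤ w' →
      |(pos n w).1 a - (pos n w').1 a| ≤ ((p : ℝ) / (p + 1)) ^ n
  | 0, w, w', _ => by
    have h : ∀ μ : OC P, 0 ≤ μ.1 a ∧ μ.1 a ≤ 1 := fun μ =>
      ⟨μ.nonneg a,
        (Finset.single_le_sum (fun b _ => μ.nonneg b) (Finset.mem_univ a)).trans μ.sum_eq.le⟩
    have h1 := h (pos 0 w)
    have h2 := h (pos 0 w')
    rw [pow_zero, abs_le]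
    constructor <;> linarith
  | n + 1, c, c', h => by
    rw [pos_succ n c, pos_succ n c', pow_succ, mul_comm]
    refine abs_average_sub_le (NonemptyFiniteChains.nonempty (X := (sdP n).obj P) c) h
      ((hP.sdP n).card_le c') fun i hi j hj => ?_
    rcases NonemptyFiniteChains.comparable (X := (sdP n).obj P) c' ⟨i, hi⟩ ⟨j, hj⟩ with h | h
    · exact abs_pos_sub_pos_le hP a n i j h
    · rw [abs_sub_comm]
      exact abs_pos_sub_pos_le hP a n j i h

/-- A point of a `p`-dimensional complex is close to the vertices of the simplex of the `n`-fold
subdivision that contains it. -/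
lemma abs_sub_pos_le {p : ℕ} (hP : HeightLE P p) (n : ℕ) (μ : OC P) (w : (sdP n).obj P)
    (hw : (layN n μ).1 w ≠ 0) (a : P) :
    |μ.1 a - (pos n w).1 a| ≤ ((p : ℝ) / (p + 1)) ^ n := by
  classical
  set M := ((p : ℝ) / (p + 1)) ^ n
  have h1 : μ.1 a - (pos n w).1 a =
      ∑ w', (layN n μ).1 w' * ((pos n w').1 a - (pos n w).1 a) := by
    simp_rw [mul_sub]
    rw [Finset.sum_sub_distrib, ← barN_apply, barN_layN, ← Finset.sum_mul, OC.sum_eq, one_mul]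
  rw [h1]
  calc _ ≤ ∑ w', |(layN n μ).1 w' * ((pos n w').1 a - (pos n w).1 a)| :=
        Finset.abs_sum_le_sum_abs _ _
    _ ≤ ∑ w', (layN n μ).1 w' * M := Finset.sum_le_sum fun w' _ => by
        by_cases h : (layN n μ).1 w' = 0
        · simp [h]
        · rw [abs_mul, abs_of_nonneg (OC.nonneg _ _)]
          refine mul_le_mul_of_nonneg_left ?_ (OC.nonneg _ _)
          rcases OC.comparable _ h hw with h | h
          · exact abs_pos_sub_pos_le hP a n _ _ h
          · rw [abs_sub_comm]; exact abs_pos_sub_pos_le hP a n _ _ h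
    _ = M := by rw [← Finset.sum_mul, OC.sum_eq, one_mul]

end geometry

/-- A point of a face lies in the subdivision of this face. -/
lemma mem_range_of_layN_ne_zero {P Q : PartOrd.{u}} [Fintype Q] (f : P ⟶ Q)
    (hf : ∀ a b, f.hom a ≤ f.hom b → a ≤ b) (μ : OC Q)
    (hμ : ∀ a, μ.1 a ≠ 0 → a ∈ Set.range f.hom) :
    ∀ n w, (layN n μ).1 w ≠ 0 → w ∈ Set.range ((sdP n).map f).hom
  | 0, w, hw => hμ w hw
  | n + 1, w, hw => chain_mem_range _ (sdP_map_reflects f hf n) w fun a ha =>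
    mem_range_of_layN_ne_zero f hf μ hμ n a
      (OC.ne_zero_of_mem_of_lay_ne (P := (sdP n).obj Q) (layN n μ) hw ha)

lemma mem_range_of_barN_ne_zero {P Q : PartOrd.{u}} [Fintype Q] (f : P ⟶ Q) :
    ∀ n (ν : OC ((sdP n).obj Q)), (∀ w, ν.1 w ≠ 0 → w ∈ Set.range ((sdP n).map f).hom) →
      ∀ a, (barN n ν).1 a ≠ 0 → a ∈ Set.range f.hom
  | 0, _, h => h
  | n + 1, ν, h => mem_range_of_barN_ne_zero f n (OC.bar (P := (sdP n).obj Q) ν) fun w hw => by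
    obtain ⟨c, hwc, hc⟩ := OC.exists_of_bar_ne_zero (P := (sdP n).obj Q) ν hw
    exact mem_of_mem_range_sdP_succ f n (h c hc) hwc

lemma mem_range_of_pos_ne_zero {P Q : PartOrd.{u}} [Fintype Q] (f : P ⟶ Q) (n : ℕ)
    {w : (sdP n).obj Q}
    (hw : w ∈ Set.range ((sdP n).map f).hom) {a : Q} (ha : (pos n w).1 a ≠ 0) :
    a ∈ Set.range f.hom := by
  classical
  refine mem_range_of_barN_ne_zero f n _ (fun w' hw' => ?_) a ha
  have : w' = w := by
    by_contra hne
    exact hw' (by simp [OC.vertex, hne])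
  exact this ▸ hw

/-! ### Maps to Vietoris–Rips complexes in terms of barycentric coordinates -/

/-- A continuous map from `Z` to the Vietoris–Rips complex of `T` for the value `k`, given by
barycentric coordinates: `μ z` is a probability measure on `T` supported on a set of diameter
at most `k`. All measures `μ z` are supported on a common finite set. -/
structure IsVRMap {T : Type*} (d : T → T → ℕ) (k : ℕ) {Z : Type*} [TopologicalSpace Z]
    (μ : Z → T → ℝ) : Prop where
  continuous : ∀ t, Continuous fun z => μ z t
  nonneg : ∀ z t, 0 ≤ μ z t
  exists_finset : ∃ W : Finset T, (∀ z, ∀ t ∉ W, μ z t = 0) ∧ ∀ z, ∑ t ∈ W, μ z t = 1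
  clique : ∀ z s t, μ z s ≠ 0 → μ z t ≠ 0 → d s t ≤ k

namespace IsVRMap

variable {T : Type*} {d : T → T → ℕ} {k l : ℕ} {Z Z' : Type*} [TopologicalSpace Z]
  [TopologicalSpace Z'] {μ ν : Z → T → ℝ}

lemma mono (h : IsVRMap d k μ) (hkl : k ≤ l) : IsVRMap d l μ :=
  { h with clique := fun z s t hs ht => (h.clique z s t hs ht).trans hkl }

lemma comp (h : IsVRMap d k μ) {f : Z' → Z} (hf : Continuous f) : IsVRMap d k (fun z => μ (f z)) where
  continuous t := (h.continuous t).comp hf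
  nonneg z t := h.nonneg _ t
  exists_finset := by
    obtain ⟨W, h1, h2⟩ := h.exists_finset
    exact ⟨W, fun z => h1 _, fun z => h2 _⟩
  clique z := h.clique _

lemma exists_ne (h : IsVRMap d k μ) (z : Z) : ∃ t, μ z t ≠ 0 := by
  obtain ⟨W, -, h2⟩ := h.exists_finset
  by_contra! h0
  simpa [h0] using h2 z

/-- A common finite support can be enlarged. -/
lemma sum_eq_one_of_subset {W W' : Finset T} (hW : W ⊆ W') {ρ : T → ℝ} (h1 : ∀ t ∉ W, ρ t = 0)
    (h2 : ∑ t ∈ W, ρ t = 1) : ∑ t ∈ W', ρ t = 1 := by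
  rw [← h2]
  exact (Finset.sum_subset hW fun t _ ht => h1 t ht).symm

lemma exists_common_finset (hμ : IsVRMap d k μ) {ν : Z' → T → ℝ} (hν : IsVRMap d l ν) :
    ∃ W : Finset T, ((∀ z, ∀ t ∉ W, μ z t = 0) ∧ ∀ z, ∑ t ∈ W, μ z t = 1) ∧
      ((∀ z, ∀ t ∉ W, ν z t = 0) ∧ ∀ z, ∑ t ∈ W, ν z t = 1) := by
  classical
  obtain ⟨W, h1, h2⟩ := hμ.exists_finset
  obtain ⟨W', h1', h2'⟩ := hν.exists_finset
  refine ⟨W ∪ W', ⟨fun z t ht => h1 z t fun h => ht (Finset.mem_union_left _ h),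
    fun z => sum_eq_one_of_subset Finset.subset_union_left (h1 z) (h2 z)⟩,
    fun z t ht => h1' z t fun h => ht (Finset.mem_union_right _ h),
    fun z => sum_eq_one_of_subset Finset.subset_union_right (h1' z) (h2' z)⟩

/-- The straight line homotopy. -/
lemma mix (hμ : IsVRMap d k μ) (hν : IsVRMap d k ν)
    (hc : ∀ z s t, μ z s ≠ 0 → ν z t ≠ 0 → d s t ≤ k ∧ d t s ≤ k) {c : Z → ℝ} (hcont : Continuous c)
    (h0 : ∀ z, 0 ≤ c z) (h1 : ∀ z, c z ≤ 1) :
    IsVRMap d k fun z t => (1 - c z) * μ z t + c z * ν z t where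
  continuous t := by
    have := hμ.continuous t
    have := hν.continuous t
    fun_prop
  nonneg z t := add_nonneg (mul_nonneg (by linarith [h1 z]) (hμ.nonneg z t))
    (mul_nonneg (h0 z) (hν.nonneg z t))
  exists_finset := by
    obtain ⟨W, ⟨a1, a2⟩, b1, b2⟩ := exists_common_finset hμ hν
    refine ⟨W, fun z t ht => by rw [a1 z t ht, b1 z t ht]; ring, fun z => ?_⟩
    rw [Finset.sum_add_distrib, ← Finset.mul_sum, ← Finset.mul_sum, a2, b2]
    ring
  clique z s t hs ht := by
    have key : ∀ t, (1 - c z) * μ z t + c z * ν z t ≠ 0 → μ z t ≠ 0 ∨ ν z t ≠ 0 := by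
      intro t h
      by_contra! h'
      simp [h'] at h
    rcases key s hs with hs | hs <;> rcases key t ht with ht | ht
    · exact hμ.clique z s t hs ht
    · exact (hc z s t hs ht).1
    · exact (hc z t s ht hs).2
    · exact hν.clique z s t hs ht

lemma ite_le (hμ : IsVRMap d k μ) (hν : IsVRMap d k ν) {a : Z → ℝ} (ha : Continuous a) (c : ℝ)
    (h : ∀ z, a z = c → μ z = ν z) : IsVRMap d k fun z => if a z ≤ c then μ z else ν z where
  continuous t := by
    have : (fun z => (if a z ≤ c then μ z else ν z) t) = fun z => if a z ≤ c then μ z t else ν z t := by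
      funext z; split_ifs <;> rfl
    rw [this]
    exact (hμ.continuous t).if_le (hν.continuous t) ha continuous_const fun z hz => by rw [h z hz]
  nonneg z t := by
    split_ifs
    · exact hμ.nonneg z t
    · exact hν.nonneg z t
  exists_finset := by
    obtain ⟨W, ⟨a1, a2⟩, b1, b2⟩ := exists_common_finset hμ hν
    refine ⟨W, fun z t ht => ?_, fun z => ?_⟩ <;> split_ifs
    · exact a1 z t ht
    · exact b1 z t ht
    · exact a2 z
    · exact b2 z
  clique z s t := by
    split_ifs
    · exact hμ.clique z s t
    · exact hν.clique z s t

/-- Maps descend along topological quotients. -/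
lemma exists_descend {π : Z → Z'} (hπ : Topology.IsQuotientMap π) (h : IsVRMap d k μ)
    (hfib : ∀ z z', π z = π z' → μ z = μ z') :
    ∃ M : Z' → T → ℝ, IsVRMap d k M ∧ ∀ z, M (π z) = μ z := by
  have hM : ∀ z, μ (Function.surjInv hπ.surjective (π z)) = μ z := fun z =>
    hfib _ _ (Function.surjInv_eq _ _)
  refine ⟨fun z' => μ (Function.surjInv hπ.surjective z'), ⟨fun t => ?_, fun z t => h.nonneg _ t, ?_,
    fun z => h.clique _⟩, hM⟩
  · rw [hπ.continuous_iff]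
    refine (h.continuous t).congr fun z => ?_
    exact (congrFun (hM z) t).symm
  · obtain ⟨W, h1, h2⟩ := h.exists_finset
    exact ⟨W, fun z => h1 _, fun z => h2 _⟩

end IsVRMap

/-- The map to a Vietoris–Rips complex given by a map to an order complex and a labelling of the
vertices. -/
def labelMap {T : Type*} {Z : Type*} {P : Type*} [PartialOrder P] [Fintype P] (ℓ : Z → OC P)
    (b : P → T) (z : Z) (t : T) : ℝ := by
  classical
  exact ∑ w with b w = t, (ℓ z).1 w

section labelMap

variable {T : Type*} {Z : Type*} {P : Type*} [PartialOrder P] [Fintype P] {ℓ : Z → OC P} {b : P → T}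

lemma labelMap_ne_zero_iff {z : Z} {t : T} : labelMap ℓ b z t ≠ 0 ↔ ∃ w, (ℓ z).1 w ≠ 0 ∧ b w = t := by
  classical
  rw [labelMap, ne_eq, Finset.sum_eq_zero_iff_of_nonneg fun w _ => (ℓ z).nonneg w]
  simp only [Finset.mem_filter, Finset.mem_univ, true_and]
  push Not
  exact ⟨fun ⟨w, h, h'⟩ => ⟨w, h', h⟩, fun ⟨w, h, h'⟩ => ⟨w, h', h⟩⟩

lemma isVRMap_labelMap [TopologicalSpace Z] {d : T → T → ℕ} {k : ℕ} (hℓ : Continuous ℓ)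
    (hb : ∀ z w w', (ℓ z).1 w ≠ 0 → (ℓ z).1 w' ≠ 0 → d (b w) (b w') ≤ k) :
    IsVRMap d k (labelMap ℓ b) where
  continuous t := by
    classical
    exact continuous_finsetSum _ fun w _ => (continuous_apply w).comp (continuous_subtype_val.comp hℓ)
  nonneg z t := by
    classical
    exact Finset.sum_nonneg fun w _ => (ℓ z).nonneg w
  exists_finset := by
    classical
    refine ⟨Finset.univ.image b, fun z t ht => ?_, fun z => ?_⟩
    · by_contra h
      obtain ⟨w, -, rfl⟩ := labelMap_ne_zero_iff.1 h
      exact ht (Finset.mem_image_of_mem _ (Finset.mem_univ w))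
    · rw [← (ℓ z).sum_eq]
      exact Finset.sum_fiberwise_of_maps_to (fun w hw => Finset.mem_image_of_mem b hw) _
  clique z s t hs ht := by
    obtain ⟨w, hw, rfl⟩ := labelMap_ne_zero_iff.1 hs
    obtain ⟨w', hw', rfl⟩ := labelMap_ne_zero_iff.1 ht
    exact hb z w w' hw hw'

end labelMap

/-! ### The boundary of a simplex and collars -/

/-- The boundary of the topological `(q + 1)`-simplex. -/
def bd (q : ℕ) : Set (stdSimplex ℝ (Fin (q + 2))) := {x | ∃ i, x i = 0}

lemma continuous_coord {ι : Type*} [Fintype ι] (i : ι) : Continuous fun x : stdSimplex ℝ ι => x i :=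
  (continuous_apply i).comp continuous_subtype_val

lemma isClosed_bd (q : ℕ) : IsClosed (bd q) := by
  have : bd q = ⋃ i, {x | x i = 0} := by ext; simp [bd]
  rw [this]
  exact isClosed_iUnion_of_finite fun i => isClosed_eq (continuous_coord i) continuous_const

instance (q : ℕ) : CompactSpace (bd q) := isCompact_iff_compactSpace.1 (isClosed_bd q).isCompact

/-- The convex combination `(1 - s) x + s y` of points in a simplex. -/
def cvx {ι : Type*} [Fintype ι] (x y : stdSimplex ℝ ι) (s : unitInterval) : stdSimplex ℝ ι :=
  ⟨fun i => (1 - s) * x i + s * y i, fun i => add_nonneg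
    (mul_nonneg (sub_nonneg.2 s.2.2) (x.2.1 i)) (mul_nonneg s.2.1 (y.2.1 i)), by
    rw [Finset.sum_add_distrib, ← Finset.mul_sum, ← Finset.mul_sum, stdSimplex.sum_eq_one,
      stdSimplex.sum_eq_one]
    ring⟩

@[simp]
lemma cvx_apply {ι : Type*} [Fintype ι] (x y : stdSimplex ℝ ι) (s : unitInterval) (i : ι) :
    cvx x y s i = (1 - s) * x i + s * y i := rfl

@[simp]
lemma cvx_zero {ι : Type*} [Fintype ι] (x y : stdSimplex ℝ ι) : cvx x y 0 = x := by ext i; simp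

@[simp]
lemma cvx_one {ι : Type*} [Fintype ι] (x y : stdSimplex ℝ ι) : cvx x y 1 = y := by ext i; simp

lemma continuous_cvx {ι : Type*} [Fintype ι] :
    Continuous fun p : (stdSimplex ℝ ι × stdSimplex ℝ ι) × unitInterval => cvx p.1.1 p.1.2 p.2 := by
  refine Continuous.subtype_mk (continuous_pi fun i => ?_) _
  have h1 : Continuous fun p : (stdSimplex ℝ ι × stdSimplex ℝ ι) × unitInterval => p.1.1 i :=
    (continuous_coord i).comp (continuous_fst.comp continuous_fst)
  have h2 : Continuous fun p : (stdSimplex ℝ ι × stdSimplex ℝ ι) × unitInterval => p.1.2 i :=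
    (continuous_coord i).comp (continuous_snd.comp continuous_fst)
  have h3 : Continuous fun p : (stdSimplex ℝ ι × stdSimplex ℝ ι) × unitInterval => (p.2 : ℝ) :=
    continuous_subtype_val.comp continuous_snd
  fun_prop

/-- The smallest coordinate of a point of a simplex. -/
def minCoord {q : ℕ} (x : stdSimplex ℝ (Fin (q + 1))) : ℝ :=
  Finset.univ.inf' Finset.univ_nonempty fun i => x i

lemma minCoord_le {q : ℕ} (x : stdSimplex ℝ (Fin (q + 1))) (i) : minCoord x ≤ x i :=
  Finset.inf'_le _ (Finset.mem_univ i)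

lemma exists_eq_minCoord {q : ℕ} (x : stdSimplex ℝ (Fin (q + 1))) : ∃ i, x i = minCoord x := by
  obtain ⟨i, -, h⟩ := Finset.exists_mem_eq_inf' Finset.univ_nonempty fun i => x i
  exact ⟨i, h.symm⟩

lemma minCoord_nonneg {q : ℕ} (x : stdSimplex ℝ (Fin (q + 1))) : 0 ≤ minCoord x :=
  Finset.le_inf' _ _ fun i _ => x.2.1 i

lemma minCoord_mul_le {q : ℕ} (x : stdSimplex ℝ (Fin (q + 1))) : (q + 1) * minCoord x ≤ 1 := by
  rw [← stdSimplex.sum_eq_one x]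
  refine le_trans ?_ (Finset.sum_le_sum fun i _ => minCoord_le x i)
  simp

lemma continuous_minCoord {q : ℕ} : Continuous (minCoord (q := q)) :=
  Continuous.finset_inf'_apply _ fun i _ => continuous_coord i

lemma minCoord_eq_of {q : ℕ} {x : stdSimplex ℝ (Fin (q + 1))} {c : ℝ} (h : ∀ i, c ≤ x i) {i}
    (hi : x i = c) : minCoord x = c :=
  le_antisymm (hi ▸ minCoord_le x i) (Finset.le_inf' _ _ fun i _ => h i)

/-- The barycenter of a simplex. -/
def ctr (q : ℕ) : stdSimplex ℝ (Fin (q + 1)) := stdSimplex.barycenter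

@[simp]
lemma ctr_apply (q : ℕ) (i) : ctr q i = (q + 1 : ℝ)⁻¹ := by
  refine (stdSimplex.barycenter_apply (𝕜 := ℝ) i).trans ?_
  simp

/-- The radial description of a simplex as the cone over its boundary. -/
def coneMap (q : ℕ) (p : bd q × unitInterval) : stdSimplex ℝ (Fin (q + 2)) :=
  cvx p.1.1 (ctr (q + 1)) p.2

lemma continuous_coneMap (q : ℕ) : Continuous (coneMap q) :=
  continuous_cvx.comp (((continuous_subtype_val.comp continuous_fst).prodMk continuous_const).prodMk
    continuous_snd)

lemma minCoord_coneMap {q : ℕ} (p : bd q × unitInterval) :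
    minCoord (coneMap q p) = p.2 * (q + 2 : ℝ)⁻¹ := by
  obtain ⟨⟨x, i, hi⟩, s⟩ := p
  have h2 : (0 : ℝ) ≤ 1 - s := sub_nonneg.2 s.2.2
  refine minCoord_eq_of (i := i) (fun j => ?_) ?_
  · have := mul_nonneg h2 (x.2.1 j)
    simp only [coneMap, cvx_apply, ctr_apply]
    push_cast
    rw [show ((q : ℝ) + 1 + 1) = q + 2 by ring]
    linarith [show (0:ℝ) ≤ (1 - s) * x j from this]
  · simp only [coneMap, cvx_apply, ctr_apply, hi]
    push_cast
    ring

lemma coneMap_fiber {q : ℕ} {p p' : bd q × unitInterval} (h : coneMap q p = coneMap q p') :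
    p.2 = p'.2 ∧ (p.2 = 1 ∨ p = p') := by
  have h2 : p.2 = p'.2 := by
    have := congrArg minCoord h
    rw [minCoord_coneMap, minCoord_coneMap] at this
    have hq : (q + 2 : ℝ)⁻¹ ≠ 0 := by positivity
    exact Subtype.ext (mul_right_cancel₀ hq this)
  refine ⟨h2, or_iff_not_imp_left.2 fun h1 => Prod.ext (Subtype.ext ?_) h2⟩
  ext i
  have := congrArg (fun x : stdSimplex ℝ (Fin (q + 2)) => x i) h
  simp only [coneMap, cvx_apply, ← h2] at this
  have h3 : (1 - (p.2 : ℝ)) ≠ 0 := sub_ne_zero.2 fun h => h1 (Subtype.ext h.symm)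
  exact mul_left_cancel₀ h3 (by linarith)

/-- A point other than the barycenter lies on a ray from the barycenter through the boundary. -/
lemma coneMap_surjective (q : ℕ) : Function.Surjective (coneMap q) := by
  intro x
  have hq : (0 : ℝ) < q + 2 := by positivity
  have hm1 : (q + 2) * minCoord x ≤ 1 := by
    have := minCoord_mul_le x
    push_cast at this
    linarith
  set s : unitInterval := ⟨(q + 2) * minCoord x, by have := minCoord_nonneg x; positivity, hm1⟩
  by_cases h1 : (q + 2) * minCoord x = 1
  · classical
    refine ⟨(⟨stdSimplex.vertex 0, 1, by simp⟩, 1), ?_⟩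
    have hle : ∀ i, (q + 2 : ℝ)⁻¹ ≤ x i := fun i => by
      rw [inv_le_iff_one_le_mul₀' hq, ← h1]
      exact mul_le_mul_of_nonneg_left (minCoord_le x i) hq.le
    have heq := (Finset.sum_eq_sum_iff_of_le (s := Finset.univ) fun i _ => hle i).1 (by
      rw [stdSimplex.sum_eq_one x]; simp; field_simp)
    rw [coneMap, cvx_one]
    ext i
    rw [ctr_apply, ← heq i (Finset.mem_univ i)]
    push_cast
    ring_nf
  · have hlt : 0 < 1 - (q + 2) * minCoord x := sub_pos.2 (lt_of_le_of_ne hm1 h1)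
    refine ⟨(⟨⟨fun i => (x i - minCoord x) / (1 - (q + 2) * minCoord x), fun i =>
      div_nonneg (sub_nonneg.2 (minCoord_le x i)) hlt.le, ?_⟩, ?_⟩, s), ?_⟩
    · rw [← Finset.sum_div, Finset.sum_sub_distrib, stdSimplex.sum_eq_one, Finset.sum_const,
        div_eq_one_iff_eq hlt.ne']
      simp
    · obtain ⟨i, hi⟩ := exists_eq_minCoord x
      refine ⟨i, ?_⟩
      change (x i - minCoord x) / _ = 0
      rw [hi, sub_self, zero_div]
    · ext i
      change (1 - (q + 2) * minCoord x) * ((x i - minCoord x) / (1 - (q + 2) * minCoord x)) +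
        (q + 2) * minCoord x * ctr (q + 1) i = x i
      rw [ctr_apply]
      push_cast
      field_simp
      ring

lemma isQuotientMap_coneMap (q : ℕ) : Topology.IsQuotientMap (coneMap q) :=
  Topology.IsQuotientMap.of_surjective_continuous (coneMap_surjective q) (continuous_coneMap q)

@[simp]
lemma coneMap_zero {q : ℕ} (x : bd q) : coneMap q (x, 0) = x := cvx_zero _ _

section Extends

variable {T : Type*} (d : T → T → ℕ)

/-- Every map from the boundary of the `(q + 1)`-simplex to the Vietoris–Rips complex for the
value `k` extends to the simplex as a map to the Vietoris–Rips complex for the value `l`. -/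
def ExtendsVR (q k l : ℕ) : Prop :=
  ∀ μ : bd q → T → ℝ, IsVRMap d k μ →
    ∃ M : stdSimplex ℝ (Fin (q + 2)) → T → ℝ, IsVRMap d l M ∧ ∀ x : bd q, M x = μ x

variable {d}

/-- Extendability of maps from the boundary is invariant under straight line homotopies, which fill
a collar of the boundary. -/
lemma exists_extension_of_close {q l : ℕ} {f₀ f₁ : bd q → T → ℝ} (h₀ : IsVRMap d l f₀)
    (h₁ : IsVRMap d l f₁)
    (hc : ∀ z s t, f₀ z s ≠ 0 → f₁ z t ≠ 0 → d s t ≤ l ∧ d t s ≤ l)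
    {F : stdSimplex ℝ (Fin (q + 2)) → T → ℝ} (hF : IsVRMap d l F) (hF₁ : ∀ x : bd q, F x = f₁ x) :
    ∃ M : stdSimplex ℝ (Fin (q + 2)) → T → ℝ, IsVRMap d l M ∧ ∀ x : bd q, M x = f₀ x := by
  let c₀ : unitInterval → ℝ := fun s => min (2 * s) 1
  let c₁ : unitInterval → unitInterval := fun s => Set.projIcc 0 1 zero_le_one (2 * s - 1)
  have hc₀ : Continuous c₀ := by fun_prop
  have hc₁ : Continuous c₁ := continuous_projIcc.comp (by fun_prop)
  have hA : IsVRMap d l fun (p : bd q × unitInterval) t =>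
      (1 - c₀ p.2) * f₀ p.1 t + c₀ p.2 * f₁ p.1 t :=
    (h₀.comp continuous_fst).mix (h₁.comp continuous_fst) (fun z => hc z.1)
      (hc₀.comp continuous_snd) (fun z => le_min (by have := z.2.2.1; positivity) zero_le_one)
      fun z => min_le_right _ _
  have hB : IsVRMap d l fun p : bd q × unitInterval => F (coneMap q (p.1, c₁ p.2)) :=
    hF.comp ((continuous_coneMap q).comp (continuous_fst.prodMk (hc₁.comp continuous_snd)))
  have hG := hA.ite_le hB (a := fun p => (p.2 : ℝ)) (by fun_prop) (1 / 2) (by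
    rintro ⟨x, s⟩ (hs : (s : ℝ) = 1 / 2)
    have e0 : c₀ s = 1 := by simp [c₀, hs]
    have e1 : c₁ s = 0 := by
      have : 2 * (s : ℝ) - 1 = 0 := by rw [hs]; norm_num
      simp only [c₁, this]
      exact Set.projIcc_left zero_le_one
    funext t
    dsimp only
    rw [e0, e1, coneMap_zero, hF₁]
    ring)
  obtain ⟨M, hM, hM'⟩ := hG.exists_descend (isQuotientMap_coneMap q) (by
    intro p p' h
    obtain ⟨h2, h1 | rfl⟩ := coneMap_fiber h
    · have h1' : p'.2 = 1 := h2 ▸ h1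
      have e1 : c₁ 1 = 1 := by
        simp only [c₁]
        refine Set.projIcc_of_right_le _ ?_
        norm_num
      simp only [h1, h1', e1, coneMap, cvx_one]
      norm_num
    · rfl)
  refine ⟨M, hM, fun x => ?_⟩
  rw [← coneMap_zero x, hM']
  have e0 : c₀ 0 = 0 := by simp [c₀]
  funext t
  simp [e0]

end Extends

/-! ### Simplicial approximation -/

/-- The poset `{0, …, p}`. -/
abbrev ord (p : ℕ) : PartOrd.{u} := SimplexCategory.toPartOrd.obj (SimplexCategory.mk p)

instance (p : ℕ) : Fintype (ord.{u} p) := inferInstanceAs (Fintype (ULift (Fin (p + 1))))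

/-- The elements of `ord p` are the numbers `0, …, p`. -/
def ordEquiv (p : ℕ) : ord.{u} p ≃o Fin (p + 1) where
  toFun a := ULift.down a
  invFun i := ULift.up i
  left_inv _ := rfl
  right_inv _ := rfl
  map_rel_iff' := Iff.rfl

lemma heightLE_ord (p : ℕ) : HeightLE (ord.{u} p) p :=
  ⟨fun a => ordEquiv p a, fun _ _ h => (ordEquiv p).strictMono h,
    fun a => Nat.lt_succ_iff.1 (ordEquiv p a).2⟩

/-- A standard simplex as the order complex of a linear order. -/
def toOC {p : ℕ} (x : stdSimplex ℝ (Fin (p + 1))) : OC (ord.{u} p) :=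
  ⟨fun a => x (ordEquiv p a), fun _ => x.2.1 _,
    (Equiv.sum_comp (ordEquiv p).toEquiv fun i => x i).trans (stdSimplex.sum_eq_one x),
    fun a b _ _ => ((le_total (ordEquiv p a) (ordEquiv p b)).imp
      (ordEquiv p).le_iff_le.1 (ordEquiv p).le_iff_le.1)⟩

/-- A point of the order complex of a linear order as a point of the standard simplex. -/
def ofOC {p : ℕ} (μ : OC (ord.{u} p)) : stdSimplex ℝ (Fin (p + 1)) :=
  ⟨fun i => μ.1 ((ordEquiv p).symm i), fun _ => μ.nonneg _,
    (Equiv.sum_comp (ordEquiv p).symm.toEquiv μ.1).trans μ.sum_eq⟩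

lemma continuous_toOC {p : ℕ} : Continuous (toOC.{u} (p := p)) :=
  Continuous.subtype_mk (continuous_pi fun a => continuous_coord (ordEquiv p a)) _

lemma dist_le_of_coord {ι : Type*} [Fintype ι] {x y : stdSimplex ℝ ι} {r : ℝ} (hr : 0 ≤ r)
    (h : ∀ i, |x i - y i| ≤ r) : dist x y ≤ r :=
  (dist_pi_le_iff hr).2 h

/-- Fine subdivisions of a simplex carry a labelling of the vertices by points of `T` which are in
the support of a given map, in a neighbourhood of the star of the vertex. -/
lemma exists_labels {T : Type*} {d : T → T → ℕ} {l p : ℕ}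
    {F : stdSimplex ℝ (Fin (p + 1)) → T → ℝ} (hF : IsVRMap d l F) :
    ∃ n₀, ∀ n ≥ n₀, ∃ t : (sdP n).obj (ord.{u} p) → T, ∀ w x,
      (∀ i, |x i - ofOC (pos n w) i| ≤ ((p : ℝ) / (p + 1)) ^ n) → F x (t w) ≠ 0 := by
  obtain ⟨δ, hδ, h⟩ := lebesgue_number_lemma_of_metric (s := Set.univ)
    (c := fun t : T => {x | F x t ≠ 0}) isCompact_univ
    (fun t => isOpen_ne_fun (hF.continuous t) continuous_const)
    (fun x _ => Set.mem_iUnion.2 (hF.exists_ne x))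
  have h1 : (p : ℝ) / (p + 1) < 1 := by rw [div_lt_one (by positivity)]; linarith
  have h0 : (0 : ℝ) ≤ (p : ℝ) / (p + 1) := by positivity
  obtain ⟨n₀, hn₀⟩ := exists_pow_lt_of_lt_one hδ h1
  refine ⟨n₀, fun n hn => ?_⟩
  choose t ht using fun w : (sdP n).obj (ord.{u} p) => h (ofOC (pos n w)) (Set.mem_univ _)
  refine ⟨t, fun w x hx => ht w ?_⟩
  rw [Metric.mem_ball]
  exact (dist_le_of_coord (by positivity) hx).trans_lt
    ((pow_le_pow_of_le_one h0 h1.le hn).trans_lt hn₀)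

/-- Simplicial approximation: a map from a simplex is contiguous to one that is affine on a fine
subdivision. The supports of the latter are contained in those of the former. -/
lemma exists_simplicial_approx {T : Type*} {d : T → T → ℕ} {l p : ℕ}
    {F : stdSimplex ℝ (Fin (p + 1)) → T → ℝ} (hF : IsVRMap d l F) :
    ∃ (n : ℕ) (t : (sdP n).obj (ord.{u} p) → T),
      (∀ w w', w ≤ w' → d (t w) (t w') ≤ l ∧ d (t w') (t w) ≤ l) ∧
      ∀ x s, labelMap (fun x => layN n (toOC x)) t x s ≠ 0 → F x s ≠ 0 := by
  obtain ⟨n, hn⟩ := exists_labels.{u} hF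
  obtain ⟨t, ht⟩ := hn n le_rfl
  refine ⟨n, t, fun w w' h => ?_, fun x s hs => ?_⟩
  · have h1 := ht w (ofOC (pos n w)) fun i => by rw [sub_self, abs_zero]; positivity
    have h2 := ht w' (ofOC (pos n w)) fun i => abs_pos_sub_pos_le (heightLE_ord p) _ n w w' h
    exact ⟨hF.clique _ _ _ h1 h2, hF.clique _ _ _ h2 h1⟩
  · obtain ⟨w, hw, rfl⟩ := labelMap_ne_zero_iff.1 hs
    exact ht w x fun i => abs_sub_pos_le (heightLE_ord p) n (toOC x) w hw ((ordEquiv p).symm i)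

/-- The inclusion of the `i`-th face. -/
abbrev face {q : ℕ} (i : Fin (q + 2)) : ord.{u} q ⟶ ord.{u} (q + 1) :=
  SimplexCategory.toPartOrd.map (SimplexCategory.δ i)

lemma face_reflects {q : ℕ} (i : Fin (q + 2)) (a b : ord.{u} q)
    (h : (face i).hom a ≤ (face i).hom b) : a ≤ b :=
  (ordEquiv q).le_iff_le.1 ((Fin.succAboveOrderEmb i).le_iff_le.1
    (show i.succAbove (ordEquiv q a) ≤ i.succAbove (ordEquiv q b) from h))

lemma mem_range_face {q : ℕ} {i : Fin (q + 2)} {a : ord.{u} (q + 1)} :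
    a ∈ Set.range (face i).hom ↔ ordEquiv (q + 1) a ≠ i := by
  constructor
  · rintro ⟨b, rfl⟩
    exact Fin.succAbove_ne i (ordEquiv q b)
  · intro h
    obtain ⟨b, hb⟩ := Fin.exists_succAbove_eq h
    exact ⟨(ordEquiv q).symm b, (ordEquiv (q + 1)).injective hb⟩

/-- Relative simplicial approximation: a labelling of the boundary of a subdivided simplex extends
to all sufficiently fine subdivisions of the simplex. -/
lemma exists_labels_extending {T : Type*} {d : T → T → ℕ} {q k l : ℕ} (hkl : k ≤ l)
    (hE : ExtendsVR d q k l) (n : ℕ) (a : (sdP n).obj (ord.{u} (q + 1)) → T)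
    (ha : ∀ i w w', w ∈ Set.range ((sdP n).map (face i)).hom →
      w' ∈ Set.range ((sdP n).map (face i)).hom → w ≤ w' → d (a w) (a w') ≤ k ∧ d (a w') (a w) ≤ k) :
    ∃ j₀, ∀ j ≥ j₀, ∃ b : (sdP (n + j)).obj (ord.{u} (q + 1)) → T,
      (∀ w w', w ≤ w' → d (b w) (b w') ≤ l ∧ d (b w') (b w) ≤ l) ∧
      ∀ i w, w ∈ Set.range ((sdP (n + j)).map (face i)).hom → b w = a (lastN n j w) := by
  classical
  have hface : ∀ (x : bd q) w, (layN n (toOC.{u} x.1)).1 w ≠ 0 → ∀ i, x.1 i = 0 →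
      w ∈ Set.range ((sdP n).map (face i)).hom := fun x w hw i hi =>
    mem_range_of_layN_ne_zero (face i) (face_reflects i) (toOC x.1)
      (fun b hb => mem_range_face.2 fun hbi => hb (by subst hbi; exact hi)) n w hw
  have hμ : IsVRMap d k (labelMap (fun x : bd q => layN n (toOC.{u} x.1)) a) := by
    refine isVRMap_labelMap
      ((continuous_layN n).comp (continuous_toOC.comp continuous_subtype_val)) fun x w w' hw hw' => ?_
    obtain ⟨i, hi⟩ := x.2
    rcases OC.comparable _ hw hw' with h | h
    · exact (ha i _ _ (hface x w hw i hi) (hface x w' hw' i hi) h).1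
    · exact (ha i _ _ (hface x w' hw' i hi) (hface x w hw i hi) h).2
  obtain ⟨M, hM, hMμ⟩ := hE _ hμ
  obtain ⟨n₀, hn₀⟩ := exists_labels.{u} hM
  refine ⟨n₀ + 1, fun j hj => ?_⟩
  obtain ⟨t, ht⟩ := hn₀ (n + j) (by omega)
  -- the support of `M` at a boundary vertex contains the prescribed label
  have hbdry : ∀ i w, w ∈ Set.range ((sdP (n + j)).map (face i)).hom →
      M (ofOC (pos (n + j) w)) (a (lastN n j w)) ≠ 0 := by
    intro i w hw
    have hmem : ofOC (pos (n + j) w) ∈ bd q := by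
      refine ⟨i, ?_⟩
      by_contra h
      exact mem_range_face.1 (mem_range_of_pos_ne_zero (face i) (n + j) hw
        (a := (ordEquiv (q + 1)).symm i) h) rfl
    rw [hMμ ⟨_, hmem⟩, labelMap_ne_zero_iff]
    exact ⟨_, layN_pos_ne_zero n j w, rfl⟩
  have hself : ∀ w, M (ofOC (pos (n + j) w)) (t w) ≠ 0 := fun w =>
    ht w _ fun i => by rw [sub_self, abs_zero]; positivity
  have hnear : ∀ w w', w ≤ w' ∨ w' ≤ w → M (ofOC (pos (n + j) w)) (t w') ≠ 0 := by
    intro w w' h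
    refine ht w' _ fun i => ?_
    rcases h with h | h
    · exact abs_pos_sub_pos_le (heightLE_ord _) _ _ w w' h
    · rw [abs_sub_comm]
      exact abs_pos_sub_pos_le (heightLE_ord _) _ _ w' w h
  obtain ⟨m, hm⟩ : ∃ m, n + j = m + 1 := ⟨n + j - 1, by omega⟩
  have hfull : ∀ (i : Fin (q + 2)) w w', w ≤ w' → w' ∈ Set.range ((sdP (n + j)).map (face i)).hom →
      w ∈ Set.range ((sdP (n + j)).map (face.{u} i)).hom := by
    rw [hm]
    exact fun i w w' h h' => mem_range_sdP_of_le (face i) (face_reflects i) m h h'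
  let B : Set ((sdP (n + j)).obj (ord.{u} (q + 1))) :=
    {w | ∃ i, w ∈ Set.range ((sdP (n + j)).map (face i)).hom}
  refine ⟨fun w => if w ∈ B then a (lastN n j w) else t w, fun w w' h => ?_, fun i w hw =>
    if_pos ⟨i, hw⟩⟩
  dsimp only
  split_ifs with h1 h2 h2
  · obtain ⟨i, hi⟩ := h2
    have hlast : ∀ w, w ∈ Set.range ((sdP (n + j)).map (face.{u} i)).hom →
        lastN n j w ∈ Set.range ((sdP n).map (face i)).hom := by
      rintro _ ⟨v, rfl⟩
      exact ⟨_, (lastN_map _ n j v).symm⟩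
    have := ha i _ _ (hlast w (hfull i w w' h hi)) (hlast w' hi) (lastN_mono n j h)
    exact ⟨this.1.trans hkl, this.2.trans hkl⟩
  · obtain ⟨i, hi⟩ := h1
    have e1 := hbdry i w hi
    have e2 := hnear w w' (Or.inl h)
    exact ⟨hM.clique _ _ _ e1 e2, hM.clique _ _ _ e2 e1⟩
  · obtain ⟨i, hi⟩ := h2
    have e1 := hbdry i w' hi
    have e2 := hnear w' w (Or.inr h)
    exact ⟨hM.clique _ _ _ e2 e1, hM.clique _ _ _ e1 e2⟩
  · have e1 := hself w
    have e2 := hnear w w' (Or.inl h)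
    exact ⟨hM.clique _ _ _ e1 e2, hM.clique _ _ _ e2 e1⟩

/-! ### Points of the geometric realization -/

section Realization

/-- The topological simplex in the geometric realization of `X` that belongs to the simplex `σ`. -/
def realMap {X : SSet.{u}} {n : SimplexCategoryᵒᵖ} (σ : X.obj n) :
    C(stdSimplex ℝ (Fin (n.unop.len + 1)), SSet.toTop.obj X) :=
  TopCat.toSSetObjEquiv (SSet.toTop.obj X) n ((sSetTopAdj.unit.app X).app n σ)

lemma toSSetObjEquiv_map {Y : TopCat.{u}} {n m : SimplexCategoryᵒᵖ} (θ : n ⟶ m)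
    (s : (TopCat.toSSet.obj Y).obj n) (x : stdSimplex ℝ (Fin (m.unop.len + 1))) :
    TopCat.toSSetObjEquiv Y m ((TopCat.toSSet.obj Y).map θ s) x =
      TopCat.toSSetObjEquiv Y n s (stdSimplex.map θ.unop x) := rfl

variable {X : SSet.{u}}

lemma realMap_map {n m : SimplexCategoryᵒᵖ} (θ : n ⟶ m) (σ : X.obj n)
    (x : stdSimplex ℝ (Fin (m.unop.len + 1))) :
    realMap (X.map θ σ) x = realMap σ (stdSimplex.map θ.unop x) := by
  unfold realMap
  rw [← toSSetObjEquiv_map]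
  congr 2
  exact ConcreteCategory.congr_hom ((sSetTopAdj.unit.app X).naturality θ) σ

lemma toTop_map_realMap {Y : SSet.{u}} (f : X ⟶ Y) {n : SimplexCategoryᵒᵖ} (σ : X.obj n)
    (x : stdSimplex ℝ (Fin (n.unop.len + 1))) :
    SSet.toTop.map f (realMap σ x) = realMap (f.app n σ) x := by
  have h := ConcreteCategory.congr_hom
    (congrArg (fun g : X ⟶ _ => g.app n) (sSetTopAdj.unit.naturality f)) σ
  exact (congrArg (fun s => TopCat.toSSetObjEquiv (SSet.toTop.obj Y) n s x) h).symm

/-- A continuous map out of the geometric realization is a compatible family of maps out of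
topological simplices. -/
lemma exists_desc {Y : Type u} [TopologicalSpace Y]
    (g : ∀ n : SimplexCategoryᵒᵖ, X.obj n → C(stdSimplex ℝ (Fin (n.unop.len + 1)), Y))
    (hg : ∀ {n m : SimplexCategoryᵒᵖ} (θ : n ⟶ m) (σ : X.obj n) (x),
      g m (X.map θ σ) x = g n σ (stdSimplex.map θ.unop x)) :
    ∃ f : C(SSet.toTop.obj X, Y), ∀ (n : SimplexCategoryᵒᵖ) (σ : X.obj n) (x),
      f (realMap σ x) = g n σ x := by
  let G : X ⟶ TopCat.toSSet.obj (TopCat.of Y) :=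
    { app n := TypeCat.ofHom fun σ => (TopCat.toSSetObjEquiv (TopCat.of Y) n).symm (g n σ)
      naturality n m θ := by
        ext σ
        apply (TopCat.toSSetObjEquiv (TopCat.of Y) m).injective
        ext x
        refine Eq.trans ?_ (toSSetObjEquiv_map θ _ x).symm
        have e {m : SimplexCategoryᵒᵖ} (τ : X.obj m) (x : stdSimplex ℝ (Fin (m.unop.len + 1))) :
            TopCat.toSSetObjEquiv (TopCat.of Y) m
              ((TopCat.toSSetObjEquiv (TopCat.of Y) m).symm (g m τ)) x = g m τ x :=
          congrArg (fun f : C(_, _) => f x) (Equiv.apply_symm_apply _ _)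
        exact (e _ x).trans ((hg θ σ x).trans (e _ _).symm) }
  refine ⟨((sSetTopAdj.homEquiv X (TopCat.of Y)).symm G).hom, fun n σ x => ?_⟩
  have h : (sSetTopAdj.homEquiv X (TopCat.of Y)) ((sSetTopAdj.homEquiv X (TopCat.of Y)).symm G) = G :=
    Equiv.apply_symm_apply _ _
  rw [Adjunction.homEquiv_unit] at h
  have h2 := congrArg (fun f : X ⟶ TopCat.toSSet.obj (TopCat.of Y) =>
    TopCat.toSSetObjEquiv (TopCat.of Y) n (f.app n σ) x) h
  have h3 : TopCat.toSSetObjEquiv (TopCat.of Y) n (G.app n σ) x = g n σ x :=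
    congrArg (fun f : C(_, _) => f x) (Equiv.apply_symm_apply _ _)
  exact h2.trans h3

lemma realization_hom_ext {Y : Type u} [TopologicalSpace Y] {f g : C(SSet.toTop.obj X, Y)}
    (h : ∀ (n : SimplexCategoryᵒᵖ) (σ : X.obj n) (x), f (realMap σ x) = g (realMap σ x)) :
    f = g := by
  have : (TopCat.ofHom f : SSet.toTop.obj X ⟶ TopCat.of Y) = TopCat.ofHom g := by
    apply (sSetTopAdj.homEquiv X (TopCat.of Y)).injective
    rw [Adjunction.homEquiv_unit, Adjunction.homEquiv_unit]
    ext n σ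
    apply (TopCat.toSSetObjEquiv (TopCat.of Y) n).injective
    ext x
    exact h n σ x
  exact congrArg TopCat.Hom.hom this

/-- The topological simplices cover the geometric realization: two maps to an indiscrete space
that agree on them are equal. -/
lemma exists_realMap_eq (y : SSet.toTop.obj X) :
    ∃ (n : SimplexCategoryᵒᵖ) (σ : X.obj n) (x : _), realMap σ x = y := by
  let _ : TopologicalSpace (ULift.{u} Prop) := ⊤
  let f : C(SSet.toTop.obj X, ULift.{u} Prop) :=
    ⟨fun y => ⟨∃ (n : SimplexCategoryᵒᵖ) (σ : X.obj n) (x : _), realMap σ x = y⟩, continuous_top⟩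
  let g : C(SSet.toTop.obj X, ULift.{u} Prop) := ⟨fun _ => ⟨True⟩, continuous_top⟩
  have h : f = g := by
    apply realization_hom_ext
    intro n σ x
    have : (∃ (n' : SimplexCategoryᵒᵖ) (σ' : X.obj n') (x' : _), realMap σ' x' = realMap σ x) :=
      ⟨n, σ, x, rfl⟩
    exact congrArg ULift.up (eq_true this)
  have h2 := congrArg (fun k : C(SSet.toTop.obj X, ULift.{u} Prop) => (k y).down) h
  exact of_eq_true h2

end Realization

/-! ### The realization of a Vietoris–Rips complex -/

section VRRealization

variable {T : Type u} {d : T → T → ℕ} {k l : ℕ}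

/-- The geometric realization of a Vietoris–Rips complex. -/
abbrev VRReal (d : T → T → ℕ) (k : ℕ) : TopCat.{u} := SSet.toTop.obj (VR d k : SSet.{u})

/-- The topological simplex in the realization of the Vietoris–Rips complex that belongs to a
family of points indexed by a finite linearly ordered set. -/
def geo {J : Type*} [LinearOrder J] [Fintype J] [Nonempty J] (t : J → T)
    (ht : ∀ i j, d (t i) (t j) ≤ k) : C(stdSimplex ℝ J, VRReal d k) :=
  let e : Fin (Fintype.card J - 1 + 1) ≃o J :=
    Fintype.orderIsoFinOfCardEq J (Nat.succ_pred_eq_of_pos Fintype.card_pos).symm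
  (realMap (X := (VR d k : SSet.{u})) (n := op (SimplexCategory.mk (Fintype.card J - 1)))
    ⟨fun i => t (e i), fun i j => ht (e i) (e j)⟩).comp
    ⟨stdSimplex.map e.symm, stdSimplex.continuous_map _⟩

lemma geo_map {J J' : Type*} [LinearOrder J] [Fintype J] [Nonempty J] [LinearOrder J'] [Fintype J']
    [Nonempty J'] {t : J → T} (ht : ∀ i j, d (t i) (t j) ≤ k) {t' : J' → T}
    (ht' : ∀ i j, d (t' i) (t' j) ≤ k) (θ : J →o J') (h : ∀ j, t' (θ j) = t j)
    (x : stdSimplex ℝ J) : geo t ht x = geo t' ht' (stdSimplex.map θ x) := by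
  let e : Fin (Fintype.card J - 1 + 1) ≃o J :=
    Fintype.orderIsoFinOfCardEq J (Nat.succ_pred_eq_of_pos Fintype.card_pos).symm
  let e' : Fin (Fintype.card J' - 1 + 1) ≃o J' :=
    Fintype.orderIsoFinOfCardEq J' (Nat.succ_pred_eq_of_pos Fintype.card_pos).symm
  let θ' : Fin (Fintype.card J - 1 + 1) →o Fin (Fintype.card J' - 1 + 1) :=
    ⟨fun i => e'.symm (θ (e i)), fun i j hij =>
      e'.symm.monotone (θ.monotone (e.monotone hij))⟩
  let f : SimplexCategory.mk (Fintype.card J - 1) ⟶ SimplexCategory.mk (Fintype.card J' - 1) :=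
    SimplexCategory.Hom.mk θ'
  have h1 := realMap_map (X := (VR d k : SSet.{u})) f.op
    ⟨fun i => t' (e' i), fun i j => ht' (e' i) (e' j)⟩ (stdSimplex.map e.symm x)
  have h2 : (VR d k : SSet.{u}).map f.op ⟨fun i => t' (e' i), fun i j => ht' (e' i) (e' j)⟩ =
      ⟨fun i => t (e i), fun i j => ht (e i) (e j)⟩ := by
    apply Subtype.ext
    funext i
    change t' (e' (e'.symm (θ (e i)))) = _
    rw [OrderIso.apply_symm_apply, h]
  rw [h2] at h1
  refine h1.trans (congrArg (realMap (X := (VR d k : SSet.{u})) _) ?_)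
  have h3 : ((f.op.unop : _ ⟶ _) : _ → _) ∘ (e.symm : J → _) = (e'.symm : J' → _) ∘ (θ : J → J') := by
    funext j
    change e'.symm (θ (e (e.symm j))) = _
    rw [OrderIso.apply_symm_apply]; rfl
  have h4 := stdSimplex.map_comp_apply (S := ℝ) (e.symm : J → _) (f.op.unop : _ → _) x
  have h5 := stdSimplex.map_comp_apply (S := ℝ) (θ : J → J') (e'.symm : J' → _) x
  refine Eq.trans h4 (Eq.trans ?_ h5.symm)
  exact congrArg (fun g => stdSimplex.map (S := ℝ) g x) h3

lemma realMap_eq_geo {n : SimplexCategoryᵒᵖ} (σ : (VR d k : SSet.{u}).obj n)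
    (x : stdSimplex ℝ (Fin (n.unop.len + 1))) : realMap σ x = geo σ.1 σ.2 x := by
  let e : Fin (Fintype.card (Fin (n.unop.len + 1)) - 1 + 1) ≃o Fin (n.unop.len + 1) :=
    Fintype.orderIsoFinOfCardEq _ (Nat.succ_pred_eq_of_pos Fintype.card_pos).symm
  let f : SimplexCategory.mk (Fintype.card (Fin (n.unop.len + 1)) - 1) ⟶ n.unop :=
    SimplexCategory.Hom.mk ⟨e, e.monotone⟩
  have h1 := realMap_map (X := (VR d k : SSet.{u})) f.op σ (stdSimplex.map e.symm x)
  refine Eq.trans ?_ h1.symm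
  have h4 := stdSimplex.map_comp_apply (S := ℝ) (e.symm : _ → _) (f.op.unop : _ → _) x
  refine congrArg (realMap σ) (Eq.trans ?_ h4.symm)
  have h3 : (f.op.unop : _ → _) ∘ (e.symm : _ → _) = id := by
    funext j
    exact OrderIso.apply_symm_apply _ _
  exact ((congrArg (fun g => stdSimplex.map (S := ℝ) g x) h3).trans (stdSimplex.map_id_apply x)).symm

lemma toTop_map_geo (h : k ≤ l) {J : Type*} [LinearOrder J] [Fintype J] [Nonempty J] {t : J → T}
    (ht : ∀ i j, d (t i) (t j) ≤ k) (x : stdSimplex ℝ J) :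
    SSet.toTop.map (SSet.Subcomplex.homOfLE (VR_mono d h)) (geo t ht x) =
      geo t (fun i j => (ht i j).trans h) x :=
  toTop_map_realMap _ _ _

lemma exists_geo_eq (y : VRReal d k) : ∃ (p : ℕ) (t : Fin (p + 1) → T)
    (ht : ∀ i j, d (t i) (t j) ≤ k) (x : stdSimplex ℝ (Fin (p + 1))), geo t ht x = y := by
  obtain ⟨n, σ, x, rfl⟩ := exists_realMap_eq y
  exact ⟨n.unop.len, σ.1, σ.2, x, (realMap_eq_geo σ x).symm⟩

/-- Functions on the set of vertices extend linearly to the realization. -/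
lemma exists_linear_extension (N : T → ℝ) : ∃ f : C(VRReal d k, ℝ),
    ∀ {n : SimplexCategoryᵒᵖ} (σ : (VR d k : SSet.{u}).obj n) (x),
      f (realMap σ x) = ∑ i, x i * N (σ.1 i) := by
  obtain ⟨f, hf⟩ := exists_desc (X := (VR d k : SSet.{u})) (Y := ULift.{u} ℝ)
    (fun n σ => ⟨fun x => ⟨∑ i, x i * N (σ.1 i)⟩, continuous_uliftUp.comp
      (continuous_finsetSum _ fun i _ => (continuous_coord i).mul continuous_const)⟩) (by
      intro n m θ σ x
      refine congrArg ULift.up ?_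
      have : ∀ j, stdSimplex.map θ.unop x j = ∑ i with θ.unop i = j, x i := by
        intro j
        rw [stdSimplex.map_coe, FunOnFinite.linearMap_apply_apply]
      simp_rw [this, Finset.sum_mul]
      rw [← Finset.sum_fiberwise (s := Finset.univ) (g := (θ.unop : _ → _))]
      refine Finset.sum_congr rfl fun j _ => Finset.sum_congr rfl fun i hi => ?_
      rw [← (Finset.mem_filter.1 hi).2]
      rfl)
  exact ⟨⟨fun y => (f y).down, continuous_uliftDown.comp f.continuous⟩, fun σ x =>
    congrArg ULift.down (hf _ σ x)⟩

/-- The linear extension of a function on the set of vertices to the realization. -/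
def linExt (N : T → ℝ) : C(VRReal d k, ℝ) := (exists_linear_extension N).choose

lemma linExt_geo (N : T → ℝ) {J : Type*} [LinearOrder J] [Fintype J] [Nonempty J] {t : J → T}
    (ht : ∀ i j, d (t i) (t j) ≤ k) (x : stdSimplex ℝ J) :
    linExt N (geo t ht x) = ∑ i, x i * N (t i) := by
  let e : Fin (Fintype.card J - 1 + 1) ≃o J :=
    Fintype.orderIsoFinOfCardEq J (Nat.succ_pred_eq_of_pos Fintype.card_pos).symm
  refine ((exists_linear_extension (d := d) (k := k) N).choose_spec _ _).trans ?_
  rw [← Equiv.sum_comp e.toEquiv]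
  refine Finset.sum_congr rfl fun i _ => ?_
  congr 1
  have := FunOnFinite.linearMap_apply_apply ℝ ℝ (e.symm : J → Fin (Fintype.card J - 1 + 1)) x i
  refine this.trans ?_
  rw [Finset.sum_eq_single (e i)] <;> simp [OrderIso.symm_apply_eq]

open Classical in
/-- The barycentric coordinates of a point of the realization. -/
def baryCoord (y : VRReal d k) (t : T) : ℝ := linExt (Pi.single t 1) y

open Classical in
lemma baryCoord_geo {J : Type*} [LinearOrder J] [Fintype J] [Nonempty J] {t : J → T}
    (ht : ∀ i j, d (t i) (t j) ≤ k) (x : stdSimplex ℝ J) (s : T) :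
    baryCoord (geo t ht x) s = ∑ i with t i = s, x i := by
  rw [baryCoord, linExt_geo, Finset.sum_filter]
  refine Finset.sum_congr rfl fun i _ => ?_
  rw [Pi.single_apply]
  split_ifs <;> simp

lemma continuous_baryCoord (t : T) : Continuous fun y : VRReal d k => baryCoord y t :=
  (linExt _).continuous

lemma baryCoord_nonneg (y : VRReal d k) (t : T) : 0 ≤ baryCoord y t := by
  classical
  obtain ⟨p, s, hs, x, rfl⟩ := exists_geo_eq y
  rw [baryCoord_geo]
  exact Finset.sum_nonneg fun i _ => x.2.1 i

lemma baryCoord_ne_zero {J : Type*} [LinearOrder J] [Fintype J] [Nonempty J] {t : J → T}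
    {ht : ∀ i j, d (t i) (t j) ≤ k} {x : stdSimplex ℝ J} {s : T}
    (h : baryCoord (geo t ht x) s ≠ 0) : ∃ i, t i = s ∧ x i ≠ 0 := by
  classical
  rw [baryCoord_geo] at h
  obtain ⟨i, hi, h⟩ := Finset.exists_ne_zero_of_sum_ne_zero h
  exact ⟨i, (Finset.mem_filter.1 hi).2, h⟩

lemma baryCoord_toTop_map (h : k ≤ l) (y : VRReal d k) :
    baryCoord (SSet.toTop.map (SSet.Subcomplex.homOfLE (VR_mono d h)) y) = baryCoord y := by
  classical
  obtain ⟨p, s, hs, x, rfl⟩ := exists_geo_eq y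
  funext t
  rw [toTop_map_geo h, baryCoord_geo, baryCoord_geo]

lemma linExt_eq_sum (N : T → ℝ) (y : VRReal d k) {W : Finset T} (hW : ∀ t ∉ W, baryCoord y t = 0) :
    linExt N y = ∑ t ∈ W, baryCoord y t * N t := by
  classical
  obtain ⟨p, s, hs, x, rfl⟩ := exists_geo_eq y
  rw [linExt_geo]
  have h1 : ∀ i, x i ≠ 0 → s i ∈ W := by
    intro i hi
    by_contra hn
    have h2 := hW _ hn
    rw [baryCoord_geo] at h2
    exact hi ((Finset.sum_eq_zero_iff_of_nonneg fun i _ => x.2.1 i).1 h2 i (by simp))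
  simp_rw [baryCoord_geo, Finset.sum_mul, Finset.sum_filter]
  rw [Finset.sum_comm]
  refine Finset.sum_congr rfl fun i _ => ?_
  by_cases hi : x i = 0
  · simp [hi]
  · rw [Finset.sum_ite_eq, if_pos (h1 i hi)]

lemma sum_baryCoord (y : VRReal d k) {W : Finset T} (hW : ∀ t ∉ W, baryCoord y t = 0) :
    ∑ t ∈ W, baryCoord y t = 1 := by
  have h := linExt_eq_sum 1 y hW
  obtain ⟨p, s, hs, x, hx⟩ := exists_geo_eq y
  rw [← hx, linExt_geo] at h
  simp only [Pi.one_apply, mul_one, stdSimplex.sum_eq_one, hx] at h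
  exact h.symm

/-- The barycentric coordinates of a map from a compact space. The images lie in a finite
subcomplex, as otherwise some linear function on the realization is unbounded on them. -/
lemma isVRMap_baryCoord {Z : Type*} [TopologicalSpace Z] [CompactSpace Z] (f : C(Z, VRReal d k)) :
    IsVRMap d k fun z => baryCoord (f z) := by
  classical
  have hfin : {t | ∃ z, baryCoord (f z) t ≠ 0}.Finite := by
    by_contra hinf
    let t := Set.Infinite.natEmbedding _ hinf
    choose z hz using fun i => (t i).2
    let N : T → ℝ := fun s => ∑' i, if (t i : T) = s then i / baryCoord (f (z i)) s else 0
    have hN : ∀ i, N (t i) = i / baryCoord (f (z i)) (t i) := by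
      intro i
      refine (tsum_eq_single i fun j hj => if_neg fun h => hj ?_).trans (if_pos rfl)
      exact t.injective (Subtype.ext h)
    have hN0 : ∀ s, 0 ≤ N s := fun s => tsum_nonneg fun i => by
      split_ifs
      · exact div_nonneg (Nat.cast_nonneg _) (baryCoord_nonneg _ _)
      · exact le_rfl
    obtain ⟨B, hB⟩ := (isCompact_range ((linExt N).comp f).continuous).bddAbove
    obtain ⟨i, hi⟩ := exists_nat_gt B
    have h1 : linExt N (f (z i)) ≤ B := hB ⟨z i, rfl⟩
    obtain ⟨p, s, hs, x, hx⟩ := exists_geo_eq (f (z i))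
    have hW : ∀ r ∉ Finset.univ.image s, baryCoord (f (z i)) r = 0 := by
      intro r hr
      by_contra hn
      rw [← hx] at hn
      obtain ⟨j, hj, -⟩ := baryCoord_ne_zero hn
      exact hr (by simp [← hj])
    rw [linExt_eq_sum N _ hW] at h1
    have h2 : baryCoord (f (z i)) (t i) * N (t i) ≤ B := by
      refine le_trans (Finset.single_le_sum (f := fun r => baryCoord (f (z i)) r * N r)
        (fun r _ => mul_nonneg (baryCoord_nonneg _ _) (hN0 r)) ?_) h1
      by_contra hn
      exact hz i (hW _ hn)
    rw [hN, mul_div_cancel₀ _ (hz i)] at h2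
    linarith
  refine ⟨fun t => (continuous_baryCoord t).comp f.continuous, fun z t => baryCoord_nonneg _ _,
    ⟨hfin.toFinset, fun z t ht => ?_, fun z => ?_⟩, fun z s t hs ht => ?_⟩
  · by_contra hn
    exact ht (by simpa using ⟨z, hn⟩)
  · refine sum_baryCoord (f z) fun t ht => ?_
    by_contra hn
    exact ht (by simpa using ⟨z, hn⟩)
  · obtain ⟨p, r, hr, x, hx⟩ := exists_geo_eq (f z)
    rw [← hx] at hs ht
    obtain ⟨i, rfl, -⟩ := baryCoord_ne_zero hs
    obtain ⟨j, rfl, -⟩ := baryCoord_ne_zero ht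
    exact hr i j

end VRRealization

/-! ### Realizing families of barycentric coordinates -/

section Realize

variable {T : Type u} {d : T → T → ℕ} {k l : ℕ}

/-- A probability measure supported on the finite set `C`, as a point of a simplex. -/
def finsetPt (C : Finset T) (ν : T → ℝ) (h0 : ∀ t, 0 ≤ ν t) (h1 : ∑ t ∈ C, ν t = 1) :
    stdSimplex ℝ C :=
  ⟨fun t => ν t, fun t => h0 t, by rw [← h1]; exact Finset.sum_coe_sort C ν⟩

lemma nonempty_of_sum_eq_one {C : Finset T} {ν : T → ℝ} (h1 : ∑ t ∈ C, ν t = 1) : Nonempty C := by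
  rcases C.eq_empty_or_nonempty with rfl | ⟨t, ht⟩
  · simp at h1
  · exact ⟨⟨t, ht⟩⟩

/-- The point of the realization with the given barycentric coordinates, which are supported on
the clique `C`. -/
def realPt [LinearOrder T] (C : Finset T) (hC : ∀ s ∈ C, ∀ t ∈ C, d s t ≤ k) (ν : T → ℝ)
    (h0 : ∀ t, 0 ≤ ν t) (h1 : ∑ t ∈ C, ν t = 1) : VRReal d k :=
  haveI := nonempty_of_sum_eq_one h1
  geo (J := C) Subtype.val (fun s t => hC s s.2 t t.2) (finsetPt C ν h0 h1)

lemma map_finsetPt {C C' : Finset T} (hCC : C ⊆ C') {ν : T → ℝ} (h0 : ∀ t, 0 ≤ ν t)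
    (h1 : ∑ t ∈ C, ν t = 1) (h1' : ∑ t ∈ C', ν t = 1) (hoff : ∀ t ∉ C, ν t = 0) :
    stdSimplex.map (fun t : C => (⟨t, hCC t.2⟩ : C')) (finsetPt C ν h0 h1) = finsetPt C' ν h0 h1' := by
  classical
  ext t
  rw [stdSimplex.map_coe, FunOnFinite.linearMap_apply_apply]
  by_cases ht : (t : T) ∈ C
  · rw [Finset.sum_eq_single ⟨t, ht⟩]
    · rfl
    · intro b hb hne
      have h := congrArg Subtype.val (Finset.mem_filter.1 hb).2
      exact (hne (Subtype.ext h)).elim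
    · simp
  · refine (Finset.sum_eq_zero fun b hb => absurd ?_ ht).trans (hoff t ht).symm
    have := congrArg Subtype.val (Finset.mem_filter.1 hb).2
    exact this ▸ b.2

lemma realPt_subset [LinearOrder T] {C C' : Finset T} (hCC : C ⊆ C')
    (hC' : ∀ s ∈ C', ∀ t ∈ C', d s t ≤ k) {ν : T → ℝ} (h0 : ∀ t, 0 ≤ ν t)
    (h1 : ∑ t ∈ C, ν t = 1) (h1' : ∑ t ∈ C', ν t = 1) (hoff : ∀ t ∉ C, ν t = 0) :
    realPt C (fun s hs t ht => hC' s (hCC hs) t (hCC ht)) ν h0 h1 = realPt C' hC' ν h0 h1' := by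
  have := nonempty_of_sum_eq_one h1
  have := nonempty_of_sum_eq_one h1'
  unfold realPt
  refine (geo_map (J := C) (J' := C') _ (fun s t => hC' s s.2 t t.2)
    ⟨fun t : C => (⟨t, hCC t.2⟩ : C'), fun _ _ h => h⟩ (fun _ => rfl) _).trans (congrArg _ ?_)
  exact map_finsetPt hCC h0 h1 h1' hoff

lemma realPt_congr [LinearOrder T] {C C' : Finset T} (hC : ∀ s ∈ C, ∀ t ∈ C, d s t ≤ k)
    (hC' : ∀ s ∈ C', ∀ t ∈ C', d s t ≤ k) {ν : T → ℝ} (h0 : ∀ t, 0 ≤ ν t)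
    (h1 : ∑ t ∈ C, ν t = 1) (h1' : ∑ t ∈ C', ν t = 1) (hoff : ∀ t ∉ C, ν t = 0)
    (hoff' : ∀ t ∉ C', ν t = 0) : realPt C hC ν h0 h1 = realPt C' hC' ν h0 h1' := by
  have hi : ∀ t ∉ C ∩ C', ν t = 0 := fun t ht => by
    by_cases h : t ∈ C
    · exact hoff' t fun h' => ht (Finset.mem_inter.2 ⟨h, h'⟩)
    · exact hoff t h
  have h2 : ∑ t ∈ C ∩ C', ν t = 1 := by
    rw [← h1]
    exact Finset.sum_subset Finset.inter_subset_left fun t _ ht => hi t ht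
  rw [← realPt_subset Finset.inter_subset_left hC h0 h2 h1 hi,
    ← realPt_subset Finset.inter_subset_right hC' h0 h2 h1' hi]

lemma baryCoord_realPt [LinearOrder T] {C : Finset T} (hC : ∀ s ∈ C, ∀ t ∈ C, d s t ≤ k)
    {ν : T → ℝ} (h0 : ∀ t, 0 ≤ ν t) (h1 : ∑ t ∈ C, ν t = 1) (hoff : ∀ t ∉ C, ν t = 0) :
    baryCoord (realPt C hC ν h0 h1) = ν := by
  have := nonempty_of_sum_eq_one h1
  funext s
  refine (baryCoord_geo _ _ s).trans ?_
  by_cases hs : s ∈ C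
  · rw [Finset.sum_eq_single ⟨s, hs⟩]
    · rfl
    · intro b hb hne
      have h : (b : T) = s := by simpa using hb
      exact absurd (Subtype.ext h) hne
    · simp
  · refine (Finset.sum_eq_zero fun b hb => absurd ?_ hs).trans (hoff s hs).symm
    have h : (b : T) = s := by simpa using hb
    exact h ▸ b.2

/-- A family of barycentric coordinates gives a continuous map to the realization. It is continuous
on each of the finitely many closed sets on which the support is contained in a given clique. -/
lemma exists_realize [LinearOrder T] {Z : Type*} [TopologicalSpace Z] {μ : Z → T → ℝ}
    (hμ : IsVRMap d k μ) : ∃ f : C(Z, VRReal d k), ∀ (z : Z) (C : Finset T)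
      (hC : ∀ s ∈ C, ∀ t ∈ C, d s t ≤ k) (h1 : ∑ t ∈ C, μ z t = 1), (∀ t ∉ C, μ z t = 0) →
      f z = realPt C hC (μ z) (hμ.nonneg z) h1 := by
  classical
  obtain ⟨W, hW0, hW1⟩ := hμ.exists_finset
  let C₀ : Z → Finset T := fun z => W.filter fun t => μ z t ≠ 0
  have hC₀ : ∀ z, ∀ s ∈ C₀ z, ∀ t ∈ C₀ z, d s t ≤ k := fun z s hs t ht =>
    hμ.clique z s t (Finset.mem_filter.1 hs).2 (Finset.mem_filter.1 ht).2
  have hC₀1 : ∀ z, ∑ t ∈ C₀ z, μ z t = 1 := fun z => by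
    rw [Finset.sum_filter_ne_zero, hW1]
  have hC₀off : ∀ z, ∀ t ∉ C₀ z, μ z t = 0 := fun z t ht => by
    by_contra h
    refine ht (Finset.mem_filter.2 ⟨?_, h⟩)
    by_contra h'
    exact h (hW0 z t h')
  let f : Z → VRReal d k := fun z => realPt (C₀ z) (hC₀ z) (μ z) (hμ.nonneg z) (hC₀1 z)
  have hf : ∀ (z : Z) (C : Finset T)
      (hC : ∀ s ∈ C, ∀ t ∈ C, d s t ≤ k) (h1 : ∑ t ∈ C, μ z t = 1), (∀ t ∉ C, μ z t = 0) →
      f z = realPt C hC (μ z) (hμ.nonneg z) h1 := fun z C hC h1 hoff =>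
    realPt_congr _ _ _ _ _ (hC₀off z) hoff
  -- the closed cover by the sets on which the support is contained in a given clique
  let A : W.powerset → Set Z := fun C =>
    {z | (∀ s ∈ C.1, ∀ t ∈ C.1, d s t ≤ k) ∧ ∀ t ∈ W \ C.1, μ z t = 0}
  have hoffA : ∀ C, ∀ z ∈ A C, ∀ t ∉ C.1, μ z t = 0 := fun C z hz t ht => by
    by_cases h : t ∈ W
    · exact hz.2 t (Finset.mem_sdiff.2 ⟨h, ht⟩)
    · exact hW0 z t h
  have hsumA : ∀ C, ∀ z ∈ A C, ∑ t ∈ C.1, μ z t = 1 := fun C z hz => by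
    rw [← hW1 z]
    exact Finset.sum_subset (Finset.mem_powerset.1 C.2) fun t _ ht => hoffA C z hz t ht
  refine ⟨⟨f, ?_⟩, hf⟩
  refine (locallyFinite_of_finite A).continuous ?_ ?_ ?_
  · refine Set.eq_univ_of_forall fun z => Set.mem_iUnion.2
      ⟨⟨C₀ z, Finset.mem_powerset.2 (Finset.filter_subset _ _)⟩, hC₀ z, fun t ht => ?_⟩
    exact hC₀off z t (Finset.mem_sdiff.1 ht).2
  · intro C
    by_cases hC : ∀ s ∈ C.1, ∀ t ∈ C.1, d s t ≤ k
    · have : A C = ⋂ t ∈ W \ C.1, {z | μ z t = 0} := by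
        ext z
        simp only [A, Set.mem_ofPred_eq, Set.mem_iInter]
        exact ⟨fun h => h.2, fun h => ⟨hC, h⟩⟩
      rw [this]
      exact isClosed_biInter fun t _ => isClosed_eq (hμ.continuous t) continuous_const
    · have : A C = ∅ := Set.eq_empty_of_forall_notMem fun z hz => hC hz.1
      rw [this]
      exact isClosed_empty
  · intro C
    rw [continuousOn_iff_continuous_domRestrict]
    rcases isEmpty_or_nonempty (A C) with hA | ⟨⟨z₀, hz₀⟩⟩
    · exact continuous_of_discreteTopology
    · have := nonempty_of_sum_eq_one (hsumA C z₀ hz₀)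
      have : (A C).domRestrict f = fun z : A C => geo (J := C.1) Subtype.val
          (fun s t => hz₀.1 s s.2 t t.2) (finsetPt C.1 (μ z) (hμ.nonneg z) (hsumA C z z.2)) := by
        funext z
        exact hf z C.1 z.2.1 (hsumA C z z.2) (hoffA C z z.2)
      rw [this]
      refine (geo _ _).continuous.comp (Continuous.subtype_mk (continuous_pi fun t => ?_) _)
      exact (hμ.continuous t).comp continuous_subtype_val

lemma map_cvx {X Y : Type*} [Fintype X] [Fintype Y] (f : X → Y) (x y : stdSimplex ℝ X)
    (s : unitInterval) :
    stdSimplex.map f (cvx x y s) = cvx (stdSimplex.map f x) (stdSimplex.map f y) s := by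
  classical
  ext j
  rw [cvx_apply]
  simp only [stdSimplex.map_coe, FunOnFinite.linearMap_apply_apply, Finset.mul_sum,
    ← Finset.sum_add_distrib]
  exact Finset.sum_congr rfl fun i _ => cvx_apply x y s i

open Classical in
/-- The set of vertices of a simplex. -/
def vertSet {p : ℕ} (σ : Fin (p + 1) → T) : Finset T := Finset.univ.image σ

lemma mem_vertSet {p : ℕ} {σ : Fin (p + 1) → T} {t : T} : t ∈ vertSet σ ↔ ∃ i, σ i = t := by
  simp [vertSet]

/-- A vertex of a simplex, as an element of the set of vertices. -/
def toVertSet {p : ℕ} (σ : Fin (p + 1) → T) (i : Fin (p + 1)) : vertSet σ :=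
  ⟨σ i, mem_vertSet.2 ⟨i, rfl⟩⟩

instance {p : ℕ} (σ : Fin (p + 1) → T) : Nonempty (vertSet σ) := ⟨toVertSet σ 0⟩

lemma vertSet_clique {p : ℕ} {σ : Fin (p + 1) → T} (hσ : ∀ i j, d (σ i) (σ j) ≤ k) :
    ∀ s ∈ vertSet σ, ∀ t ∈ vertSet σ, d s t ≤ k := by
  intro s hs t ht
  obtain ⟨i, rfl⟩ := mem_vertSet.1 hs
  obtain ⟨j, rfl⟩ := mem_vertSet.1 ht
  exact hσ i j

/-- The vertices of the join of a simplex `σ` with the simplex on the set of vertices of `σ`. -/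
abbrev JoinIdx {p : ℕ} (σ : Fin (p + 1) → T) : Type u := Fin (p + 1) ⊕ₗ vertSet σ

/-- The map that restricts to `σ` and to the inclusion of the set of vertices of `σ`. -/
def joinVert {p : ℕ} (σ : Fin (p + 1) → T) (j : JoinIdx σ) : T :=
  Sum.elim σ Subtype.val (ofLex j)

lemma joinVert_clique {p : ℕ} {σ : Fin (p + 1) → T} (hσ : ∀ i j, d (σ i) (σ j) ≤ k)
    (a b : JoinIdx σ) : d (joinVert σ a) (joinVert σ b) ≤ k := by
  have key : ∀ a : JoinIdx σ, joinVert σ a ∈ vertSet σ := by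
    intro a
    rcases h : ofLex a with i | s
    · simp [joinVert, h, mem_vertSet]
    · simp [joinVert, h]
  exact vertSet_clique hσ _ (key a) _ (key b)

/-- The inclusion of the first summand. -/
def joinInl {p : ℕ} (σ : Fin (p + 1) → T) (i : Fin (p + 1)) : JoinIdx σ := toLex (Sum.inl i)

/-- The map `σ` to the second summand. -/
def joinInr {p : ℕ} (σ : Fin (p + 1) → T) (i : Fin (p + 1)) : JoinIdx σ :=
  toLex (Sum.inr (toVertSet σ i))

/-- The segment in the join between the two copies of the point with barycentric
coordinates `x`. -/
def joinPt {p : ℕ} (σ : Fin (p + 1) → T) (x : stdSimplex ℝ (Fin (p + 1))) (s : unitInterval) :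
    stdSimplex ℝ (JoinIdx σ) :=
  cvx (stdSimplex.map (joinInl σ) x) (stdSimplex.map (joinInr σ) x) s

lemma continuous_joinPt {p : ℕ} (σ : Fin (p + 1) → T) :
    Continuous fun q : stdSimplex ℝ (Fin (p + 1)) × unitInterval => joinPt σ q.1 q.2 :=
  continuous_cvx.comp ((((stdSimplex.continuous_map _).comp continuous_fst).prodMk
    ((stdSimplex.continuous_map _).comp continuous_fst)).prodMk continuous_snd)

/-- The functoriality of the join. -/
def joinMap {p q : ℕ} (θ : Fin (p + 1) →o Fin (q + 1)) {σ : Fin (q + 1) → T} {τ : Fin (p + 1) → T}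
    (h : ∀ i, τ i = σ (θ i)) (j : JoinIdx τ) : JoinIdx σ :=
  toLex (Sum.map θ (fun c => ⟨c.1, by
    obtain ⟨i, hi⟩ := mem_vertSet.1 c.2
    exact mem_vertSet.2 ⟨θ i, by rw [← hi, h]⟩⟩) (ofLex j))

lemma geo_joinPt_map [LinearOrder T] {p q : ℕ} (θ : Fin (p + 1) →o Fin (q + 1))
    {σ : Fin (q + 1) → T} {τ : Fin (p + 1) → T} (h : ∀ i, τ i = σ (θ i))
    (hσ : ∀ i j, d (σ i) (σ j) ≤ k) (hτ : ∀ i j, d (τ i) (τ j) ≤ k)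
    (x : stdSimplex ℝ (Fin (p + 1))) (s : unitInterval) :
    geo (joinVert τ) (joinVert_clique hτ) (joinPt τ x s) =
      geo (joinVert σ) (joinVert_clique hσ) (joinPt σ (stdSimplex.map θ x) s) := by
  refine (geo_map _ (joinVert_clique hσ) ⟨joinMap θ h, ?_⟩ (fun j => ?_) _).trans (congrArg _ ?_)
  · intro j j' hj
    induction j using Lex.rec with | _ j
    induction j' using Lex.rec with | _ j'
    rcases j with j | j <;> rcases j' with j' | j'
    · exact Sum.Lex.inl_le_inl_iff.2 (θ.monotone (Sum.Lex.inl_le_inl_iff.1 hj))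
    · exact Sum.Lex.inl_le_inr _ _
    · exact absurd hj Sum.Lex.not_inr_le_inl
    · have h' : j ≤ j' := Sum.Lex.inr_le_inr_iff.1 hj
      exact Sum.Lex.inr_le_inr_iff.2 h'
  · induction j using Lex.rec with | _ j
    rcases j with j | j
    · exact (h j).symm
    · rfl
  · have h1 : joinMap θ h ∘ joinInl τ = joinInl σ ∘ θ := rfl
    have h2 : joinMap θ h ∘ joinInr τ = joinInr σ ∘ θ := by
      funext i
      exact congrArg (fun c => toLex (Sum.inr c)) (Subtype.ext (h i))
    refine (map_cvx _ _ _ s).trans ?_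
    rw [stdSimplex.map_comp_apply, stdSimplex.map_comp_apply]
    rw [joinPt, stdSimplex.map_comp_apply, stdSimplex.map_comp_apply]
    rw [← h1, ← h2]
    rfl

lemma geo_joinPt_zero [LinearOrder T] {p : ℕ} {σ : Fin (p + 1) → T}
    (hσ : ∀ i j, d (σ i) (σ j) ≤ k) (x : stdSimplex ℝ (Fin (p + 1))) :
    geo (joinVert σ) (joinVert_clique hσ) (joinPt σ x 0) = geo σ hσ x := by
  rw [joinPt, cvx_zero]
  exact (geo_map hσ (joinVert_clique hσ) ⟨joinInl σ, fun i j hij => Sum.Lex.inl_le_inl_iff.2 hij⟩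
    (fun j => rfl) x).symm

lemma geo_joinPt_one [LinearOrder T] {p : ℕ} {σ : Fin (p + 1) → T}
    (hσ : ∀ i j, d (σ i) (σ j) ≤ k) (x : stdSimplex ℝ (Fin (p + 1))) :
    geo (joinVert σ) (joinVert_clique hσ) (joinPt σ x 1) =
      geo (J := vertSet σ) Subtype.val (fun c c' => vertSet_clique hσ c c.2 c' c'.2)
        (stdSimplex.map (toVertSet σ) x) := by
  have h : stdSimplex.map (joinInr σ) x =
      stdSimplex.map (fun c : vertSet σ => (toLex (Sum.inr c) : JoinIdx σ))
        (stdSimplex.map (toVertSet σ) x) :=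
    (stdSimplex.map_comp_apply (S := ℝ) (toVertSet σ) _ x).symm
  rw [joinPt, cvx_one, h]
  exact (geo_map (J := vertSet σ) (fun c c' => vertSet_clique hσ c c.2 c' c'.2)
    (joinVert_clique hσ) ⟨fun c => toLex (Sum.inr c), fun i j hij => Sum.Lex.inr_le_inr_iff.2 hij⟩
    (fun j => rfl) _).symm

/-- A point of the realization is joined to the point with the same barycentric coordinates whose
vertices are in increasing order, by a path in the join of the two simplices. -/
lemma exists_homotopy_realPt [LinearOrder T] : ∃ H : C(VRReal d k × unitInterval, VRReal d k),
    (∀ y, H (y, 0) = y) ∧ ∀ (y : VRReal d k) (C : Finset T) (hC : ∀ s ∈ C, ∀ t ∈ C, d s t ≤ k)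
      (h0 : ∀ t, 0 ≤ baryCoord y t) (h1 : ∑ t ∈ C, baryCoord y t = 1),
      (∀ t ∉ C, baryCoord y t = 0) → H (y, 1) = realPt C hC (baryCoord y) h0 h1 := by
  obtain ⟨f, hf⟩ := exists_desc (X := (VR d k : SSet.{u})) (Y := C(unitInterval, VRReal d k))
    (fun n σ => ContinuousMap.curry ⟨fun q => geo (joinVert σ.1) (joinVert_clique σ.2)
      (joinPt σ.1 q.1 q.2), (geo _ _).continuous.comp (continuous_joinPt σ.1)⟩) (by
    intro n m θ σ x
    ext s
    exact geo_joinPt_map θ.unop.toOrderHom (fun _ => rfl) σ.2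
      ((VR d k : SSet.{u}).map θ σ).2 x s)
  have hf' : ∀ (n : SimplexCategoryᵒᵖ) (σ : (VR d k : SSet.{u}).obj n) (x) (s : unitInterval),
      f (realMap σ x) s = geo (joinVert σ.1) (joinVert_clique σ.2) (joinPt σ.1 x s) :=
    fun n σ x s => by
      rw [hf]
      rfl
  refine ⟨f.uncurry, fun y => ?_, fun y C' hC' h0 h1 hoff => ?_⟩
  · obtain ⟨n, σ, x, rfl⟩ := exists_realMap_eq y
    exact (hf' n σ x 0).trans ((geo_joinPt_zero σ.2 x).trans (realMap_eq_geo σ x).symm)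
  · obtain ⟨n, σ, x, rfl⟩ := exists_realMap_eq y
    refine (hf' n σ x 1).trans ((geo_joinPt_one σ.2 x).trans ?_)
    classical
    have hcoord : ∀ c, baryCoord (realMap σ x) c = ∑ i with σ.1 i = c, x i := fun c => by
      rw [realMap_eq_geo]
      convert baryCoord_geo (d := d) (k := k) σ.2 x c
    have hoffC : ∀ c ∉ vertSet σ.1, baryCoord (realMap σ x) c = 0 := fun c hc => by
      rw [hcoord]
      refine Finset.sum_eq_zero fun i hi => absurd (mem_vertSet.2 ⟨i, ?_⟩) hc
      simpa using hi
    have h1C := sum_baryCoord _ hoffC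
    refine Eq.trans ?_ (realPt_congr (C := vertSet σ.1) (vertSet_clique σ.2) hC' h0 h1C h1 hoffC hoff)
    refine congrArg _ ?_
    ext c
    rw [stdSimplex.map_coe, FunOnFinite.linearMap_apply_apply]
    refine Eq.trans ?_ (hcoord c).symm
    refine Finset.sum_congr ?_ fun _ _ => rfl
    ext i
    simp only [Finset.mem_filter]
    exact and_congr_right fun _ => Subtype.ext_iff

end Realize

/-! ### Spheres as boundaries of simplices and as quotients of cubes -/

/-- An interior point remains in the set if it is pushed away a little from the point with
coordinates `1 / (q + 1)`, and so satisfies strict inequalities. -/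
lemma interior_corner (q : ℕ) : interior {y : Fin q → ℝ | (∀ i, 0 ≤ y i) ∧ ∑ i, y i ≤ 1} =
    {y | (∀ i, 0 < y i) ∧ ∑ i, y i < 1} := by
  apply Set.Subset.antisymm
  · intro y hy
    have hcont : Continuous fun ε : ℝ => fun i => y i + ε * (y i - (q + 1 : ℝ)⁻¹) := by fun_prop
    have h0 : (fun i => y i + 0 * (y i - (q + 1 : ℝ)⁻¹)) ∈
        interior {y : Fin q → ℝ | (∀ i, 0 ≤ y i) ∧ ∑ i, y i ≤ 1} := by simpa using hy
    have hev := (hcont.tendsto 0).eventually (isOpen_interior.mem_nhds h0)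
    obtain ⟨ε, hmem, hε⟩ := ((hev.filter_mono nhdsWithin_le_nhds).and
      (self_mem_nhdsWithin : Set.Ioi (0 : ℝ) ∈ 𝓝[>] 0)).exists
    obtain ⟨h1, h2⟩ := interior_subset hmem
    have hε : 0 < ε := hε
    have hq : (0 : ℝ) < (q + 1 : ℝ)⁻¹ := by positivity
    refine ⟨fun i => ?_, ?_⟩
    · have := h1 i
      by_contra hn
      nlinarith [mul_pos hε hq]
    · simp only [Finset.sum_add_distrib, ← Finset.mul_sum, Finset.sum_sub_distrib, Finset.sum_const,
        Finset.card_univ, Fintype.card_fin, nsmul_eq_mul] at h2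
      have h3 : (q : ℝ) * (q + 1 : ℝ)⁻¹ < 1 := by
        rw [← div_eq_mul_inv, div_lt_one (by positivity)]
        linarith
      by_contra hn
      push Not at hn
      nlinarith [mul_pos hε (sub_pos.2 h3)]
  · refine interior_maximal (fun y hy => ⟨fun i => (hy.1 i).le, hy.2.le⟩) ?_
    have : {y : Fin q → ℝ | (∀ i, 0 < y i) ∧ ∑ i, y i < 1} =
        (⋂ i, {y | 0 < y i}) ∩ {y | ∑ i, y i < 1} := by
      ext y
      simp
    rw [this]
    refine IsOpen.inter (isOpen_iInter_of_finite fun i => ?_) ?_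
    · exact isOpen_lt continuous_const (continuous_apply i)
    · exact isOpen_lt (by fun_prop) continuous_const

/-- The cube is homeomorphic to the simplex, with boundaries corresponding to each other, as both
are convex bodies. -/
lemma exists_cube_simplex (q : ℕ) : ∃ ψ : (Fin q → unitInterval) → stdSimplex ℝ (Fin (q + 1)),
    Continuous ψ ∧ Function.Bijective ψ ∧ ∀ y, y ∈ Cube.boundary (Fin q) ↔ ∃ i, ψ y i = 0 := by
  let s : Set (Fin q → ℝ) := Set.pi Set.univ fun _ => Set.Icc 0 1
  let t : Set (Fin q → ℝ) := {y | (∀ i, 0 ≤ y i) ∧ ∑ i, y i ≤ 1}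
  have hs_int : interior s = Set.pi Set.univ fun _ => Set.Ioo 0 1 := by
    simp only [s, interior_pi_set Set.finite_univ, interior_Icc]
  have ht_int := interior_corner q
  have hs_cl : IsClosed s := isClosed_set_pi fun _ _ => isClosed_Icc
  have ht_cl : IsClosed t := by
    have : t = (⋂ i, {y | 0 ≤ y i}) ∩ {y | ∑ i, y i ≤ 1} := by
      ext y
      simp [t]
    rw [this]
    refine IsClosed.inter (isClosed_iInter fun i => ?_) ?_
    · exact isClosed_le continuous_const (continuous_apply i)
    · exact isClosed_le (by fun_prop) continuous_const
  have hle : ∀ y ∈ t, ∀ i, y i ≤ 1 := fun y hy i =>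
    (Finset.single_le_sum (fun j _ => hy.1 j) (Finset.mem_univ i)).trans hy.2
  have hs_bd : Bornology.IsBounded s := Bornology.IsBounded.pi fun _ => Metric.isBounded_Icc 0 1
  have ht_bd : Bornology.IsBounded t := hs_bd.subset fun y hy i _ => ⟨hy.1 i, hle y hy i⟩
  obtain ⟨e, he_int, he_cl, -⟩ := exists_homeomorph_image_eq (s := s) (t := t)
    (convex_pi fun _ _ => convex_Icc 0 1)
    (by rw [hs_int]; exact ⟨fun _ => 1 / 2, fun i _ => by norm_num⟩)
    (NormedSpace.isVonNBounded_of_isBounded _ hs_bd)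
    (by
      intro x hx y hy a b ha hb hab
      refine ⟨fun i => ?_, ?_⟩
      · have := mul_nonneg ha (hx.1 i)
        have := mul_nonneg hb (hy.1 i)
        simpa using by linarith
      · simp only [Pi.add_apply, Pi.smul_apply, smul_eq_mul, Finset.sum_add_distrib, ← Finset.mul_sum]
        nlinarith [mul_le_mul_of_nonneg_left hx.2 ha, mul_le_mul_of_nonneg_left hy.2 hb])
    (by
      rw [ht_int]
      refine ⟨fun _ => (q + 1 : ℝ)⁻¹, fun i => by positivity, ?_⟩
      simp only [Finset.sum_const, Finset.card_univ, Fintype.card_fin, nsmul_eq_mul]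
      rw [← div_eq_mul_inv, div_lt_one (by positivity)]
      linarith)
    (NormedSpace.isVonNBounded_of_isBounded _ ht_bd)
  rw [hs_cl.closure_eq, ht_cl.closure_eq] at he_cl
  rw [hs_int, ht_int] at he_int
  let v : (Fin q → unitInterval) → Fin q → ℝ := fun y => e fun i => y i
  have hv : ∀ y, v y ∈ t := fun y => by
    rw [← he_cl]
    exact ⟨_, fun i _ => (y i).2, rfl⟩
  have hvc : Continuous v := e.continuous.comp
    (continuous_pi fun i => continuous_subtype_val.comp (continuous_apply i))
  refine ⟨fun y => ⟨Fin.snoc (α := fun _ => ℝ) (v y) (1 - ∑ i, v y i), fun i => ?_, ?_⟩, ?_,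
    ⟨?_, ?_⟩, ?_⟩
  · refine Fin.lastCases ?_ (fun i => ?_) i
    · simpa using (hv y).2
    · simpa using (hv y).1 i
  · rw [Fin.sum_univ_castSucc]
    simp
  · refine Continuous.subtype_mk (continuous_pi fun i => ?_) _
    refine Fin.lastCases ?_ (fun i => ?_) i
    · simp only [Fin.snoc_last]
      fun_prop
    · simp only [Fin.snoc_castSucc]
      fun_prop
  · intro y y' h
    have h1 : v y = v y' := by
      funext i
      have := congrFun (congrArg Subtype.val h) i.castSucc
      simpa using this
    have h2 := e.injective h1
    funext i
    exact Subtype.ext (congrFun h2 i)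
  · intro x
    have hx : (fun i : Fin q => x i.castSucc) ∈ t := by
      refine ⟨fun i => x.2.1 _, ?_⟩
      have := stdSimplex.sum_eq_one x
      rw [Fin.sum_univ_castSucc] at this
      have h0 := x.2.1 (Fin.last q)
      change 0 ≤ x (Fin.last q) at h0
      linarith
    rw [← he_cl] at hx
    obtain ⟨y, hy, hyx⟩ := hx
    have hvy : v (fun i => ⟨y i, hy i trivial⟩) = fun i : Fin q => x i.castSucc := hyx
    refine ⟨fun i => ⟨y i, hy i trivial⟩, ?_⟩
    ext i
    change Fin.snoc (α := fun _ => ℝ) (v _) (1 - ∑ i, v _ i) i = x i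
    rw [hvy]
    refine Fin.lastCases ?_ (fun i => ?_) i
    · have := stdSimplex.sum_eq_one x
      rw [Fin.sum_univ_castSucc] at this
      simp only [Fin.snoc_last]
      linarith
    · simp
  · intro y
    have h1 : y ∈ Cube.boundary (Fin q) ↔
        (fun i => (y i : ℝ)) ∉ Set.pi Set.univ fun _ : Fin q => Set.Ioo (0 : ℝ) 1 := by
      simp only [Cube.boundary, Set.mem_ofPred_eq, Set.mem_pi, Set.mem_univ, true_imp_iff,
        not_forall, Set.mem_Ioo]
      refine exists_congr fun i => ?_
      rw [not_and_or, not_lt, not_lt]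
      refine or_congr ⟨fun h => by rw [h]; rfl, fun h => Subtype.ext (le_antisymm h (y i).2.1)⟩
        ⟨fun h => by rw [h]; rfl, fun h => Subtype.ext (le_antisymm (y i).2.2 h)⟩
    have h2 : (∃ i, Fin.snoc (α := fun _ => ℝ) (v y) (1 - ∑ i, v y i) i = 0) ↔
        v y ∉ {y | (∀ i, 0 < y i) ∧ ∑ i, y i < 1} := by
      rw [Set.mem_ofPred_eq, not_and_or, not_forall]
      constructor
      · rintro ⟨i, hi⟩
        revert hi
        refine Fin.lastCases (fun hi => ?_) (fun i hi => ?_) i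
        · right
          simp only [Fin.snoc_last] at hi
          linarith
        · left
          exact ⟨i, by simp only [Fin.snoc_castSucc] at hi; linarith⟩
      · rintro (⟨i, hi⟩ | h)
        · exact ⟨i.castSucc, by simpa using le_antisymm (not_lt.1 hi) ((hv y).1 i)⟩
        · refine ⟨Fin.last q, ?_⟩
          simp only [Fin.snoc_last]
          linarith [(hv y).2]
    refine h1.trans (Iff.trans ?_ h2.symm)
    rw [← he_int, e.injective.mem_set_image]

/-- The last vertex of a simplex, as a point of the boundary. -/
def lastVertex (q : ℕ) : bd q := by
  classical
  exact ⟨stdSimplex.vertex (Fin.last (q + 1)), 0, by simp [Fin.ext_iff]⟩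

lemma lastVertex_castSucc {q : ℕ} (i : Fin (q + 1)) : (lastVertex q).1 i.castSucc = 0 := by
  simp [lastVertex, Fin.castSucc_ne_last]

lemma eq_lastVertex {q : ℕ} {z : bd q} (h : z.1 (Fin.last (q + 1)) = 1) : z = lastVertex q := by
  have hz := stdSimplex.sum_eq_one z.1
  rw [Fin.sum_univ_castSucc, h, add_eq_right] at hz
  have hz := (Finset.sum_eq_zero_iff_of_nonneg fun i _ => z.1.2.1 _).1 hz
  apply Subtype.ext
  ext i
  refine Fin.lastCases ?_ (fun i => ?_) i
  · rw [h]
    simp [lastVertex]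
  · rw [lastVertex_castSucc]
    exact hz i (Finset.mem_univ i)

/-- The boundary of the `(q + 1)`-simplex is the `q`-dimensional cube with its boundary collapsed to
a point. (If `q = 0`, then a point is added.) On the `q`-simplex, the map is the homeomorphism to
the face opposite the last vertex, expanded radially. -/
lemma exists_collapse (q : ℕ) : ∃ c : (Fin q → unitInterval) → bd q, Continuous c ∧
    (∀ y, y ∈ Cube.boundary (Fin q) ↔ c y = lastVertex q) ∧
    (∀ y y', c y = c y' → c y ≠ lastVertex q → y = y') ∧
    ∀ z, z ≠ lastVertex q → ∃ y, c y = z := by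
  suffices h : ∃ c : stdSimplex ℝ (Fin (q + 1)) → bd q, Continuous c ∧
      (∀ y, (∃ i, y i = 0) ↔ c y = lastVertex q) ∧
      (∀ y y', c y = c y' → c y ≠ lastVertex q → y = y') ∧
      ∀ z, z ≠ lastVertex q → ∃ y, c y = z by
    obtain ⟨ψ, hψc, ⟨hψi, hψs⟩, hψ⟩ := exists_cube_simplex q
    obtain ⟨c, hcc, hc1, hc2, hc3⟩ := h
    refine ⟨c ∘ ψ, hcc.comp hψc, fun y => (hψ y).trans (hc1 _), fun y y' h h' => hψi (hc2 _ _ h h'),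
      fun z hz => ?_⟩
    obtain ⟨x, rfl⟩ := hc3 z hz
    obtain ⟨y, rfl⟩ := hψs x
    exact ⟨y, rfl⟩
  have hq : (0 : ℝ) < q + 1 := by positivity
  -- `1 - 2 * r x` is the last coordinate of the image of `x`. It is `0` for `x` near the
  -- barycenter, and then the image lies in the face opposite the last vertex
  let r : stdSimplex ℝ (Fin (q + 1)) → ℝ := fun x => min ((q + 1) * minCoord x) (1 / 2)
  have hrc : Continuous r := (continuous_const.mul continuous_minCoord).min continuous_const
  have hr0 : ∀ x, 0 ≤ r x := fun x =>
    le_min (mul_nonneg hq.le (minCoord_nonneg x)) (by norm_num)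
  have hr1 : ∀ x, r x ≤ 1 / 2 := fun x => min_le_right _ _
  have hr2 : ∀ x i, r x / (q + 1) ≤ x i := fun x i => by
    rw [div_le_iff₀' hq]
    exact (min_le_left _ _).trans (mul_le_mul_of_nonneg_left (minCoord_le x i) hq.le)
  let C : stdSimplex ℝ (Fin (q + 1)) → Fin (q + 2) → ℝ := fun x =>
    Fin.snoc (α := fun _ => ℝ) (fun i => 2 * r x / (1 - r x) * (x i - r x / (q + 1))) (1 - 2 * r x)
  have hC : ∀ x i, C x (Fin.castSucc i) = 2 * r x / (1 - r x) * (x i - r x / (q + 1)) := fun x i => by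
    simp [C]
  have hCl : ∀ x, C x (Fin.last _) = 1 - 2 * r x := fun x => by simp [C]
  have hpos : ∀ x, 0 < 1 - r x := fun x => by linarith [hr1 x]
  have hmem : ∀ x, C x ∈ stdSimplex ℝ (Fin (q + 2)) := by
    refine fun x => ⟨fun i => ?_, ?_⟩
    · refine Fin.lastCases ?_ (fun i => ?_) i
      · rw [hCl]; linarith [hr1 x]
      · rw [hC]
        exact mul_nonneg (div_nonneg (by linarith [hr0 x]) (hpos x).le) (sub_nonneg.2 (hr2 x i))
    · rw [Fin.sum_univ_castSucc, hCl]
      simp_rw [hC]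
      rw [← Finset.mul_sum, Finset.sum_sub_distrib, stdSimplex.sum_eq_one]
      have := hpos x
      simp only [Finset.sum_const, Finset.card_univ, Fintype.card_fin, nsmul_eq_mul]
      push_cast
      field_simp
      ring
  have hbd : ∀ x, ∃ i, C x i = 0 := by
    intro x
    rcases le_total ((q + 1) * minCoord x) (1 / 2) with h | h
    · obtain ⟨i, hi⟩ := exists_eq_minCoord x
      refine ⟨i.castSucc, ?_⟩
      have : r x = (q + 1) * minCoord x := min_eq_left h
      rw [hC, hi, this, mul_div_cancel_left₀ _ hq.ne', sub_self, mul_zero]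
    · refine ⟨Fin.last _, ?_⟩
      have : r x = 1 / 2 := min_eq_right h
      rw [hCl, this]
      norm_num
  have hlast : ∀ x, (⟨⟨C x, hmem x⟩, hbd x⟩ : bd q) = lastVertex q ↔ r x = 0 := by
    intro x
    constructor
    · intro h
      have h1 := congrArg (fun z : bd q => z.1 (Fin.last (q + 1))) h
      have h2 : C x (Fin.last _) = 1 := h1.trans (by simp [lastVertex])
      rw [hCl] at h2
      linarith
    · intro h
      refine eq_lastVertex ((hCl x).trans ?_)
      rw [h]
      ring
  refine ⟨fun x => ⟨⟨C x, hmem x⟩, hbd x⟩, ?_, fun x => ?_, fun x x' h hne => ?_, fun z hz => ?_⟩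
  · refine Continuous.subtype_mk (Continuous.subtype_mk (continuous_pi fun i => ?_) _) _
    refine Fin.lastCases ?_ (fun i => ?_) i
    · simp_rw [hCl]
      fun_prop
    · simp_rw [hC]
      have := continuous_coord i (ι := Fin (q + 1))
      exact ((continuous_const.mul hrc).div (continuous_const.sub hrc) fun x => (hpos x).ne').mul
        (this.sub (hrc.div_const _))
  · rw [hlast]
    constructor
    · rintro ⟨i, hi⟩
      have := hr2 x i
      rw [hi, div_le_iff₀ hq, zero_mul] at this
      exact le_antisymm this (hr0 x)
    · intro h
      obtain ⟨i, hi⟩ := exists_eq_minCoord x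
      refine ⟨i, ?_⟩
      rw [hi]
      rcases min_choice ((q + 1) * minCoord x) (1 / 2) with h' | h'
      · have h2 : r x = _ := h'
        rw [h] at h2
        exact (mul_eq_zero.1 h2.symm).resolve_left hq.ne'
      · have h2 : r x = _ := h'
        rw [h] at h2
        norm_num at h2
  · rw [Ne, hlast] at hne
    have h0 : C x = C x' := congrArg (fun z : bd q => (z.1 : Fin (q + 2) → ℝ)) h
    have h1 : r x = r x' := by
      have := congrFun h0 (Fin.last _)
      rw [hCl, hCl] at this
      linarith
    ext i
    have h2 := congrFun h0 i.castSucc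
    rw [hC, hC, ← h1] at h2
    have h3 : 2 * r x / (1 - r x) ≠ 0 := div_ne_zero (mul_ne_zero two_ne_zero hne) (hpos x).ne'
    exact sub_left_injective (mul_left_cancel₀ h3 h2)
  · have hz1 : z.1 (Fin.last (q + 1)) ≠ 1 := fun h => hz (eq_lastVertex h)
    have hz2 : z.1 (Fin.last (q + 1)) < 1 := lt_of_le_of_ne (stdSimplex.le_one _ _) hz1
    have hz0 : 0 ≤ z.1 (Fin.last (q + 1)) := z.1.2.1 _
    set ρ : ℝ := (1 - z.1 (Fin.last (q + 1))) / 2 with hρ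
    have hρ0 : 0 < ρ := by linarith
    have hρ1 : ρ ≤ 1 / 2 := by linarith
    have hρ2 : 0 < 1 - ρ := by linarith
    have hsum : ∑ i : Fin (q + 1), z.1 i.castSucc = 2 * ρ := by
      have := stdSimplex.sum_eq_one z.1
      rw [Fin.sum_univ_castSucc] at this
      linarith
    have hc0 : 0 < (1 - ρ) / (2 * ρ) := by positivity
    let x : stdSimplex ℝ (Fin (q + 1)) :=
      ⟨fun i => (1 - ρ) / (2 * ρ) * z.1 i.castSucc + ρ / (q + 1), fun i =>
        add_nonneg (mul_nonneg hc0.le (z.1.2.1 _)) (by positivity), by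
        rw [Finset.sum_add_distrib, ← Finset.mul_sum, hsum]
        simp only [Finset.sum_const, Finset.card_univ, Fintype.card_fin, nsmul_eq_mul]
        push_cast
        field_simp
        ring⟩
    have hx : ∀ i, x i = (1 - ρ) / (2 * ρ) * z.1 i.castSucc + ρ / (q + 1) := fun i => rfl
    have hx' : ∀ i, ρ / (q + 1) ≤ x i := fun i => by
      rw [hx]
      have h0 : 0 ≤ z.1 i.castSucc := z.1.2.1 _
      linarith [mul_nonneg hc0.le h0]
    have hrx : r x = ρ := by
      obtain ⟨i, hi⟩ := z.2
      revert hi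
      refine Fin.lastCases (fun hi => ?_) (fun i hi => ?_) i
      · have hρ' : ρ = 1 / 2 := by rw [hρ, hi]; ring
        rw [hρ']
        refine min_eq_right ?_
        obtain ⟨j, hj⟩ := exists_eq_minCoord x
        rw [← hj, ← hρ', ← div_le_iff₀' hq]
        exact hx' j
      · have h1 : minCoord x = ρ / (q + 1) := minCoord_eq_of hx' (i := i) (by rw [hx, hi]; ring)
        change min _ _ = ρ
        rw [h1, mul_div_cancel₀ _ hq.ne']
        exact min_eq_left hρ1
    refine ⟨x, Subtype.ext ?_⟩
    ext i
    change C x i = z.1 i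
    refine Fin.lastCases ?_ (fun i => ?_) i
    · rw [hCl, hrx]
      linarith
    · rw [hC, hrx, hx]
      field_simp
      ring

/-! ### Homotopy groups and extension of maps from the boundary of a simplex -/

lemma exists_lift_of_isQuotientMap {A B Y : Type*} [TopologicalSpace A] [TopologicalSpace B]
    [TopologicalSpace Y] {K : A → B} (hK : Topology.IsQuotientMap K) (Φ : C(A, Y))
    (h : ∀ p p', K p = K p' → Φ p = Φ p') : ∃ F : C(B, Y), ∀ p, F (K p) = Φ p := by
  have e : ∀ p, Φ (Function.surjInv hK.surjective (K p)) = Φ p := fun p =>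
    h _ _ (Function.surjInv_eq _ _)
  exact ⟨⟨fun b => Φ (Function.surjInv hK.surjective b), hK.continuous_iff.2
    (Φ.continuous.congr fun p => (e p).symm)⟩, e⟩

section PiExtension

variable {X Y : Type u} [TopologicalSpace X] [TopologicalSpace Y] (q : ℕ) (j : C(X, Y))

/-- If `j` is trivial on the `q`-th homotopy groups, then maps from the boundary of the
`(q + 1)`-simplex extend to the simplex after composition with `j`. -/
lemma exists_extension_of_piMap (h : ∀ (x : X) (a : π_ q X x), piMap q j x a = ⟦GenLoop.const⟧)
    (f : C(bd q, X)) : ∃ F : C(stdSimplex ℝ (Fin (q + 2)), Y), ∀ z : bd q, F z = j (f z) := by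
  obtain ⟨c, hc, hc1, hc2, hc3⟩ := exists_collapse q
  let γ : GenLoop (Fin q) X (f (lastVertex q)) :=
    ⟨f.comp ⟨c, hc⟩, fun y hy => congrArg f ((hc1 y).1 hy)⟩
  obtain ⟨H⟩ := Quotient.exact (h _ (Quotient.mk (GenLoop.Homotopic.setoid (Fin q) _) γ))
  have H0 : ∀ y, H (0, y) = j (f (c y)) := fun y => H.apply_zero y
  have H1 : ∀ y, H (1, y) = j (f (lastVertex q)) := fun y => H.apply_one y
  have Hbd : ∀ t, ∀ y ∈ Cube.boundary (Fin q), H (t, y) = j (f (lastVertex q)) := fun t y hy =>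
    (H.eq_fst t hy).trans (congrArg (fun z => j (f z)) ((hc1 y).1 hy))
  -- the cone over the boundary as a quotient of two cylinders
  let K : ((Fin q → unitInterval) × unitInterval) ⊕ unitInterval → stdSimplex ℝ (Fin (q + 2)) :=
    Sum.elim (fun p => coneMap q (c p.1, p.2)) fun t => coneMap q (lastVertex q, t)
  have hK : Continuous K := Continuous.sumElim
    ((continuous_coneMap q).comp ((hc.comp continuous_fst).prodMk continuous_snd))
    ((continuous_coneMap q).comp (continuous_const.prodMk continuous_id))
  have hKs : Function.Surjective K := by
    intro x
    obtain ⟨⟨z, t⟩, rfl⟩ := coneMap_surjective q x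
    by_cases hz : z = lastVertex q
    · exact ⟨Sum.inr t, by rw [hz]; rfl⟩
    · obtain ⟨y, rfl⟩ := hc3 z hz
      exact ⟨Sum.inl (y, t), rfl⟩
  have hKq : Topology.IsQuotientMap K := Topology.IsQuotientMap.of_surjective_continuous hKs hK
  let Φ : C(((Fin q → unitInterval) × unitInterval) ⊕ unitInterval, Y) :=
    ⟨Sum.elim (fun p => H (p.2, p.1)) fun _ => j (f (lastVertex q)), Continuous.sumElim
      (H.continuous.comp (continuous_snd.prodMk continuous_fst)) continuous_const⟩
  -- the homotopy in terms of the cone parameters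
  have key : ∀ p, ∃ z t, K p = coneMap q (z, t) ∧ (t = 1 ∨ z = lastVertex q →
      Φ p = j (f (lastVertex q))) ∧ (z ≠ lastVertex q → ∃ y, c y = z ∧ Φ p = H (t, y)) := by
    rintro (⟨y, t⟩ | t)
    · refine ⟨c y, t, rfl, ?_, fun _ => ⟨y, rfl, rfl⟩⟩
      rintro (rfl | h)
      · exact H1 y
      · exact Hbd t y ((hc1 y).2 h)
    · exact ⟨lastVertex q, t, rfl, fun _ => rfl, fun h => absurd rfl h⟩
  have hfib : ∀ p p', K p = K p' → Φ p = Φ p' := by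
    intro p p' h
    obtain ⟨z, t, e, e1, e2⟩ := key p
    obtain ⟨z', t', e', e1', e2'⟩ := key p'
    rw [e, e'] at h
    obtain ⟨ht, h⟩ := coneMap_fiber h
    have ht : t = t' := ht
    subst ht
    rcases h with h | h
    · have h : t = 1 := h
      rw [e1 (Or.inl h), e1' (Or.inl h)]
    · have h : z = z' := congrArg Prod.fst h
      subst h
      by_cases hz : z = lastVertex q
      · rw [e1 (Or.inr hz), e1' (Or.inr hz)]
      · obtain ⟨y, hy, hp⟩ := e2 hz
        obtain ⟨y', hy', hp'⟩ := e2' hz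
        rw [hp, hp', hc2 y y' (hy.trans hy'.symm) (by rwa [hy])]
  obtain ⟨F, hlift⟩ := exists_lift_of_isQuotientMap hKq Φ hfib
  refine ⟨F, fun z => ?_⟩
  by_cases hz : z = lastVertex q
  · have := hlift (Sum.inr 0)
    simp only [K, Sum.elim_inr, coneMap_zero] at this
    rw [hz, this]
    rfl
  · obtain ⟨y, rfl⟩ := hc3 z hz
    have := hlift (Sum.inl (y, 0))
    simp only [K, Sum.elim_inl, coneMap_zero] at this
    rw [this]
    exact H0 y

/-- Conversely, an extension to the simplex is a null homotopy. -/
lemma piMap_eq_of_extension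
    (h : ∀ f : C(bd q, X), ∃ F : C(stdSimplex ℝ (Fin (q + 2)), Y), ∀ z : bd q, F z = j (f z))
    (x : X) (a : π_ q X x) : piMap q j x a = ⟦GenLoop.const⟧ := by
  obtain ⟨c, hc, hc1, hc2, hc3⟩ := exists_collapse q
  refine Quotient.inductionOn a fun γ => ?_
  let K : (Fin q → unitInterval) ⊕ Unit → bd q := Sum.elim c fun _ => lastVertex q
  have hK : Continuous K := Continuous.sumElim hc continuous_const
  have hKs : Function.Surjective K := by
    intro z
    by_cases hz : z = lastVertex q
    · exact ⟨Sum.inr (), hz.symm⟩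
    · obtain ⟨y, rfl⟩ := hc3 z hz
      exact ⟨Sum.inl y, rfl⟩
  have hKq : Topology.IsQuotientMap K := Topology.IsQuotientMap.of_surjective_continuous hKs hK
  let Φ : C((Fin q → unitInterval) ⊕ Unit, X) :=
    ⟨Sum.elim γ fun _ => x, Continuous.sumElim γ.1.continuous continuous_const⟩
  have e1 : ∀ p, K p = lastVertex q → Φ p = x := by
    rintro (y | y) hp
    · exact γ.2 y ((hc1 y).2 hp)
    · rfl
  have hfib : ∀ p p', K p = K p' → Φ p = Φ p' := by
    intro p p' hpp
    by_cases hp : K p = lastVertex q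
    · rw [e1 p hp, e1 p' (hpp ▸ hp)]
    · rcases p with y | y
      · rcases p' with y' | y'
        · rw [hc2 y y' hpp hp]
        · exact absurd hpp hp
      · exact absurd rfl hp
  obtain ⟨f, hlift⟩ := exists_lift_of_isQuotientMap hKq Φ hfib
  obtain ⟨F, hF⟩ := h f
  have hF1 : ∀ y, F (c y) = j (γ y) := fun y => (hF (c y)).trans (congrArg j (hlift (Sum.inl y)))
  have hF2 : F (lastVertex q) = j x :=
    (hF (lastVertex q)).trans (congrArg j (hlift (Sum.inr ())))
  refine Quotient.sound ⟨⟨⟨⟨fun p => F (cvx (c p.2) (lastVertex q) p.1), ?_⟩, fun y => ?_,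
    fun y => ?_⟩, fun t y hy => ?_⟩⟩
  · exact F.continuous.comp (continuous_cvx.comp
      (((continuous_subtype_val.comp (hc.comp continuous_snd)).prodMk continuous_const).prodMk
        continuous_fst))
  · change F (cvx (c y) (lastVertex q) 0) = j (γ y)
    rw [cvx_zero, hF1]
  · change F (cvx (c y) (lastVertex q) 1) = j x
    rw [cvx_one, hF2]
  · change F (cvx (c y) (lastVertex q) t) = j (γ y)
    have h1 : c y = lastVertex q := (hc1 y).1 hy
    have h2 : cvx (lastVertex q).1 (lastVertex q).1 t = (lastVertex q).1 := by
      ext i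
      rw [cvx_apply]
      ring
    rw [h1, h2, hF2]
    exact congrArg j (γ.2 y hy).symm

/-- Extendability to the simplex is a homotopy invariant. -/
lemma exists_extension_of_homotopy {f g : C(bd q, Y)} (H : C(bd q × unitInterval, Y))
    (h0 : ∀ z, H (z, 0) = f z) (h1 : ∀ z, H (z, 1) = g z)
    (F : C(stdSimplex ℝ (Fin (q + 2)), Y)) (hF : ∀ z : bd q, F z = g z) :
    ∃ F' : C(stdSimplex ℝ (Fin (q + 2)), Y), ∀ z : bd q, F' z = f z := by
  let a : unitInterval → unitInterval := fun t => Set.projIcc 0 1 zero_le_one (2 * t)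
  let b : unitInterval → unitInterval := fun t => Set.projIcc 0 1 zero_le_one (2 * t - 1)
  have ha : Continuous a := continuous_projIcc.comp (by fun_prop)
  have hb : Continuous b := continuous_projIcc.comp (by fun_prop)
  let Φ : C(bd q × unitInterval, Y) :=
    ⟨fun p => if (p.2 : ℝ) ≤ 1 / 2 then H (p.1, a p.2) else F (coneMap q (p.1, b p.2)), by
      refine Continuous.if_le ?_ ?_ (continuous_subtype_val.comp continuous_snd) continuous_const
        fun p hp => ?_
      · exact H.continuous.comp (continuous_fst.prodMk (ha.comp continuous_snd))
      · exact F.continuous.comp ((continuous_coneMap q).comp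
          (continuous_fst.prodMk (hb.comp continuous_snd)))
      · have e1 : a p.2 = 1 := by
          simp only [a, hp]
          exact Set.projIcc_of_right_le _ (by norm_num)
        have e2 : b p.2 = 0 := by
          simp only [b, hp]
          exact Set.projIcc_of_le_left _ (by norm_num)
        rw [e1, e2, h1, coneMap_zero, hF]⟩
  have hfib : ∀ p p', coneMap q p = coneMap q p' → Φ p = Φ p' := by
    intro p p' h
    obtain ⟨h2, h | h⟩ := coneMap_fiber h
    · have h' : p'.2 = 1 := h2 ▸ h
      have e2 : b 1 = 1 := Set.projIcc_of_right_le _ (by norm_num)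
      change (if (p.2 : ℝ) ≤ 1 / 2 then _ else _) = (if (p'.2 : ℝ) ≤ 1 / 2 then _ else _)
      rw [h, h', if_neg (by norm_num), if_neg (by norm_num), e2, coneMap, coneMap]
      simp only [cvx_one]
    · rw [h]
  obtain ⟨F', hlift⟩ := exists_lift_of_isQuotientMap (isQuotientMap_coneMap q) Φ hfib
  refine ⟨F', fun z => ?_⟩
  have e := hlift (z, 0)
  rw [coneMap_zero] at e
  rw [e, ← h0]
  have e1 : a 0 = 0 := Set.projIcc_of_le_left _ (by norm_num)
  change (if ((0 : unitInterval) : ℝ) ≤ 1 / 2 then H (z, a 0) else _) = _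
  rw [if_pos (by norm_num), e1]

end PiExtension

lemma IsVRMap.exists_clique {T : Type*} {d : T → T → ℕ} {k : ℕ} {Z : Type*} [TopologicalSpace Z]
    {μ : Z → T → ℝ} (h : IsVRMap d k μ) (z : Z) : ∃ C : Finset T,
      (∀ s ∈ C, ∀ t ∈ C, d s t ≤ k) ∧ ∑ t ∈ C, μ z t = 1 ∧ ∀ t ∉ C, μ z t = 0 := by
  classical
  obtain ⟨W, hW0, hW1⟩ := h.exists_finset
  refine ⟨W.filter fun t => μ z t ≠ 0, fun s hs t ht => h.clique z s t (Finset.mem_filter.1 hs).2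
    (Finset.mem_filter.1 ht).2, by rw [Finset.sum_filter_ne_zero, hW1], fun t ht => ?_⟩
  by_contra h'
  refine ht (Finset.mem_filter.2 ⟨?_, h'⟩)
  by_contra h''
  exact h' (hW0 z t h'')

/-- The vanishing of homotopy groups in terms of families of barycentric coordinates, that is,
without the topology of the geometric realization. -/
theorem piVanishes_iff {T : Type u} {d : T → T → ℕ} {k l : ℕ} (q : ℕ) (h : k ≤ l) :
    PiVanishes d q h ↔ ExtendsVR d q k l := by
  classical
  -- simplices are tuples, so some order of the vertices is needed to turn barycentric coordinates
  -- into a point of the realization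
  let _ : LinearOrder T := linearOrderOfSTO WellOrderingRel
  set j : C(VRReal d k, VRReal d l) :=
    (SSet.toTop.map (SSet.Subcomplex.homOfLE (VR_mono d h))).hom with hj
  have hjc : ∀ y, baryCoord (j y) = baryCoord y := fun y => baryCoord_toTop_map h y
  constructor
  · intro hpi μ hμ
    obtain ⟨f, hf⟩ := exists_realize hμ
    have hfμ : ∀ z, baryCoord (f z) = μ z := fun z => by
      obtain ⟨C, hC, h1, hoff⟩ := hμ.exists_clique z
      rw [hf z C hC h1 hoff, baryCoord_realPt _ _ _ hoff]
    obtain ⟨F, hF⟩ := exists_extension_of_piMap q j hpi f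
    exact ⟨_, isVRMap_baryCoord F, fun z => by rw [hF, hjc, hfμ]⟩
  · intro hext
    refine piMap_eq_of_extension q j fun f => ?_
    obtain ⟨M, hM, hMf⟩ := hext _ (isVRMap_baryCoord f)
    obtain ⟨F, hF⟩ := exists_realize hM
    obtain ⟨H, H0, H1⟩ := exists_homotopy_realPt (d := d) (k := l)
    refine exists_extension_of_homotopy q (f := j.comp f)
      (g := F.comp ⟨Subtype.val, continuous_subtype_val⟩)
      ⟨fun p => H (j (f p.1), p.2), by fun_prop⟩ (fun z => H0 _) (fun z => ?_) F fun z => rfl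
    obtain ⟨C, hC, h1, hoff⟩ := hM.exists_clique z
    have e : M z = baryCoord (j (f z)) := (hMf z).trans (hjc _).symm
    change H (j (f z), 1) = F z
    rw [hF z C hC h1 hoff, H1 (j (f z)) C hC (baryCoord_nonneg _) (by rwa [← e]) (by rwa [← e])]
    congr 1
    exact e.symm

/-! ### Subdivisions of nerves -/

section Sd

variable {X Y : SSet.{u}}

/-- The simplices of `Ex Y` as maps out of subdivided simplices. -/
def exEquiv (Y : SSet.{u}) (n : SimplexCategoryᵒᵖ) :
    (SSet.ex.obj Y).obj n ≃ (SimplexCategory.sd.{u}.obj n.unop ⟶ Y) := Equiv.ulift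

lemma exEquiv_map {n m : SimplexCategoryᵒᵖ} (θ : n ⟶ m) (s : (SSet.ex.obj Y).obj n) :
    exEquiv Y m ((SSet.ex.obj Y).map θ s) = SimplexCategory.sd.map θ.unop ≫ exEquiv Y n s := rfl

lemma exEquiv_app (f : X ⟶ Y) {n : SimplexCategoryᵒᵖ} (s : (SSet.ex.obj X).obj n) :
    exEquiv Y n ((SSet.ex.map f).app n s) = exEquiv X n s ≫ f := rfl

lemma exEquiv_naturality {Z : SSet.{u}} (f : X ⟶ SSet.ex.obj Z) {n m : SimplexCategoryᵒᵖ}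
    (θ : n ⟶ m) (σ : X.obj n) : exEquiv Z m (f.app m (X.map θ σ)) =
      SimplexCategory.sd.map θ.unop ≫ exEquiv Z n (f.app n σ) :=
  (congrArg (exEquiv Z m) (NatTrans.naturality_apply f θ σ)).trans (exEquiv_map θ _)

/-- The unit of the adjunction between the subdivision and `Ex`. -/
def sdUnit (X : SSet.{u}) : X ⟶ SSet.ex.obj (SSet.sd.obj X) := SSet.sdExAdjunction.unit.app X

/-- The subdivided simplex in the subdivision of `X` that belongs to the simplex `σ`. -/
def sdSimplex {n : SimplexCategoryᵒᵖ} (σ : X.obj n) :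
    SimplexCategory.sd.obj n.unop ⟶ SSet.sd.obj X :=
  exEquiv _ n ((sdUnit X).app n σ)

lemma sdSimplex_map {n m : SimplexCategoryᵒᵖ} (θ : n ⟶ m) (σ : X.obj n) :
    sdSimplex (X.map θ σ) = SimplexCategory.sd.map θ.unop ≫ sdSimplex σ :=
  exEquiv_naturality (sdUnit X) θ σ

lemma sdSimplex_comp (f : X ⟶ Y) {n : SimplexCategoryᵒᵖ} (σ : X.obj n) :
    sdSimplex σ ≫ SSet.sd.map f = sdSimplex (f.app n σ) := by
  have h : f ≫ sdUnit Y = sdUnit X ≫ SSet.ex.map (SSet.sd.map f) :=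
    SSet.sdExAdjunction.unit.naturality f
  have h' := ConcreteCategory.congr_hom (NatTrans.congr_app h n) σ
  rw [NatTrans.comp_app, NatTrans.comp_app] at h'
  exact (exEquiv_app _ _).symm.trans (congrArg (exEquiv _ n) h'.symm)

/-- A map out of the subdivision of `X` is a compatible family of maps out of subdivided
simplices. -/
lemma exists_sd_desc (g : ∀ n : SimplexCategoryᵒᵖ, X.obj n → (SimplexCategory.sd.obj n.unop ⟶ Y))
    (hg : ∀ {n m : SimplexCategoryᵒᵖ} (θ : n ⟶ m) (σ : X.obj n),
      g m (X.map θ σ) = SimplexCategory.sd.map θ.unop ≫ g n σ) :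
    ∃ f : SSet.sd.obj X ⟶ Y, ∀ (n : SimplexCategoryᵒᵖ) (σ : X.obj n), sdSimplex σ ≫ f = g n σ := by
  let G : X ⟶ SSet.ex.obj Y :=
    { app n := TypeCat.ofHom fun σ => ⟨g n σ⟩
      naturality n m θ := by
        ext σ
        exact congrArg ULift.up (hg θ σ) }
  refine ⟨(SSet.sdExAdjunction.homEquiv X Y).symm G, fun n σ => ?_⟩
  have h : SSet.sdExAdjunction.homEquiv X Y ((SSet.sdExAdjunction.homEquiv X Y).symm G) = G :=
    Equiv.apply_symm_apply _ _
  rw [Adjunction.homEquiv_unit] at h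
  exact congrArg (fun f : X ⟶ SSet.ex.obj Y => (f.app n σ).down) h

lemma sd_hom_ext {f g : SSet.sd.obj X ⟶ Y}
    (h : ∀ (n : SimplexCategoryᵒᵖ) (σ : X.obj n), sdSimplex σ ≫ f = sdSimplex σ ≫ g) : f = g := by
  apply (SSet.sdExAdjunction.homEquiv X Y).injective
  rw [Adjunction.homEquiv_unit, Adjunction.homEquiv_unit]
  ext n σ
  exact congrArg ULift.up (h n σ)

end Sd

/-- The nerve of a poset. -/
abbrev nv (P : PartOrd.{u}) : SSet.{u} := PartOrd.nerveFunctor.obj P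

/-- The map of nerves induced by a monotone map. -/
abbrev nvMap {P Q : PartOrd.{u}} (f : P ⟶ Q) : nv P ⟶ nv Q := PartOrd.nerveFunctor.map f

section Nerve

variable {P Q : PartOrd.{u}}

/-- The elements of a chain, as a simplex of the nerve. -/
def nvFun {n : SimplexCategoryᵒᵖ} (c : (nv P).obj n) (i : Fin (n.unop.len + 1)) : P :=
  CategoryTheory.Functor.obj (C := Fin (n.unop.len + 1)) (D := P) c i

lemma nvFun_mono {n : SimplexCategoryᵒᵖ} (c : (nv P).obj n) : Monotone (nvFun c) := fun _ _ h =>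
  leOfHom (CategoryTheory.Functor.map (C := Fin (n.unop.len + 1)) (D := P) c (homOfLE h))

lemma nv_ext {n : SimplexCategoryᵒᵖ} {c c' : (nv P).obj n} (h : ∀ i, nvFun c i = nvFun c' i) :
    c = c' :=
  nerve.ext_of_isThin (C := P) (funext h)

/-- The simplex of the nerve given by a monotone family. -/
def nvMk {n : SimplexCategoryᵒᵖ} (f : Fin (n.unop.len + 1) → P) (hf : Monotone f) : (nv P).obj n :=
  hf.functor

/-- A simplex of the nerve as a morphism of posets. -/
def nvHom {n : SimplexCategoryᵒᵖ} (c : (nv P).obj n) : SimplexCategory.toPartOrd.obj n.unop ⟶ P :=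
  PartOrd.ofHom ⟨fun i => nvFun c i.down, fun _ _ h => nvFun_mono c h⟩

/-- A morphism of posets as a simplex of the nerve. -/
def nvOfHom {n : SimplexCategoryᵒᵖ} (f : SimplexCategory.toPartOrd.{u}.obj n.unop ⟶ P) :
    (nv P).obj n :=
  nvMk (fun i => f.hom ⟨i⟩) fun _ _ h => f.hom.monotone h

@[simp]
lemma nvHom_nvOfHom {n : SimplexCategoryᵒᵖ} (f : SimplexCategory.toPartOrd.{u}.obj n.unop ⟶ P) :
    nvHom (nvOfHom f) = f := rfl

end Nerve

/-- The poset of non-empty finite chains. -/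
abbrev nfc (P : PartOrd.{u}) : PartOrd.{u} := PartOrd.nonemptyFiniteChainsFunctor.obj P

/-- The map that sends a chain to its image. -/
abbrev nfcMap {P Q : PartOrd.{u}} (f : P ⟶ Q) : nfc P ⟶ nfc Q :=
  PartOrd.nonemptyFiniteChainsFunctor.map f

section SdNerve

variable {P Q : PartOrd.{u}}

lemma exists_sdNerve (P : PartOrd.{u}) : ∃ a : SSet.sd.obj (nv P) ⟶ nv (nfc P),
    ∀ (n : SimplexCategoryᵒᵖ) (c : (nv P).obj n), sdSimplex c ≫ a = nvMap (nfcMap (nvHom c)) :=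
  exists_sd_desc _ fun {n m} θ c => by
    have : nvHom ((nv P).map θ c) = SimplexCategory.toPartOrd.map θ.unop ≫ nvHom c := rfl
    rw [this, nfcMap, nvMap, Functor.map_comp, Functor.map_comp]
    rfl

/-- The map from the subdivision of the nerve of a poset to the nerve of the poset of chains. -/
def sdNerve (P : PartOrd.{u}) : SSet.sd.obj (nv P) ⟶ nv (nfc P) := (exists_sdNerve P).choose

lemma sdSimplex_sdNerve {n : SimplexCategoryᵒᵖ} (c : (nv P).obj n) :
    sdSimplex c ≫ sdNerve P = nvMap (nfcMap (nvHom c)) :=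
  (exists_sdNerve P).choose_spec n c

lemma sdNerve_naturality (f : P ⟶ Q) :
    SSet.sd.map (nvMap f) ≫ sdNerve Q = sdNerve P ≫ nvMap (nfcMap f) := by
  apply sd_hom_ext
  intro n c
  rw [← Category.assoc, sdSimplex_comp, sdSimplex_sdNerve, ← Category.assoc, sdSimplex_sdNerve]
  have : nvHom ((nvMap f).app n c) = nvHom c ≫ f := rfl
  rw [this, nfcMap, nvMap, Functor.map_comp, Functor.map_comp]
  rfl

/-- A chain is the image of an order embedding of a finite ordinal. -/
lemma exists_embedding (c : nfc P) : ∃ (s : SimplexCategory)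
    (μ : SimplexCategory.toPartOrd.{u}.obj s ⟶ P), (∀ a b, μ.hom a ≤ μ.hom b → a ≤ b) ∧
      ∀ x, x ∈ c.finset ↔ ∃ i, μ.hom i = x := by
  classical
  let _ : LinearOrder c.finset :=
    { (inferInstance : PartialOrder c.finset) with
      le_total := fun a b => c.comparable a b
      toDecidableLE := Classical.decRel _ }
  have hc : 0 < Fintype.card c.finset := Fintype.card_pos_iff.2 ⟨_, c.nonempty.choose_spec⟩
  let e : Fin (Fintype.card c.finset - 1 + 1) ≃o c.finset :=
    Fintype.orderIsoFinOfCardEq c.finset (Nat.succ_pred_eq_of_pos hc).symm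
  refine ⟨SimplexCategory.mk (Fintype.card c.finset - 1),
    PartOrd.ofHom ⟨fun i => (e i.down).1, fun i j h => e.monotone h⟩, fun a b h => ?_, fun x => ?_⟩
  · exact e.le_iff_le.1 h
  · constructor
    · intro hx
      exact ⟨⟨e.symm ⟨x, hx⟩⟩, congrArg Subtype.val (e.apply_symm_apply ⟨x, hx⟩)⟩
    · rintro ⟨i, rfl⟩
      exact (e i.down).2

/-- A chain of chains in the image of an order embedding can be lifted. -/
lemma exists_lift_chain {s : SimplexCategory} {μ : SimplexCategory.toPartOrd.{u}.obj s ⟶ P}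
    (hμ : ∀ a b, μ.hom a ≤ μ.hom b → a ≤ b) {n : SimplexCategoryᵒᵖ} (C : (nv (nfc P)).obj n)
    (hC : ∀ x ∈ (nvFun C (Fin.last _)).finset, ∃ i, μ.hom i = x) :
    ∃ C' : (SimplexCategory.sd.{u}.obj s).obj n, (nvMap (nfcMap μ)).app n C' = C := by
  have h : ∀ i, ∃ c, (nfcMap μ).hom c = nvFun C i := fun i =>
    chain_mem_range μ.hom hμ (nvFun C i) fun a ha => hC a (nvFun_mono C (Fin.le_last i) ha)
  choose c hc using h
  refine ⟨nvMk (P := nfc _) c fun i j hij => ?_, nv_ext fun i => ?_⟩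
  · refine sdP_map_reflects μ hμ 1 _ _ ?_
    exact (hc i).le.trans ((nvFun_mono C hij).trans (hc j).ge)
  · exact hc i

/-- A simplex of a subdivided simplex in the subdivision of a nerve depends only on its image in
the nerve of the poset of chains. -/
lemma sdSimplex_app_eq {n a b : SimplexCategoryᵒᵖ} (θ : (nv P).obj a) (θ' : (nv P).obj b)
    (C : (SimplexCategory.sd.{u}.obj a.unop).obj n) (C' : (SimplexCategory.sd.{u}.obj b.unop).obj n)
    (h : (nvMap (nfcMap (nvHom θ))).app n C = (nvMap (nfcMap (nvHom θ'))).app n C') :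
    (sdSimplex θ).app n C = (sdSimplex θ').app n C' := by
  set D := (nvMap (nfcMap (nvHom θ))).app n C with hD
  obtain ⟨t, μ, hμ, hμr⟩ := exists_embedding (nvFun D (Fin.last _))
  obtain ⟨D', hD'⟩ := exists_lift_chain hμ D fun x hx => (hμr x).1 hx
  -- both simplices agree with the one that belongs to the largest chain
  have key : ∀ (e : SimplexCategoryᵒᵖ) (η : (nv P).obj e)
      (E : (SimplexCategory.sd.{u}.obj e.unop).obj n),
      (nvMap (nfcMap (nvHom η))).app n E = D →
      (sdSimplex η).app n E = (sdSimplex (nvOfHom (n := op t) μ)).app n D' := by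
    intro e η E hE
    obtain ⟨r, ν, hν, hνr⟩ := exists_embedding (P := SimplexCategory.toPartOrd.{u}.obj e.unop)
      (nvFun (P := nfc _) E (Fin.last _))
    obtain ⟨E', hE'⟩ := exists_lift_chain hν E fun x hx => (hνr x).1 hx
    have hlast : ∀ x, x ∈ (nvFun D (Fin.last _)).finset ↔
        ∃ i, i ∈ (nvFun (P := nfc _) E (Fin.last _)).finset ∧ (nvHom η).hom i = x := by
      intro x
      rw [← hE]
      exact NonemptyFiniteChains.mem_map_iff _ _ _
    have hex : ∀ i, ∃ j, μ.hom j = (nvHom η).hom (ν.hom i) := fun i =>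
      (hμr _).1 ((hlast _).2 ⟨ν.hom i, (hνr _).2 ⟨i, rfl⟩, rfl⟩)
    choose ε hε using hex
    let ε' : r ⟶ t := SimplexCategory.Hom.mk ⟨fun i => (ε ⟨i⟩).down, fun i j hij => by
      refine hμ _ _ ?_
      refine (hε ⟨i⟩).le.trans (le_trans ?_ (hε ⟨j⟩).ge)
      exact (nvHom η).hom.monotone (ν.hom.monotone hij)⟩
    let ν' : r ⟶ e.unop := SimplexCategory.Hom.mk ⟨fun i => (ν.hom ⟨i⟩).down, fun i j hij =>
      ν.hom.monotone hij⟩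
    have hcomp : (nv P).map ν'.op η = (nv P).map ε'.op (nvOfHom (n := op t) μ) :=
      nv_ext fun i => (hε ⟨i⟩).symm
    have h1 : (SimplexCategory.sd.map ν').app n E' = E := hE'
    have h2 : (sdSimplex ((nv P).map ν'.op η)).app n E' = (sdSimplex η).app n E := by
      rw [sdSimplex_map, ← h1]
      rfl
    have h3 : (sdSimplex ((nv P).map ε'.op (nvOfHom (n := op t) μ))).app n E' =
        (sdSimplex (nvOfHom (n := op t) μ)).app n ((SimplexCategory.sd.map ε').app n E') := by
      rw [sdSimplex_map]
      rfl
    rw [← h2, hcomp, h3]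
    congr 1
    refine nv_ext (P := nfc _) fun i => ?_
    refine sdP_map_injective μ hμ 1 ?_
    change nvFun (P := nfc P) ((nvMap (nfcMap μ)).app n ((SimplexCategory.sd.map ε').app n E')) i =
      nvFun (P := nfc P) ((nvMap (nfcMap μ)).app n D') i
    rw [hD', ← hE, ← h1]
    have : (nvMap (nfcMap (nvHom η))).app n ((SimplexCategory.sd.map ν').app n E') =
        (nvMap (nfcMap (nvHom ((nv P).map ν'.op η)))).app n E' := by
      have : nvHom ((nv P).map ν'.op η) = SimplexCategory.toPartOrd.map ν' ≫ nvHom η := rfl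
      rw [this, nfcMap, nfcMap, nvMap, nvMap, Functor.map_comp, Functor.map_comp]
      rfl
    rw [this, hcomp]
    have : nvHom ((nv P).map ε'.op (nvOfHom (n := op t) μ)) =
      SimplexCategory.toPartOrd.map ε' ≫ μ := rfl
    rw [this, nfcMap, nfcMap, nvMap, nvMap, Functor.map_comp, Functor.map_comp]
    rfl
  rw [key _ θ C rfl, key _ θ' C' h.symm]

end SdNerve

/-! ### Subdivided nerves and nerves of subdivided posets -/

section NerveSd

variable {P Q : PartOrd.{u}}

/-- A chain of chains lies in the subdivision of a single simplex, for instance the one given by its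
largest chain, and so determines a simplex of the subdivided nerve. -/
lemma exists_nerveSd {n : SimplexCategoryᵒᵖ} (C : (nv (nfc P)).obj n) :
    ∃ x : (SSet.sd.obj (nv P)).obj n, ∀ (a : SimplexCategoryᵒᵖ) (θ : (nv P).obj a)
      (C' : (SimplexCategory.sd.{u}.obj a.unop).obj n),
      (nvMap (nfcMap (nvHom θ))).app n C' = C → x = (sdSimplex θ).app n C' := by
  obtain ⟨t, μ, hμ, hμr⟩ := exists_embedding (nvFun C (Fin.last _))
  obtain ⟨D, hD⟩ := exists_lift_chain hμ C fun x hx => (hμr x).1 hx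
  exact ⟨(sdSimplex (nvOfHom (n := op t) μ)).app n D, fun a θ C' h =>
    sdSimplex_app_eq _ _ _ _ (hD.trans h.symm)⟩

lemma exists_lift {n : SimplexCategoryᵒᵖ} (C : (nv (nfc P)).obj n) :
    ∃ (a : SimplexCategoryᵒᵖ) (θ : (nv P).obj a) (C' : (SimplexCategory.sd.{u}.obj a.unop).obj n),
      (nvMap (nfcMap (nvHom θ))).app n C' = C := by
  obtain ⟨t, μ, hμ, hμr⟩ := exists_embedding (nvFun C (Fin.last _))
  obtain ⟨D, hD⟩ := exists_lift_chain hμ C fun x hx => (hμr x).1 hx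
  exact ⟨op t, nvOfHom μ, D, hD⟩

/-- The map from the nerve of the poset of chains of a poset to the subdivision of its nerve. -/
def nerveSd (P : PartOrd.{u}) : nv (nfc P) ⟶ SSet.sd.obj (nv P) where
  app n := TypeCat.ofHom fun C => (exists_nerveSd C).choose
  naturality n m κ := by
    ext C
    obtain ⟨a, θ, C', h⟩ := exists_lift C
    have h1 := (exists_nerveSd C).choose_spec a θ C' h
    have h2 := (exists_nerveSd ((nv (nfc P)).map κ C)).choose_spec a θ
      ((SimplexCategory.sd.{u}.obj a.unop).map κ C') (by
        exact (NatTrans.naturality_apply (nvMap (nfcMap (nvHom θ))) κ C').trans (congrArg _ h))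
    refine h2.trans ?_
    rw [NatTrans.naturality_apply (sdSimplex θ) κ C', ← h1]
    rfl

lemma nerveSd_app {n a : SimplexCategoryᵒᵖ} {C : (nv (nfc P)).obj n} (θ : (nv P).obj a)
    (C' : (SimplexCategory.sd.{u}.obj a.unop).obj n)
    (h : (nvMap (nfcMap (nvHom θ))).app n C' = C) :
    (nerveSd P).app n C = (sdSimplex θ).app n C' :=
  (exists_nerveSd C).choose_spec a θ C' h

lemma nerveSd_naturality (f : P ⟶ Q) :
    nvMap (nfcMap f) ≫ nerveSd Q = nerveSd P ≫ SSet.sd.map (nvMap f) := by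
  ext n C
  obtain ⟨a, θ, C', h⟩ := exists_lift C
  have h1 := nerveSd_app θ C' h
  have h2 : (nerveSd Q).app n ((nvMap (nfcMap f)).app n C) =
      (sdSimplex ((nvMap f).app a θ)).app n C' := by
    refine nerveSd_app _ _ ?_
    have : nvHom ((nvMap f).app a θ) = nvHom θ ≫ f := rfl
    rw [← h, this, nfcMap, nvMap, Functor.map_comp, Functor.map_comp]
    rfl
  refine h2.trans ?_
  rw [← sdSimplex_comp]
  exact congrArg ((SSet.sd.map (nvMap f)).app n) h1.symm

end NerveSd

section Iterate

variable {P Q : PartOrd.{u}}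

/-- The map from the iterated subdivision of the nerve of a poset to the nerve of the iterated
poset of chains. -/
def sdNerveIter (P : PartOrd.{u}) : ∀ n, (sdIter n).obj (nv P) ⟶ nv ((sdP n).obj P)
  | 0 => 𝟙 _
  | n + 1 => SSet.sd.map (sdNerveIter P n) ≫ sdNerve ((sdP n).obj P)

lemma sdNerveIter_naturality (f : P ⟶ Q) : ∀ n, (sdIter n).map (nvMap f) ≫ sdNerveIter Q n =
    sdNerveIter P n ≫ nvMap ((sdP n).map f)
  | 0 => rfl
  | n + 1 => by
    change SSet.sd.map ((sdIter n).map (nvMap f)) ≫ SSet.sd.map (sdNerveIter Q n) ≫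
      sdNerve ((sdP n).obj Q) = (SSet.sd.map (sdNerveIter P n) ≫ sdNerve ((sdP n).obj P)) ≫
        nvMap (nfcMap ((sdP n).map f))
    rw [← Category.assoc, ← Functor.map_comp, sdNerveIter_naturality f n, Functor.map_comp,
      Category.assoc, Category.assoc, sdNerve_naturality]

/-- The map from the nerve of the iterated poset of chains of a poset to the iterated subdivision
of its nerve. -/
def nerveSdIter (P : PartOrd.{u}) : ∀ n, nv ((sdP n).obj P) ⟶ (sdIter n).obj (nv P)
  | 0 => 𝟙 _
  | n + 1 => nerveSd ((sdP n).obj P) ≫ SSet.sd.map (nerveSdIter P n)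

lemma nerveSdIter_naturality (f : P ⟶ Q) : ∀ n, nvMap ((sdP n).map f) ≫ nerveSdIter Q n =
    nerveSdIter P n ≫ (sdIter n).map (nvMap f)
  | 0 => rfl
  | n + 1 => by
    change nvMap (nfcMap ((sdP n).map f)) ≫ nerveSd ((sdP n).obj Q) ≫
      SSet.sd.map (nerveSdIter Q n) = (nerveSd ((sdP n).obj P) ≫ SSet.sd.map (nerveSdIter P n)) ≫
        SSet.sd.map ((sdIter n).map (nvMap f))
    rw [← Category.assoc, nerveSd_naturality, Category.assoc, Category.assoc, ← Functor.map_comp,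
      ← Functor.map_comp, nerveSdIter_naturality f n]

/-- The standard simplex maps to the nerve of the corresponding ordinal. -/
def stdToNerve (n : SimplexCategory) :
    SSet.stdSimplex.{u}.obj n ⟶ nv (SimplexCategory.toPartOrd.{u}.obj n) :=
  SSet.yonedaEquiv.symm (nvOfHom (n := op n) (𝟙 _))

lemma stdToNerve_naturality {n m : SimplexCategory} (θ : n ⟶ m) :
    SSet.stdSimplex.{u}.map θ ≫ stdToNerve m =
      stdToNerve n ≫ nvMap (SimplexCategory.toPartOrd.map θ) := by
  apply SSet.yonedaEquiv.injective
  rfl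

/-- The nerve of an ordinal maps to the standard simplex. -/
def nerveToStd (n : SimplexCategory) :
    nv (SimplexCategory.toPartOrd.{u}.obj n) ⟶ SSet.stdSimplex.{u}.obj n where
  app _ := TypeCat.ofHom fun c => SSet.stdSimplex.objEquiv.symm
    (SimplexCategory.Hom.mk ⟨fun i => (nvFun c i).down, fun _ _ h => nvFun_mono c h⟩)
  naturality _ _ _ := rfl

lemma nerveToStd_comp {n : SimplexCategory} (c : (nv P).obj (op n)) :
    nerveToStd n ≫ SSet.yonedaEquiv.symm c = nvMap (nvHom c) := by
  ext _ x
  rfl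

lemma sdIter_isLeftAdjoint : ∀ n, (sdIter.{u} n).IsLeftAdjoint
  | 0 => inferInstanceAs (𝟭 SSet.{u}).IsLeftAdjoint
  | n + 1 => by
    have := sdIter_isLeftAdjoint n
    exact inferInstanceAs (sdIter.{u} n ⋙ SSet.sd).IsLeftAdjoint

variable {X Y : SSet.{u}}

/-- Left adjoints preserve the description of `X` as the colimit of its simplices: a map out of
`L.obj X` is a compatible family of maps out of the images of the simplices. -/
lemma exists_desc_of_isLeftAdjoint (L : SSet.{u} ⥤ SSet.{u}) [L.IsLeftAdjoint]
    (g : ∀ n : SimplexCategory, X.obj (op n) → (L.obj (SSet.stdSimplex.{u}.obj n) ⟶ Y))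
    (hg : ∀ {n m : SimplexCategory} (θ : m ⟶ n) (σ : X.obj (op n)),
      g m (X.map θ.op σ) = L.map (SSet.stdSimplex.map θ) ≫ g n σ) :
    ∃ f : L.obj X ⟶ Y, ∀ (n : SimplexCategory) (σ : X.obj (op n)),
      L.map (SSet.yonedaEquiv.symm σ) ≫ f = g n σ := by
  let adj := Adjunction.ofIsLeftAdjoint L
  let G : X ⟶ L.rightAdjoint.obj Y :=
    { app n := TypeCat.ofHom fun σ => SSet.yonedaEquiv (adj.homEquiv _ _ (g n.unop σ))
      naturality n m θ := by
        ext σ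
        have h := hg θ.unop σ
        change SSet.yonedaEquiv (adj.homEquiv _ _ (g m.unop (X.map θ σ))) =
          (L.rightAdjoint.obj Y).map θ (SSet.yonedaEquiv (adj.homEquiv _ _ (g n.unop σ)))
        rw [← Quiver.Hom.op_unop θ, h, Adjunction.homEquiv_naturality_left]
        exact (SSet.yonedaEquiv_naturality _ _).symm }
  refine ⟨(adj.homEquiv _ _).symm G, fun n σ => ?_⟩
  apply (adj.homEquiv _ _).injective
  rw [Adjunction.homEquiv_naturality_left, Equiv.apply_symm_apply]
  apply SSet.yonedaEquiv.injective
  rw [SSet.yonedaEquiv_comp, Equiv.apply_symm_apply]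
  rfl

lemma hom_ext_of_isLeftAdjoint (L : SSet.{u} ⥤ SSet.{u}) [L.IsLeftAdjoint] {f g : L.obj X ⟶ Y}
    (h : ∀ (n : SimplexCategory) (σ : X.obj (op n)),
      L.map (SSet.yonedaEquiv.symm σ) ≫ f = L.map (SSet.yonedaEquiv.symm σ) ≫ g) : f = g := by
  let adj := Adjunction.ofIsLeftAdjoint L
  apply (adj.homEquiv _ _).injective
  ext n σ
  have h1 := congrArg (fun k => SSet.yonedaEquiv (adj.homEquiv _ _ k)) (h n.unop σ)
  simp only [Adjunction.homEquiv_naturality_left] at h1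
  rw [SSet.yonedaEquiv_comp, SSet.yonedaEquiv_comp, Equiv.apply_symm_apply] at h1
  exact h1

end Iterate

/-! ### Word metrics are left invariant and have finite balls -/

section WordMetric

variable {G : Type u} [Group G] {H : Type v} [Group H] {S : Set H} {ι : G →* H}

lemma wordDist_self (g : G) : wordDist S ι g g = 0 := by
  unfold wordDist wordLength
  rw [inv_mul_cancel, map_one]
  exact Nat.le_zero.1 (Nat.sInf_le ⟨[], rfl, by simp, rfl⟩)

lemma finite_list_prod (hS : S.Finite) (k : ℕ) :
    {h : H | ∃ w : List H, w.length = k ∧ (∀ x ∈ w, x ∈ S ∨ x⁻¹ ∈ S) ∧ w.prod = h}.Finite := by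
  have hA : {x : H | x ∈ S ∨ x⁻¹ ∈ S}.Finite := by
    have : {x : H | x ∈ S ∨ x⁻¹ ∈ S} = S ∪ S⁻¹ := rfl
    rw [this]
    exact hS.union hS.inv
  induction k with
  | zero =>
    refine (Set.finite_singleton (1 : H)).subset ?_
    rintro h ⟨w, hw, -, rfl⟩
    rw [List.length_eq_zero_iff.1 hw]
    rfl
  | succ k ih =>
    refine (hA.image2 (· * ·) ih).subset ?_
    rintro h ⟨w, hw, hx, rfl⟩
    rcases w with _ | ⟨x, w⟩
    · simp at hw
    · exact ⟨x, hx x (by simp), w.prod, ⟨w, by simpa using hw, fun y hy => hx y (by simp [hy]), rfl⟩,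
        by simp⟩

lemma finite_ball (hS : S.Finite) (hgen : Subgroup.closure S = ⊤) (hι : Function.Injective ι)
    (k : ℕ) : {g : G | wordDist S ι 1 g ≤ k}.Finite := by
  have h1 : (⋃ j ∈ Finset.range (k + 1),
      {h : H | ∃ w : List H, w.length = j ∧ (∀ x ∈ w, x ∈ S ∨ x⁻¹ ∈ S) ∧ w.prod = h}).Finite :=
    Set.Finite.biUnion (Finset.finite_toSet _) fun j _ => finite_list_prod hS j
  refine (h1.preimage hι.injOn).subset fun g hg => ?_
  have hne : {n | ∃ w : List H, w.length = n ∧ (∀ x ∈ w, x ∈ S ∨ x⁻¹ ∈ S) ∧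
      w.prod = ι (1⁻¹ * g)}.Nonempty := by
    obtain ⟨w, hw, hp⟩ := Submonoid.exists_list_of_mem_closure (s := S ∪ S⁻¹)
      (show ι (1⁻¹ * g) ∈ Submonoid.closure (S ∪ S⁻¹) by
        rw [← Subgroup.closure_toSubmonoid, hgen]
        trivial)
    exact ⟨w.length, w, rfl, hw, hp⟩
  have h2 := Nat.sInf_mem hne
  rw [inv_one, one_mul] at h2
  simp only [Set.mem_preimage, Set.mem_iUnion]
  refine ⟨_, Finset.mem_range.2 (Nat.lt_succ_of_le ?_), h2⟩
  have h3 : wordDist S ι 1 g ≤ k := hg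
  unfold wordDist wordLength at h3
  rwa [inv_one, one_mul] at h3

end WordMetric

/-! ### Labelled posets -/

section Label

variable {T : Type u} {d : T → T → ℕ} {k l m : ℕ} {P Q : PartOrd.{u}}

/-- The labels of comparable elements have distance at most `k`. -/
def IsLabelling (d : T → T → ℕ) (k : ℕ) {P : Type*} [PartialOrder P] (b : P → T) : Prop :=
  ∀ a a', a ≤ a' → d (b a) (b a') ≤ k ∧ d (b a') (b a) ≤ k

lemma IsLabelling.mono {P : Type*} [PartialOrder P] {b : P → T} (hb : IsLabelling d k b)
    (h : k ≤ l) : IsLabelling d l b := fun a a' haa =>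
  ⟨(hb a a' haa).1.trans h, (hb a a' haa).2.trans h⟩

/-- The map from the nerve to the Vietoris–Rips complex given by a labelling of a poset. -/
def labelVR (b : P → T) (hb : IsLabelling d k b) : nv P ⟶ (VR d k : SSet.{u}) where
  app n := TypeCat.ofHom fun c => ⟨fun i => b (nvFun c i), fun i j => by
    rcases le_total i j with h | h
    · exact (hb _ _ (nvFun_mono c h)).1
    · exact (hb _ _ (nvFun_mono c h)).2⟩
  naturality _ _ _ := rfl

@[simp]
lemma labelVR_app (b : P → T) (hb : IsLabelling d k b) {n : SimplexCategoryᵒᵖ} (c : (nv P).obj n)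
    (i) : ((labelVR b hb).app n c).1 i = b (nvFun c i) := rfl

/-- Each simplex of the nerve is degenerate over one of dimension less than the cardinality of a
chain. -/
lemma exists_nv_eq_map {n : SimplexCategoryᵒᵖ} (c : (nv P).obj n) : ∃ (s : SimplexCategory)
    (μ : SimplexCategory.toPartOrd.{u}.obj s ⟶ P) (θ : n.unop ⟶ s),
      (∀ a b, μ.hom a ≤ μ.hom b → a ≤ b) ∧ c = (nv P).map θ.op (nvOfHom (n := op s) μ) := by
  classical
  obtain ⟨s, μ, hμ, hμr⟩ := exists_embedding (P := P)
    ⟨Finset.univ.image (nvFun c), by simp, by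
      rintro ⟨x, hx⟩ ⟨y, hy⟩
      obtain ⟨i, -, rfl⟩ := Finset.mem_image.1 hx
      obtain ⟨j, -, rfl⟩ := Finset.mem_image.1 hy
      exact (le_total i j).imp (fun h => nvFun_mono c h) fun h => nvFun_mono c h⟩
  have h : ∀ i, ∃ a, μ.hom a = nvFun c i := fun i =>
    (hμr _).1 (Finset.mem_image_of_mem _ (Finset.mem_univ i))
  choose θ hθ using h
  refine ⟨s, μ, SimplexCategory.Hom.mk ⟨fun i => (θ i).down, fun i j hij => hμ _ _ ?_⟩, hμ,
    nv_ext fun i => (hθ i).symm⟩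
  exact (hθ i).le.trans ((nvFun_mono c hij).trans (hθ j).ge)

/-- A chain in a poset of height at most `m` has at most `m + 1` elements. -/
lemma HeightLE.len_le (hP : HeightLE P m) {s : SimplexCategory}
    {μ : SimplexCategory.toPartOrd.{u}.obj s ⟶ P} (hμ : ∀ a b, μ.hom a ≤ μ.hom b → a ≤ b) :
    s.len ≤ m := by
  obtain ⟨r, hr, hm⟩ := hP
  have h1 : StrictMono fun i : Fin (s.len + 1) => r (μ.hom ⟨i⟩) := fun i j hij =>
    hr (lt_of_le_not_ge (μ.hom.monotone hij.le) fun h => not_le_of_gt hij (hμ _ _ h))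
  have h2 := Fintype.card_le_of_injective
    (fun i : Fin (s.len + 1) => (⟨r (μ.hom ⟨i⟩), Nat.lt_succ_of_le (hm _)⟩ : Fin (m + 1)))
    fun i j hij => h1.injective (congrArg Fin.val hij)
  simpa using h2

lemma labelVR_mem_skeleton (hP : HeightLE P m) (b : P → T) (hb : IsLabelling d k b)
    (n : SimplexCategoryᵒᵖ) (c : (nv P).obj n) :
    (labelVR b hb).app n c ∈ ((VR d k : SSet.{u}).skeleton (m + 1)).obj n := by
  obtain ⟨s, μ, θ, hμ, rfl⟩ := exists_nv_eq_map c
  have h : (labelVR b hb).app n ((nv P).map θ.op (nvOfHom (n := op s) μ)) =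
      (VR d k : SSet.{u}).map θ.op ((labelVR b hb).app (op s) (nvOfHom (n := op s) μ)) := rfl
  rw [h]
  exact ((VR d k : SSet.{u}).skeleton (m + 1)).map θ.op
    (SSet.mem_skeleton _ _ (Nat.lt_succ_of_le (hP.len_le hμ)))

/-- The map to the skeleton of the Vietoris–Rips complex given by a labelling. -/
def labelSk (b : P → T) (hb : IsLabelling d k b)
    (h : ∀ n c, (labelVR b hb).app n c ∈ ((VR d k : SSet.{u}).skeleton (m + 1)).obj n) :
    nv P ⟶ sk m (VR d k : SSet.{u}) where
  app n := TypeCat.ofHom fun c => ⟨(labelVR b hb).app n c, h n c⟩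
  naturality _ _ _ := rfl

end Label

/-! ### Labellings pushed by a simplicial map of a subdivision -/

section Push

open scoped Simplicial

variable {T : Type u} {d : T → T → ℕ} {k m n : ℕ} {P Q : PartOrd.{u}}
  (φ : (sdIter n).obj (sk m (VR d k : SSet.{u})) ⟶ sk m (VR d k : SSet.{u}))

/-- A map from the nerve of a poset, subdivided and composed with `φ`. -/
def pushMap (f : nv P ⟶ sk m (VR d k : SSet.{u})) : nv ((sdP n).obj P) ⟶ sk m (VR d k : SSet.{u}) :=
  nerveSdIter P n ≫ (sdIter n).map f ≫ φ

/-- The labels of the vertices of the subdivision that `pushMap` gives. -/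
def pushLabel (f : nv P ⟶ sk m (VR d k : SSet.{u})) (w : (sdP n).obj P) : T :=
  verts (q := 0) ((pushMap φ f).app (op ⦋0⦌) (nvMk (fun _ => w) monotone_const)) 0

lemma pushMap_nvMap (g : Q ⟶ P) (f : nv P ⟶ sk m (VR d k : SSet.{u})) :
    nvMap ((sdP n).map g) ≫ pushMap φ f = pushMap φ (nvMap g ≫ f) := by
  unfold pushMap
  rw [← Category.assoc, nerveSdIter_naturality, Functor.map_comp, Category.assoc, Category.assoc]

lemma pushLabel_map (g : Q ⟶ P) (f : nv P ⟶ sk m (VR d k : SSet.{u})) (w : (sdP n).obj Q) :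
    pushLabel φ f (((sdP n).map g).hom w) = pushLabel φ (nvMap g ≫ f) w := by
  unfold pushLabel
  rw [← pushMap_nvMap]
  rfl

/-- The vertices of the image of a simplex are the images of its vertices. -/
lemma verts_nv_eq {q : ℕ} (h : nv P ⟶ sk m (VR d k : SSet.{u})) (c : (nv P).obj (op ⦋q⦌))
    (i : Fin (q + 1)) : verts (h.app (op ⦋q⦌) c) i =
      verts (q := 0) (h.app (op ⦋0⦌) (nvMk (fun _ => nvFun c i) monotone_const)) 0 := by
  have h1 : (nvMk (fun _ => nvFun c i) monotone_const : (nv P).obj (op ⦋0⦌)) =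
      (nv P).map (SimplexCategory.const ⦋0⦌ ⦋q⦌ i).op c := nv_ext fun _ => rfl
  rw [h1, NatTrans.naturality_apply h]
  rfl

lemma isLabelling_pushLabel (f : nv P ⟶ sk m (VR d k : SSet.{u})) :
    IsLabelling d k (pushLabel φ f) := fun a a' h => by
  have hm : Monotone (![a, a'] : Fin 2 → (sdP n).obj P) := by
    rw [Fin.monotone_iff_le_succ]
    intro i
    fin_cases i
    exact h
  let c : (nv ((sdP n).obj P)).obj (op ⦋1⦌) := nvMk ![a, a'] hm
  have h0 : verts (q := 1) ((pushMap φ f).app (op ⦋1⦌) c) 0 = pushLabel φ f a :=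
    verts_nv_eq (q := 1) _ c 0
  have h1 : verts (q := 1) ((pushMap φ f).app (op ⦋1⦌) c) 1 = pushLabel φ f a' :=
    verts_nv_eq (q := 1) _ c 1
  have h2 := ((pushMap φ f).app (op ⦋1⦌) c).1.2
  rw [← h0, ← h1]
  exact ⟨h2 0 1, h2 1 0⟩

/-- A simplex as a map from the nerve of an ordinal. -/
def simplexMap {r : ℕ} (σ : (sk m (VR d k : SSet.{u})) _⦋r⦌) :
    nv (ord.{u} r) ⟶ sk m (VR d k : SSet.{u}) :=
  nerveToStd ⦋r⦌ ≫ SSet.yonedaEquiv.symm σ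

lemma nvMap_comp_eq_simplexMap {r : ℕ} (μ : ord r ⟶ P) (f : nv P ⟶ sk m (VR d k : SSet.{u})) :
    nvMap μ ≫ f = simplexMap (f.app (op ⦋r⦌) (nvOfHom (n := op ⦋r⦌) μ)) := by
  unfold simplexMap
  have h := nerveToStd_comp (P := P) (n := ⦋r⦌) (nvOfHom (n := op ⦋r⦌) μ)
  rw [nvHom_nvOfHom] at h
  have h' : SSet.yonedaEquiv.symm (nvOfHom (n := op ⦋r⦌) μ) ≫ f =
      SSet.yonedaEquiv.symm (f.app (op ⦋r⦌) (nvOfHom (n := op ⦋r⦌) μ)) := by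
    apply SSet.yonedaEquiv.injective
    rw [SSet.yonedaEquiv_comp, Equiv.apply_symm_apply, Equiv.apply_symm_apply]
  rw [← h', ← Category.assoc, h]

end Push

section PushGroup

open scoped Simplicial

variable {G : Type u} [Group G] {H : Type v} [Group H] {S : Set H} {ι : G →* H} {k m n : ℕ}
  {χ : Additive G →+ ℝ}
  {φ : (sdIter n).obj (sk m (VR (wordDist S ι) k : SSet.{u})) ⟶
      sk m (VR (wordDist S ι) k : SSet.{u})}

lemma pushLabel_translate (hφ : IsEquivariant S ι φ) {P : PartOrd.{u}}
    (f : nv P ⟶ sk m (VR (wordDist S ι) k : SSet.{u})) (t : G) (w : (sdP n).obj P) :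
    pushLabel φ (f ≫ skMap m (translate S ι k t)) w = t * pushLabel φ f w := by
  have h : pushMap φ (f ≫ skMap m (translate S ι k t)) =
      pushMap φ f ≫ skMap m (translate S ι k t) := by
    unfold pushMap
    rw [Functor.map_comp, Category.assoc, hφ t, Category.assoc, Category.assoc]
  unfold pushLabel
  rw [h]
  rfl

lemma lt_pushLabel (hr : RaisesVal (wordDist S ι) χ φ) {r : ℕ}
    (σ : (sk m (VR (wordDist S ι) k : SSet.{u})) _⦋r⦌) (w : (sdP n).obj (ord.{u} r)) :
    val χ (verts σ) < χ (Additive.ofMul (pushLabel φ (simplexMap σ) w)) := by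
  refine (hr r σ 0 (((sdIter n).map (nerveToStd ⦋r⦌)).app _
    ((nerveSdIter (ord r) n).app _ (nvMk (fun _ => w) monotone_const)))).trans_le ?_
  refine (Finset.inf'_le _ (Finset.mem_univ 0)).trans_eq ?_
  unfold pushLabel pushMap simplexMap
  rw [Functor.map_comp, Category.assoc]
  rfl

lemma val_translate (χ : Additive G →+ ℝ) (t : G) {r : ℕ} (τ : Fin (r + 1) → G) :
    val χ (fun i => t * τ i) = χ (Additive.ofMul t) + val χ τ := by
  unfold val
  refine le_antisymm ?_ ?_
  · obtain ⟨i, -, hi⟩ := Finset.exists_mem_eq_inf' Finset.univ_nonempty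
      fun i => χ (Additive.ofMul (τ i))
    rw [hi, ← map_add]
    exact Finset.inf'_le (fun i => χ (Additive.ofMul (t * τ i))) (Finset.mem_univ i)
  · refine Finset.le_inf' _ _ fun i _ => ?_
    rw [ofMul_mul, map_add]
    exact add_le_add le_rfl (Finset.inf'_le _ (Finset.mem_univ i))

lemma val_le (χ : Additive G →+ ℝ) {r : ℕ} (τ : Fin (r + 1) → G) (i) :
    val χ τ ≤ χ (Additive.ofMul (τ i)) :=
  Finset.inf'_le (fun i => χ (Additive.ofMul (τ i))) (Finset.mem_univ i)

lemma le_val {χ : Additive G →+ ℝ} {r : ℕ} {τ : Fin (r + 1) → G} {c : ℝ}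
    (h : ∀ i, c ≤ χ (Additive.ofMul (τ i))) : c ≤ val χ τ :=
  Finset.le_inf' _ _ fun i _ => h i

/-- Up to translation there are only finitely many simplices of each dimension. -/
lemma finite_simplices (hS : S.Finite) (hgen : Subgroup.closure S = ⊤) (hι : Function.Injective ι)
    (r : ℕ) : Finite {σ : (sk m (VR (wordDist S ι) k : SSet.{u})) _⦋r⦌ // verts σ 0 = 1} := by
  have hf := Set.Finite.pi' fun _ : Fin (r + 1) => finite_ball hS hgen hι k
  have : Finite {f : Fin (r + 1) → G // ∀ i, wordDist S ι 1 (f i) ≤ k} := hf.to_subtype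
  refine Finite.of_injective (β := {f : Fin (r + 1) → G // ∀ i, wordDist S ι 1 (f i) ≤ k})
    (fun σ => ⟨verts σ.1, fun i => ?_⟩) fun σ τ h => ?_
  · have := σ.1.1.2 0 i
    have h0 : σ.1.1.1 0 = 1 := σ.2
    rw [h0] at this
    exact this
  · have h' : verts σ.1 = verts τ.1 := (Subtype.ext_iff.1 h :)
    exact Subtype.ext (Subtype.ext (Subtype.ext h'))

/-- By equivariance, an equivariant map that raises the value raises it by a definite amount and
moves points by a bounded amount. -/
lemma exists_uniform_push (hS : S.Finite) (hgen : Subgroup.closure S = ⊤)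
    (hι : Function.Injective ι) (hφ : IsEquivariant S ι φ)
    (hr : RaisesVal (wordDist S ι) χ φ) :
    ∃ ε > 0, ∃ l : ℕ, ∀ r ≤ m, ∀ (σ : (sk m (VR (wordDist S ι) k : SSet.{u})) _⦋r⦌)
      (w : (sdP n).obj (ord.{u} r)),
      val χ (verts σ) + ε ≤ χ (Additive.ofMul (pushLabel φ (simplexMap σ) w)) ∧
      ∀ i, wordDist S ι (pushLabel φ (simplexMap σ) w) (verts σ i) ≤ l ∧
        wordDist S ι (verts σ i) (pushLabel φ (simplexMap σ) w) ≤ l := by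
  let I := Σ r : Fin (m + 1),
    {σ : (sk m (VR (wordDist S ι) k : SSet.{u})) _⦋r⦌ // verts σ 0 = 1} × (sdP n).obj (ord.{u} r)
  have : Finite I := by
    have := fun r => finite_simplices (m := m) (k := k) hS hgen hι r
    infer_instance
  let e : I → G := fun x => pushLabel φ (simplexMap x.2.1.1) x.2.2
  obtain ⟨ε, hε, h1⟩ : ∃ ε > 0, ∀ x : I, ε ≤ χ (Additive.ofMul (e x)) - val χ (verts x.2.1.1) := by
    rcases isEmpty_or_nonempty I with h | h
    · exact ⟨1, one_pos, fun x => h.elim x⟩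
    · obtain ⟨x, hx⟩ := Finite.exists_min
        fun x : I => χ (Additive.ofMul (e x)) - val χ (verts x.2.1.1)
      exact ⟨_, sub_pos.2 (lt_pushLabel hr x.2.1.1 x.2.2), hx⟩
  obtain ⟨l, hl⟩ : ∃ l : ℕ, ∀ (y : Σ x : I, Fin (x.1 + 1)),
      wordDist S ι (e y.1) (verts y.1.2.1.1 y.2) + wordDist S ι (verts y.1.2.1.1 y.2) (e y.1) ≤ l := by
    obtain ⟨l, hl⟩ := (Set.finite_range fun y : Σ x : I, Fin (x.1 + 1) =>
      wordDist S ι (e y.1) (verts y.1.2.1.1 y.2) +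
        wordDist S ι (verts y.1.2.1.1 y.2) (e y.1)).bddAbove
    exact ⟨l, fun y => hl ⟨y, rfl⟩⟩
  refine ⟨ε, hε, l, fun r hrm σ w => ?_⟩
  -- translate the first vertex to `1`
  set g := verts σ 0
  let σ' := (skMap m (translate S ι k g⁻¹)).app (op ⦋r⦌) σ
  have hσ' : verts σ' = fun i => g⁻¹ * verts σ i := rfl
  have hσ'0 : verts σ' 0 = 1 := inv_mul_cancel g
  have hs : simplexMap σ' = simplexMap σ ≫ skMap m (translate S ι k g⁻¹) := by
    unfold simplexMap
    rw [Category.assoc]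
    congr 1
  have he : pushLabel φ (simplexMap σ') w = g⁻¹ * pushLabel φ (simplexMap σ) w := by
    rw [hs, pushLabel_translate hφ]
  let x : I := ⟨⟨r, Nat.lt_succ_of_le hrm⟩, ⟨σ', hσ'0⟩, w⟩
  have hx : e x = g⁻¹ * pushLabel φ (simplexMap σ) w := he
  constructor
  · have := h1 x
    rw [hx] at this
    change ε ≤ _ - val χ (verts σ') at this
    rw [hσ', val_translate, ofMul_mul, map_add] at this
    linarith
  · intro i
    have := hl ⟨x, i⟩
    rw [hx] at this
    change wordDist S ι _ (verts σ' i) + wordDist S ι (verts σ' i) _ ≤ l at this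
    rw [hσ', wordDist_mul_left, wordDist_mul_left] at this
    exact ⟨(Nat.le_add_right _ _).trans this, (Nat.le_add_left _ _).trans this⟩

/-- An equivariant map that raises the value pushes labellings of posets to labellings of their
subdivisions that are close and have larger values, both uniformly. -/
lemma exists_push_labelling (hS : S.Finite) (hgen : Subgroup.closure S = ⊤)
    (hι : Function.Injective ι) (hφ : IsEquivariant S ι φ)
    (hr : RaisesVal (wordDist S ι) χ φ) :
    ∃ ε > 0, ∃ l : ℕ, ∀ (P : PartOrd.{u}), HeightLE P m → ∀ b : P → G,
      IsLabelling (wordDist S ι) k b → ∃ b' : (sdP n).obj P → G,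
        IsLabelling (wordDist S ι) k b' ∧ ∀ r ≤ m, ∀ (μ : ord.{u} r ⟶ P),
          ∀ w ∈ Set.range ((sdP n).map μ).hom,
            val χ (fun i => b (μ.hom ((ordEquiv r).symm i))) + ε ≤ χ (Additive.ofMul (b' w)) ∧
            ∀ i, wordDist S ι (b' w) (b (μ.hom i)) ≤ l ∧ wordDist S ι (b (μ.hom i)) (b' w) ≤ l := by
  obtain ⟨ε, hε, l, h⟩ := exists_uniform_push (χ := χ) hS hgen hι hφ hr
  refine ⟨ε, hε, l, fun P hP b hb => ?_⟩
  let f := labelSk (m := m) b hb (labelVR_mem_skeleton hP b hb)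
  refine ⟨pushLabel φ f, isLabelling_pushLabel φ f, fun r hrm μ w hw => ?_⟩
  obtain ⟨w, rfl⟩ := hw
  rw [pushLabel_map, nvMap_comp_eq_simplexMap]
  have h1 := h r hrm (f.app (op ⦋r⦌) (nvOfHom (n := op ⦋r⦌) μ)) w
  exact ⟨h1.1, fun i => h1.2 (ordEquiv r i)⟩

end PushGroup

/-! ### Pushing fillings into the positive half -/

section Restrict

variable {G : Type u} [Group G] {d : G → G → ℕ} {χ : Additive G →+ ℝ} {Z : Type*}
  [TopologicalSpace Z] {l : ℕ}

/-- A map whose supports lie in `G_χ` is a map to the Vietoris–Rips complex of `G_χ`. -/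
lemma IsVRMap.restrict {μ : Z → G → ℝ} (h : IsVRMap d l μ)
    (h0 : ∀ z g, μ z g ≠ 0 → 0 ≤ χ (Additive.ofMul g)) :
    IsVRMap (posDist d χ) l fun z (g : Pos χ) => μ z g.1 where
  continuous t := h.continuous t.1
  nonneg z t := h.nonneg z t.1
  exists_finset := by
    classical
    obtain ⟨W, h1, h2⟩ := h.exists_finset
    refine ⟨W.subtype _, fun z t ht => h1 z t.1 fun hW => ht (Finset.mem_subtype.2 hW),
      fun z => ?_⟩
    rw [Finset.sum_subtype_eq_sum_filter (f := μ z), Finset.sum_filter_of_ne, h2]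
    exact fun g _ hg => h0 z g hg
  clique z s t := h.clique z s.1 t.1

/-- A map to the Vietoris–Rips complex of `G_χ` as a map to that of `G`. -/
lemma IsVRMap.push {μ : Z → Pos χ → ℝ} (h : IsVRMap (posDist d χ) l μ) :
    ∃ ν : Z → G → ℝ, IsVRMap d l ν ∧ (∀ z (g : Pos χ), ν z g.1 = μ z g) ∧
      ∀ z g, ν z g ≠ 0 → 0 ≤ χ (Additive.ofMul g) := by
  classical
  let ν : Z → G → ℝ := fun z g => if hg : 0 ≤ χ (Additive.ofMul g) then μ z ⟨g, hg⟩ else 0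
  have hν : ∀ z (g : Pos χ), ν z g.1 = μ z g := fun z g => dif_pos g.2
  have hν0 : ∀ z g, ν z g ≠ 0 → 0 ≤ χ (Additive.ofMul g) := fun z g hg => by
    by_contra h
    exact hg (dif_neg h)
  refine ⟨ν, ⟨fun g => ?_, fun z g => ?_, ?_, fun z s t hs ht => ?_⟩, hν, hν0⟩
  · by_cases hg : 0 ≤ χ (Additive.ofMul g)
    · exact (h.continuous ⟨g, hg⟩).congr fun z => (hν z ⟨g, hg⟩).symm
    · exact continuous_const.congr fun z => (dif_neg hg).symm
  · by_cases hg : 0 ≤ χ (Additive.ofMul g)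
    · exact (h.nonneg z ⟨g, hg⟩).trans_eq (hν z ⟨g, hg⟩).symm
    · exact (show ν z g = 0 from dif_neg hg).ge
  · obtain ⟨W, h1, h2⟩ := h.exists_finset
    refine ⟨W.map (Function.Embedding.subtype _), fun z g hg => ?_, fun z => ?_⟩
    · by_contra hne
      refine hne ((hν z ⟨g, hν0 z g hne⟩).trans (h1 z _ fun hW => hg ?_))
      exact Finset.mem_map.2 ⟨_, hW, rfl⟩
    · rw [Finset.sum_map, ← h2 z]
      exact Finset.sum_congr rfl fun g _ => hν z g
  · have e1 := hν0 z s hs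
    have e2 := hν0 z t ht
    refine h.clique z ⟨s, e1⟩ ⟨t, e2⟩ ?_ ?_
    · rwa [← hν]
    · rwa [← hν]

end Restrict

/-- The support of a point of an order complex is the image of a finite ordinal. -/
lemma OC.exists_support {P : PartOrd.{u}} [Fintype P] (μ : OC P) : ∃ (s : SimplexCategory)
    (f : SimplexCategory.toPartOrd.{u}.obj s ⟶ P), (∀ a b, f.hom a ≤ f.hom b → a ≤ b) ∧
      ∀ x, μ.1 x ≠ 0 ↔ ∃ i, f.hom i = x := by
  classical
  obtain ⟨s, f, hf, hx⟩ := exists_embedding (P := P) ⟨Finset.univ.filter fun x => μ.1 x ≠ 0, by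
    obtain ⟨x, hx⟩ := OC.exists_ne μ
    exact ⟨x, by simpa using hx⟩, by
    rintro ⟨x, hx⟩ ⟨y, hy⟩
    exact OC.comparable μ (by simpa using hx) (by simpa using hy)⟩
  exact ⟨s, f, hf, fun x => by simpa using hx x⟩

/-- Each vertex of the subdivision lies in a subdivided chain. -/
lemma exists_mem_range_sdP {P : PartOrd.{u}} [Fintype P] (n : ℕ) (w : (sdP n).obj P) :
    ∃ (s : SimplexCategory) (f : SimplexCategory.toPartOrd.{u}.obj s ⟶ P),
      (∀ a b, f.hom a ≤ f.hom b → a ≤ b) ∧ w ∈ Set.range ((sdP n).map f).hom := by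
  obtain ⟨s, f, hf, hx⟩ := OC.exists_support (pos n w)
  exact ⟨s, f, hf, mem_range_of_layN_ne_zero f hf (pos n w) (fun a ha => (hx a).1 ha) n w
    (layN_pos_ne_zero n 0 w)⟩

section Fill

variable {G : Type u} [Group G] {d : G → G → ℕ} {χ : Additive G →+ ℝ} {k l m n q : ℕ} {ε : ℝ}

/-- If labellings can be pushed, by a definite amount, then a labelled simplex with boundary in the
positive half can be replaced by one that lies in the positive half, relative to the boundary. The
induction is on the number `J` of pushes that are needed to make all values non-negative. -/
lemma exists_pos_extension (hε : 0 < ε) (hkl : k ≤ l)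
    (hpush : ∀ (P : PartOrd.{u}), HeightLE P m → ∀ b : P → G,
      IsLabelling d k b → ∃ b' : (sdP n).obj P → G,
        IsLabelling d k b' ∧ ∀ r ≤ m, ∀ (μ : ord.{u} r ⟶ P),
          ∀ w ∈ Set.range ((sdP n).map μ).hom,
            val χ (fun i => b (μ.hom ((ordEquiv r).symm i))) + ε ≤ χ (Additive.ofMul (b' w)) ∧
            ∀ i, d (b' w) (b (μ.hom i)) ≤ l ∧ d (b (μ.hom i)) (b' w) ≤ l) :
    ∀ (J : ℕ) (P : PartOrd.{u}) [Fintype P] (_ : HeightLE P m)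
      (ℓ : stdSimplex ℝ (Fin (q + 2)) → OC P) (_ : Continuous ℓ) (t : P → G)
      (_ : IsLabelling d k t)
      (_ : ∀ x : bd q, ∀ a, (ℓ x).1 a ≠ 0 → 0 ≤ χ (Additive.ofMul (t a)))
      (_ : ∀ a, -(J * ε) ≤ χ (Additive.ofMul (t a))),
      ∃ M : stdSimplex ℝ (Fin (q + 2)) → Pos χ → ℝ, IsVRMap (posDist d χ) l M ∧
        ∀ x : bd q, M x = fun g => labelMap ℓ t x g.1 := by
  intro J
  have hmap : ∀ (P : PartOrd.{u}) [Fintype P] {Z : Type} [TopologicalSpace Z] (ℓ : Z → OC P)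
      (_ : Continuous ℓ) (t : P → G) (_ : IsLabelling d k t), IsVRMap d l (labelMap ℓ t) := by
    intro P _ Z _ ℓ hℓ t ht
    refine (isVRMap_labelMap hℓ fun z w w' hw hw' => ?_).mono hkl
    rcases OC.comparable _ hw hw' with h | h
    · exact (ht _ _ h).1
    · exact (ht _ _ h).2
  induction J with
  | zero =>
    intro P _ hP ℓ hℓ t ht hbd hJ
    refine ⟨_, (hmap P ℓ hℓ t ht).restrict fun z g hg => ?_, fun x => rfl⟩
    obtain ⟨w, -, rfl⟩ := labelMap_ne_zero_iff.1 hg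
    simpa using hJ w
  | succ J ih =>
    intro P _ hP ℓ hℓ t ht hbd hJ
    obtain ⟨b, hb, hbl⟩ := hpush P hP t ht
    let ℓ' : stdSimplex ℝ (Fin (q + 2)) → OC ((sdP n).obj P) := fun x => layN n (ℓ x)
    -- on the boundary, the new labels are close to the old ones
    have hnear : ∀ x w, (ℓ' x).1 w ≠ 0 → ∃ r ≤ m, ∃ μ : ord.{u} r ⟶ P,
        w ∈ Set.range ((sdP n).map μ).hom ∧ ∀ a, (ℓ x).1 a ≠ 0 ↔ ∃ i, μ.hom i = a := by
      intro x w hw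
      obtain ⟨s, μ, hμ, hs⟩ := OC.exists_support (ℓ x)
      exact ⟨s.len, hP.len_le hμ, μ,
        mem_range_of_layN_ne_zero μ hμ (ℓ x) (fun a ha => (hs a).1 ha) n w hw, hs⟩
    have hpos' : ∀ x : bd q, ∀ w, (ℓ' x).1 w ≠ 0 → 0 ≤ χ (Additive.ofMul (b w)) := by
      intro x w hw
      obtain ⟨r, hr, μ, hwμ, hs⟩ := hnear x w hw
      refine le_trans ?_ (hbl r hr μ w hwμ).1
      exact add_nonneg (le_val fun i => hbd x _ ((hs _).2 ⟨_, rfl⟩)) hε.le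
    obtain ⟨M, hM, hMb⟩ := ih ((sdP n).obj P) (hP.sdP n) ℓ' ((continuous_layN n).comp hℓ) b hb
      hpos' fun w => by
        obtain ⟨s, μ, hμ, hw⟩ := exists_mem_range_sdP n w
        have h1 := (hbl s.len (hP.len_le hμ) μ w hw).1
        have h2 : -((J + 1 : ℕ) * ε) ≤
            val χ (fun i => t (μ.hom ((ordEquiv s.len).symm i))) := le_val fun i => hJ _
        push_cast at h2
        linarith
    have hf : ∀ (P : PartOrd.{u}) [Fintype P] (ℓ : stdSimplex ℝ (Fin (q + 2)) → OC P)
        (_ : Continuous ℓ) (t : P → G) (_ : IsLabelling d k t)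
        (_ : ∀ x : bd q, ∀ a, (ℓ x).1 a ≠ 0 → 0 ≤ χ (Additive.ofMul (t a))),
        IsVRMap (posDist d χ) l fun (x : bd q) (g : Pos χ) => labelMap ℓ t x g.1 := by
      intro P _ ℓ hℓ t ht hbd
      refine ((hmap P ℓ hℓ t ht).comp continuous_subtype_val).restrict fun z g hg => ?_
      obtain ⟨w, hw, rfl⟩ := labelMap_ne_zero_iff.1 hg
      exact hbd z w hw
    refine exists_extension_of_close (hf P ℓ hℓ t ht hbd)
      (hf _ ℓ' ((continuous_layN n).comp hℓ) b hb hpos') (fun x g g' hg hg' => ?_) hM hMb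
    obtain ⟨a, ha, hag⟩ := labelMap_ne_zero_iff.1 hg
    obtain ⟨w, hw, hwg⟩ := labelMap_ne_zero_iff.1 hg'
    obtain ⟨r, hr, μ, hwμ, hs⟩ := hnear x w hw
    obtain ⟨i, hi⟩ := (hs a).1 ha
    have := (hbl r hr μ w hwμ).2 i
    rw [hi, hag, hwg] at this
    exact ⟨this.2, this.1⟩

end Fill

section RaiseToSigma

variable {G : Type u} [Group G] {H : Type v} [Group H] {S : Set H} {ι : G →* H}
  {χ : Additive G →+ ℝ} {m : ℕ}

/-- If equivariant maps raise the value, then `G_χ` is of type `F_m`: a sphere in `G_χ` has a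
filling in `G`, which can be pushed into `G_χ`. -/
theorem isTypeF_of_raisesVal (hS : S.Finite) (hgen : Subgroup.closure S = ⊤)
    (hι : Function.Injective ι) (hG : IsTypeF (wordDist S ι) m)
    (h : ∃ K : ℕ, ∀ k ≥ K, ∃ (n : ℕ)
        (φ : (sdIter n).obj (sk m (VR (wordDist S ι) k : SSet.{u})) ⟶
          sk m (VR (wordDist S ι) k : SSet.{u})),
        IsEquivariant S ι φ ∧ RaisesVal (wordDist S ι) χ φ) :
    IsTypeF (posDist (wordDist S ι) χ) m := by
  intro q hq k
  obtain ⟨K, hK⟩ := h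
  obtain ⟨l, hkl, hE⟩ := hG q hq k
  rw [piVanishes_iff] at hE
  obtain ⟨n, φ, hφ, hr⟩ := hK (max l K) (le_max_right _ _)
  obtain ⟨ε, hε, e, hpush⟩ := exists_push_labelling hS hgen hι hφ hr
  have hlL : l ≤ max (max l K) e := (le_max_left _ _).trans (le_max_left _ _)
  refine ⟨max (max l K) e, hkl.trans hlL, ?_⟩
  rw [piVanishes_iff]
  intro μ hμ
  obtain ⟨ν, hν, hνμ, hν0⟩ := hμ.push
  obtain ⟨F, hF, hFν⟩ := hE ν hν
  obtain ⟨n₀, t, ht, htF⟩ := exists_simplicial_approx.{u} hF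
  obtain ⟨J, hJ⟩ : ∃ J : ℕ, ∀ a, -(J * ε) ≤ χ (Additive.ofMul (t a)) := by
    obtain ⟨c, hc⟩ := (Set.finite_range fun a => -χ (Additive.ofMul (t a)) / ε).bddAbove
    refine ⟨⌈c⌉₊, fun a => ?_⟩
    have h1 : -χ (Additive.ofMul (t a)) / ε ≤ ⌈c⌉₊ := (hc ⟨a, rfl⟩).trans (Nat.le_ceil c)
    rw [div_le_iff₀ hε] at h1
    linarith
  let ℓ : stdSimplex ℝ (Fin (q + 2)) → OC ((sdP n₀).obj (ord.{u} (q + 1))) :=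
    fun x => layN n₀ (toOC x)
  have hℓ : Continuous ℓ := (continuous_layN n₀).comp continuous_toOC
  have hheight : HeightLE ((sdP n₀).obj (ord.{u} (q + 1))) m := by
    obtain ⟨r, hr, h⟩ := (heightLE_ord.{u} (q + 1)).sdP n₀
    exact ⟨r, hr, fun a => (h a).trans hq⟩
  have hbd : ∀ x : bd q, ∀ a, (ℓ x).1 a ≠ 0 → 0 ≤ χ (Additive.ofMul (t a)) := by
    intro x a ha
    refine hν0 x _ ?_
    rw [← hFν]
    exact htF _ _ (labelMap_ne_zero_iff.2 ⟨a, ha, rfl⟩)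
  have htl : IsLabelling (wordDist S ι) (max l K) t := IsLabelling.mono ht (le_max_left _ _)
  obtain ⟨M, hM, hMb⟩ := exists_pos_extension (q := q) hε (le_max_left (max l K) e)
    (fun P hP b hb => by
      obtain ⟨b', hb', h⟩ := hpush P hP b hb
      exact ⟨b', hb', fun r hr μ w hw => ⟨(h r hr μ w hw).1, fun i =>
        ⟨((h r hr μ w hw).2 i).1.trans (le_max_right _ _),
          ((h r hr μ w hw).2 i).2.trans (le_max_right _ _)⟩⟩⟩)
    J _ hheight ℓ hℓ t htl hbd hJ
  have hlab : IsVRMap (wordDist S ι) l (labelMap ℓ t) := isVRMap_labelMap hℓ fun z w w' hw hw' => by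
    rcases OC.comparable _ hw hw' with h | h
    · exact (ht _ _ h).1
    · exact (ht _ _ h).2
  refine exists_extension_of_close (hμ.mono (hkl.trans hlL))
    (((hlab.comp continuous_subtype_val).restrict fun z g hg => ?_).mono hlL)
    (fun x g g' hg hg' => ?_) hM hMb
  · obtain ⟨w, hw, rfl⟩ := labelMap_ne_zero_iff.1 hg
    exact hbd z w hw
  · have h1 : F x g.1 ≠ 0 := by rwa [hFν, hνμ]
    have h2 : F x g'.1 ≠ 0 := htF _ _ hg'
    exact ⟨(hF.clique _ _ _ h1 h2).trans hlL, (hF.clique _ _ _ h2 h1).trans hlL⟩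

end RaiseToSigma

/-! ### Extending maps over the skeleta -/

section Skeleton

open scoped Simplicial

variable {X Φ : SSet.{u}}

/-- A simplex lies in a subcomplex if one of its degeneracies does. -/
lemma mem_subcomplex_of_epi (A : X.Subcomplex) {s r : SimplexCategory} (θ : s ⟶ r) [Epi θ]
    {τ : X.obj (op r)} (h : X.map θ.op τ ∈ A.obj (op s)) : τ ∈ A.obj (op r) := by
  have := isSplitEpi_of_epi θ
  have h1 : X.map (section_ θ).op (X.map θ.op τ) ∈ A.obj (op r) := A.map (section_ θ).op h
  rwa [← Functor.map_comp_apply, ← op_comp, IsSplitEpi.id, op_id, Functor.map_id_apply] at h1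

lemma exists_of_mem_skeleton_succ {q : ℕ} {r : SimplexCategory} {σ : X.obj (op r)}
    (h : σ ∈ (X.skeleton (q + 1)).obj (op r)) : σ ∈ (X.skeleton q).obj (op r) ∨
      ∃ τ ∈ X.nonDegenerate q, ∃ θ : r ⟶ ⦋q⦌, Epi θ ∧ σ = X.map θ.op τ := by
  induction r using SimplexCategory.rec with | _ p
  obtain ⟨s, θ, hθ, y, rfl⟩ := X.exists_nonDegenerate σ
  have hy := mem_subcomplex_of_epi _ θ h
  rw [SSet.mem_skeleton_obj_iff_of_nonDegenerate] at hy
  rcases Nat.lt_or_ge s q with hs | hs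
  · exact Or.inl ((X.skeleton q).map θ.op (X.mem_skeleton _ hs))
  · obtain rfl : s = q := by omega
    exact Or.inr ⟨y.1, y.2, θ, hθ, rfl⟩

/-- A map on a skeleton extends to the next skeleton if it extends to the simplices of the next
dimension. -/
lemma exists_extend_skeleton {q : ℕ} (F : ∀ s, X.obj (op s) → Φ.obj (op s))
    (hF : ∀ (s r : SimplexCategory) (θ : s ⟶ r) (σ : X.obj (op r)),
      σ ∈ (X.skeleton (q + 1)).obj (op r) → F s (X.map θ.op σ) = Φ.map θ.op (F r σ))
    (b : X _⦋q + 1⦌ → Φ _⦋q + 1⦌) (hb : ∀ τ i, Φ.δ i (b τ) = F ⦋q⦌ (X.δ i τ)) :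
    ∃ F' : ∀ s, X.obj (op s) → Φ.obj (op s),
      (∀ s σ, σ ∈ (X.skeleton (q + 1)).obj (op s) → F' s σ = F s σ) ∧
      ∀ (s : SimplexCategory) (θ : s ⟶ ⦋q + 1⦌), ∀ τ ∈ X.nonDegenerate (q + 1),
        F' s (X.map θ.op τ) = Φ.map θ.op (b τ) := by
  classical
  have hex : ∀ (s : SimplexCategory) (σ : X.obj (op s)), ∃ c : Φ.obj (op s),
      (σ ∈ (X.skeleton (q + 1)).obj (op s) → c = F s σ) ∧
      ∀ (θ : s ⟶ ⦋q + 1⦌), ∀ τ ∈ X.nonDegenerate (q + 1), σ = X.map θ.op τ →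
        c = Φ.map θ.op (b τ) := by
    intro s σ
    by_cases hσ : σ ∈ (X.skeleton (q + 1)).obj (op s)
    · refine ⟨F s σ, fun _ => rfl, fun θ τ hτ h => ?_⟩
      by_cases hθ : Function.Surjective θ.toOrderHom
      · exfalso
        have hepi : Epi θ := SimplexCategory.epi_iff_surjective.2 hθ
        rw [h] at hσ
        have h1 := mem_subcomplex_of_epi _ θ hσ
        exact lt_irrefl _ ((X.mem_skeleton_obj_iff_of_nonDegenerate ⟨τ, hτ⟩ _).1 h1)
      · obtain ⟨i, θ', rfl⟩ := SimplexCategory.eq_comp_δ_of_not_surjective θ hθ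
        have e1 : σ = X.map θ'.op (X.δ i τ) := by
          rw [h, op_comp, Functor.map_comp_apply]
          rfl
        rw [e1, hF _ _ θ' _ (X.mem_skeleton _), ← hb, op_comp, Functor.map_comp_apply]
        rfl
    · by_cases h : ∃ (θ : s ⟶ ⦋q + 1⦌), ∃ τ ∈ X.nonDegenerate (q + 1), σ = X.map θ.op τ
      · obtain ⟨θ, τ, hτ, h⟩ := h
        refine ⟨Φ.map θ.op (b τ), fun h' => absurd h' hσ, fun θ' τ' hτ' h' => ?_⟩
        have hepi : ∀ (θ : s ⟶ ⦋q + 1⦌) (τ : X _⦋q + 1⦌), σ = X.map θ.op τ → Epi θ := by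
          intro θ τ h
          rw [SimplexCategory.epi_iff_surjective]
          by_contra hθ
          obtain ⟨i, θ', rfl⟩ := SimplexCategory.eq_comp_δ_of_not_surjective θ hθ
          apply hσ
          have e1 : σ = X.map θ'.op (X.δ i τ) := by
            rw [h, op_comp, Functor.map_comp_apply]
            rfl
          rw [e1]
          exact (X.skeleton (q + 1)).map θ'.op (X.mem_skeleton _)
        induction s using SimplexCategory.rec with | _ p
        have := hepi θ τ h
        have e1 := X.unique_nonDegenerate_simplex σ θ ⟨τ, hτ⟩ h θ' ⟨τ', hτ'⟩ h'
        have e2 := X.unique_nonDegenerate_map σ θ ⟨τ, hτ⟩ h θ' ⟨τ', hτ'⟩ h'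
        obtain rfl : τ = τ' := congrArg Subtype.val e1
        rw [e2]
      · exact ⟨F s σ, fun h' => absurd h' hσ, fun θ τ hτ h' => absurd ⟨θ, τ, hτ, h'⟩ h⟩
  choose F' h1 h2 using hex
  exact ⟨F', h1, fun s θ τ hτ => h2 s _ θ τ hτ rfl⟩

end Skeleton

section Minimal

open scoped Simplicial

/-- Each vertex of a subdivided simplex lies in a smallest subdivided face. -/
lemma exists_minimal_face {q : ℕ} (n : ℕ) (w : (sdP n).obj (ord.{u} (q + 1))) :
    ∃ (s : SimplexCategory) (f : s ⟶ ⦋q + 1⦌)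
      (x : (sdP n).obj (SimplexCategory.toPartOrd.{u}.obj s)),
      ((sdP n).map (SimplexCategory.toPartOrd.map f)).hom x = w ∧
      ∀ i v, ((sdP n).map (face i)).hom v = w → ∃ g : s ⟶ ⦋q⦌, f = g ≫ SimplexCategory.δ i ∧
        v = ((sdP n).map (SimplexCategory.toPartOrd.map g)).hom x := by
  obtain ⟨s, f, hf, hs⟩ := OC.exists_support (pos n w)
  obtain ⟨x, hx⟩ := mem_range_of_layN_ne_zero f hf (pos n w) (fun a ha => (hs a).1 ha) n w
    (layN_pos_ne_zero n 0 w)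
  let f' : s ⟶ ⦋q + 1⦌ := SimplexCategory.Hom.mk
    ⟨fun i => ordEquiv (q + 1) (f.hom ⟨i⟩), fun i j h => f.hom.monotone h⟩
  have hf' : SimplexCategory.toPartOrd.map f' = f := rfl
  refine ⟨s, f', x, by rw [hf', hx], fun i v hv => ?_⟩
  obtain ⟨g, hg⟩ := SimplexCategory.eq_comp_δ_of_not_surjective' f' i fun j =>
    mem_range_face.1 (mem_range_of_pos_ne_zero (face i) n ⟨v, hv⟩ ((hs _).2 ⟨⟨j⟩, rfl⟩))
  refine ⟨g, hg, sdP_map_injective (face i) (face_reflects i) n ?_⟩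
  rw [hv, ← hx, ← hf', hg, Functor.map_comp, Functor.map_comp]
  rfl

end Minimal

/-- The simplicial set of labelled, subdivided simplices: its `q`-simplices are the families of
points of `T` that are indexed by the vertices of the `n`-fold subdivision of a `q`-simplex. -/
def labelSet (T : Type u) (n : ℕ) : SSet.{u} where
  obj s := (sdP n).obj (SimplexCategory.toPartOrd.{u}.obj s.unop) → T
  map θ := TypeCat.ofHom fun f w => f (((sdP n).map (SimplexCategory.toPartOrd.map θ.unop)).hom w)
  map_id s := by
    ext f w
    change f (((sdP n).map (SimplexCategory.toPartOrd.map (𝟙 _))).hom w) = f w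
    rw [CategoryTheory.Functor.map_id, CategoryTheory.Functor.map_id]
    rfl
  map_comp θ η := by
    ext f w
    change f (((sdP n).map (SimplexCategory.toPartOrd.map (η.unop ≫ θ.unop))).hom w) = _
    rw [Functor.map_comp, Functor.map_comp]
    rfl

/-! ### Equivariant labellings that raise the value -/

section Raise

open scoped Simplicial

variable {G : Type u} [Group G] {H : Type v} [Group H] {S : Set H} {ι : G →* H}
  {χ : Additive G →+ ℝ} {K n q l l' : ℕ} {c : ℝ}

/-- A family of labels for the `n`-fold subdivisions of the simplices of `VR_K G` that is, on the
`q`-skeleton, natural, equivariant, a map to `VR_l G`, and raises the value by at least `c`. -/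
structure IsRaising (S : Set H) (ι : G →* H) (χ : Additive G →+ ℝ) (K n q l : ℕ) (c : ℝ)
    (F : ∀ s, (VR (wordDist S ι) K : SSet.{u}).obj (op s) →
      (sdP n).obj (SimplexCategory.toPartOrd.{u}.obj s) → G) :
    Prop where
  natural : ∀ (s r : SimplexCategory) (θ : s ⟶ r)
    (σ : (VR (wordDist S ι) K : SSet.{u}).obj (op r)),
    σ ∈ ((VR (wordDist S ι) K : SSet.{u}).skeleton (q + 1)).obj (op r) →
      ∀ w, F s ((VR (wordDist S ι) K : SSet.{u}).map θ.op σ) w =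
        F r σ (((sdP n).map (SimplexCategory.toPartOrd.map θ)).hom w)
  equivariant : ∀ (g : G) (s : SimplexCategory)
    (σ : (VR (wordDist S ι) K : SSet.{u}).obj (op s)),
    σ ∈ ((VR (wordDist S ι) K : SSet.{u}).skeleton (q + 1)).obj (op s) →
      ∀ w, F s ((translate S ι K g).app (op s) σ) w = g * F s σ w
  labelling : ∀ (s : SimplexCategory) (σ : (VR (wordDist S ι) K : SSet.{u}).obj (op s)),
    σ ∈ ((VR (wordDist S ι) K : SSet.{u}).skeleton (q + 1)).obj (op s) →
      IsLabelling (wordDist S ι) l (F s σ)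
  val_add_le : ∀ (s : SimplexCategory) (σ : (VR (wordDist S ι) K : SSet.{u}).obj (op s)),
    σ ∈ ((VR (wordDist S ι) K : SSet.{u}).skeleton (q + 1)).obj (op s) →
      ∀ w, val χ σ.1 + c ≤ χ (Additive.ofMul (F s σ w))

/-- On the vertices, translation by an element of positive value is a family as required. -/
lemma exists_isRaising_zero (t : G) :
    ∃ F, IsRaising S ι χ K 0 0 l (χ (Additive.ofMul t)) F := by
  refine ⟨fun s σ w => σ.1 (ULift.down w) * t, fun s r θ σ _ w => rfl, fun g s σ _ w => mul_assoc _ _ _,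
    fun s σ h => ?_, fun s σ _ w => ?_⟩
  · rcases exists_of_mem_skeleton_succ h with h | ⟨τ, -, θ, -, rfl⟩
    · rw [SSet.skeleton_zero] at h
      exact h.elim
    · intro a a' _
      have h0 : ∀ i, ((VR (wordDist S ι) K : SSet.{u}).map θ.op τ).1 i = τ.1 0 := fun i =>
        congrArg τ.1 (Subsingleton.elim (α := Fin 1) _ _)
      dsimp only
      rw [h0, h0, wordDist_self]
      exact ⟨Nat.zero_le _, Nat.zero_le _⟩
  · rw [ofMul_mul, map_add]
    exact add_le_add (val_le χ _ _) le_rfl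

/-- The labels on the boundary of a simplex extend to fine subdivisions of the simplex. -/
lemma IsRaising.exists_fill
    {F : ∀ s, (VR (wordDist S ι) K : SSet.{u}).obj (op s) →
      (sdP n).obj (SimplexCategory.toPartOrd.{u}.obj s) → G}
    (hF : IsRaising S ι χ K n q l c F) (hl : l ≤ l')
    (hE : ExtendsVR (posDist (wordDist S ι) χ) q l l') {t : G} (ht : χ (Additive.ofMul t) = c)
    (τ : (VR (wordDist S ι) K : SSet.{u}) _⦋q + 1⦌) :
    ∃ j₀, ∀ j ≥ j₀, ∃ b : (sdP (n + j)).obj (ord.{u} (q + 1)) → G,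
      IsLabelling (wordDist S ι) l' b ∧ (∀ w, val χ τ.1 + c ≤ χ (Additive.ofMul (b w))) ∧
      ∀ i v, b (((sdP (n + j)).map (face i)).hom v) =
        F ⦋q⦌ ((VR (wordDist S ι) K : SSet.{u}).δ i τ) (lastN n j v) := by
  classical
  choose s f x hx hmin using exists_minimal_face.{u} (q := q) n
  -- the labels on the boundary, glued from the faces
  let a : (sdP n).obj (ord.{u} (q + 1)) → G := fun w =>
    F (s w) ((VR (wordDist S ι) K : SSet.{u}).map (f w).op τ) (x w)
  have ha : ∀ i v, a (((sdP n).map (face i)).hom v) =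
      F ⦋q⦌ ((VR (wordDist S ι) K : SSet.{u}).δ i τ) v := by
    intro i v
    obtain ⟨g, hg, hv⟩ := hmin _ i v rfl
    have h1 : (VR (wordDist S ι) K : SSet.{u}).map (f (((sdP n).map (face i)).hom v)).op τ =
        (VR (wordDist S ι) K : SSet.{u}).map g.op ((VR (wordDist S ι) K : SSet.{u}).δ i τ) := by
      rw [hg]
      rfl
    change F _ ((VR (wordDist S ι) K : SSet.{u}).map (f (((sdP n).map (face i)).hom v)).op τ) _ = _
    rw [h1, hF.natural _ _ g _ (SSet.mem_skeleton _ _)]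
    exact congrArg (F ⦋q⦌ ((VR (wordDist S ι) K : SSet.{u}).δ i τ)) hv.symm
  -- translate the half space of values at least `val χ τ + c` to the positive half
  obtain ⟨i₀, -, hi₀⟩ := Finset.exists_mem_eq_inf' Finset.univ_nonempty
    fun i => χ (Additive.ofMul (τ.1 i))
  let g₀ : G := τ.1 i₀ * t
  have hg₀ : χ (Additive.ofMul g₀) = val χ τ.1 + c := by
    rw [ofMul_mul, map_add, ht]
    exact congrArg (· + c) hi₀.symm
  have hχ : ∀ g : G, χ (Additive.ofMul (g₀⁻¹ * g)) = χ (Additive.ofMul g) - (val χ τ.1 + c) := by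
    intro g
    rw [ofMul_mul, ofMul_inv, map_add, map_neg, hg₀]
    ring
  have haχ : ∀ i v, val χ τ.1 + c ≤ χ (Additive.ofMul (a (((sdP n).map (face i)).hom v))) := by
    intro i v
    rw [ha]
    refine le_trans ?_ (hF.val_add_le ⦋q⦌ _ (SSet.mem_skeleton _ _) v)
    exact add_le_add (le_val fun j => val_le χ τ.1 _) le_rfl
  let a' : (sdP n).obj (ord.{u} (q + 1)) → Pos χ := fun w =>
    if h : 0 ≤ χ (Additive.ofMul (g₀⁻¹ * a w)) then ⟨g₀⁻¹ * a w, h⟩ else ⟨1, by simp⟩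
  have ha' : ∀ i v, (a' (((sdP n).map (face i)).hom v)).1 =
      g₀⁻¹ * F ⦋q⦌ ((VR (wordDist S ι) K : SSet.{u}).δ i τ) v := by
    intro i v
    have h : 0 ≤ χ (Additive.ofMul (g₀⁻¹ * a (((sdP n).map (face i)).hom v))) := by
      rw [hχ]
      exact sub_nonneg.2 (haχ i v)
    have h1 : a' (((sdP n).map (face i)).hom v) = ⟨_, h⟩ := dif_pos h
    rw [h1, ← ha]
  obtain ⟨j₀, hj₀⟩ := exists_labels_extending hl hE n a' (by
    rintro i _ _ ⟨v, rfl⟩ ⟨v', rfl⟩ h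
    have h1 := hF.labelling ⦋q⦌ ((VR (wordDist S ι) K : SSet.{u}).δ i τ) (SSet.mem_skeleton _ _)
      v v' (sdP_map_reflects _ (face_reflects i) n _ _ h)
    unfold posDist
    rw [ha', ha', wordDist_mul_left, wordDist_mul_left]
    exact h1)
  refine ⟨j₀, fun j hj => ?_⟩
  obtain ⟨b, hb, hba⟩ := hj₀ j hj
  refine ⟨fun w => g₀ * (b w).1, fun w w' h => ?_, fun w => ?_, fun i v => ?_⟩
  · rw [wordDist_mul_left, wordDist_mul_left]
    exact hb w w' h
  · rw [ofMul_mul, map_add, hg₀]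
    exact le_add_of_nonneg_right (b w).2
  · dsimp only
    rw [hba i _ ⟨v, rfl⟩, lastN_map, ha', mul_inv_cancel_left]

/-- The fillings of the simplices can be chosen equivariantly, for a common subdivision: there are
only finitely many simplices up to translation, and the translations act freely. -/
lemma IsRaising.exists_equivariant_fill (hS : S.Finite) (hgen : Subgroup.closure S = ⊤)
    (hι : Function.Injective ι)
    {F : ∀ s, (VR (wordDist S ι) K : SSet.{u}).obj (op s) →
      (sdP n).obj (SimplexCategory.toPartOrd.{u}.obj s) → G}
    (hF : IsRaising S ι χ K n q l c F) (hl : l ≤ l')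
    (hE : ExtendsVR (posDist (wordDist S ι) χ) q l l') {t : G} (ht : χ (Additive.ofMul t) = c) :
    ∃ j, ∃ b : (VR (wordDist S ι) K : SSet.{u}) _⦋q + 1⦌ →
        (sdP (n + j)).obj (ord.{u} (q + 1)) → G,
      ∀ τ, IsLabelling (wordDist S ι) l' (b τ) ∧
      (∀ w, val χ τ.1 + c ≤ χ (Additive.ofMul (b τ w))) ∧
      (∀ i v, b τ (((sdP (n + j)).map (face i)).hom v) =
        F ⦋q⦌ ((VR (wordDist S ι) K : SSet.{u}).δ i τ) (lastN n j v)) ∧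
      ∀ g w, b ((translate S ι K g).app (op ⦋q + 1⦌) τ) w = g * b τ w := by
  choose j₀ hj₀ using fun τ => hF.exists_fill hl hE ht τ
  have hfin : Finite {τ : (VR (wordDist S ι) K : SSet.{u}) _⦋q + 1⦌ // τ.1 0 = 1} := by
    have hf := Set.Finite.pi' fun _ : Fin (q + 1 + 1) => finite_ball hS hgen hι K
    have : Finite {f : Fin (q + 1 + 1) → G // ∀ i, wordDist S ι 1 (f i) ≤ K} := hf.to_subtype
    refine Finite.of_injective
      (β := {f : Fin (q + 1 + 1) → G // ∀ i, wordDist S ι 1 (f i) ≤ K})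
      (fun σ => ⟨σ.1.1, fun i => ?_⟩) fun σ τ h => ?_
    · have := σ.1.2 0 i
      rw [σ.2] at this
      exact this
    · have h' : σ.1.1 = τ.1.1 := (Subtype.ext_iff.1 h :)
      exact Subtype.ext (Subtype.ext h')
  obtain ⟨j, hj⟩ : ∃ j, ∀ τ : {τ : (VR (wordDist S ι) K : SSet.{u}) _⦋q + 1⦌ // τ.1 0 = 1},
      j₀ τ.1 ≤ j := by
    obtain ⟨j, hj⟩ := (Set.finite_range fun τ : {τ : (VR (wordDist S ι) K : SSet.{u}) _⦋q + 1⦌ //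
      τ.1 0 = 1} => j₀ τ.1).bddAbove
    exact ⟨j, fun τ => hj ⟨τ, rfl⟩⟩
  -- the translate of a simplex with first vertex `1`
  let N : (VR (wordDist S ι) K : SSet.{u}) _⦋q + 1⦌ → (VR (wordDist S ι) K : SSet.{u}) _⦋q + 1⦌ :=
    fun τ => (translate S ι K (τ.1 0)⁻¹).app (op ⦋q + 1⦌) τ
  have hN0 : ∀ τ, (N τ).1 0 = 1 := fun τ => inv_mul_cancel _
  have hNτ : ∀ τ, (translate S ι K (τ.1 0)).app (op ⦋q + 1⦌) (N τ) = τ := fun τ =>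
    Subtype.ext (funext fun i => mul_inv_cancel_left _ _)
  have hNg : ∀ g τ, N ((translate S ι K g).app (op ⦋q + 1⦌) τ) = N τ := fun g τ => by
    refine Subtype.ext (funext fun i => ?_)
    change (g * τ.1 0)⁻¹ * (g * τ.1 i) = (τ.1 0)⁻¹ * τ.1 i
    group
  choose B' hB' using fun τ : {τ : (VR (wordDist S ι) K : SSet.{u}) _⦋q + 1⦌ // τ.1 0 = 1} =>
    hj₀ τ.1 j (hj τ)
  refine ⟨j, fun τ w => τ.1 0 * B' ⟨N τ, hN0 τ⟩ w, fun τ => ⟨fun w w' h => ?_, fun w => ?_,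
    fun i v => ?_, fun g w => ?_⟩⟩
  · rw [wordDist_mul_left, wordDist_mul_left]
    exact (hB' ⟨N τ, hN0 τ⟩).1 w w' h
  · have h1 := (hB' ⟨N τ, hN0 τ⟩).2.1 w
    have h2 : val χ (N τ).1 = χ (Additive.ofMul (τ.1 0)⁻¹) + val χ τ.1 := val_translate χ _ τ.1
    rw [h2, ofMul_inv, map_neg] at h1
    rw [ofMul_mul, map_add]
    linarith
  · dsimp only
    rw [(hB' ⟨N τ, hN0 τ⟩).2.2 i v, ← hF.equivariant _ _ _ (SSet.mem_skeleton _ _)]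
    have h1 : (translate S ι K (τ.1 0)).app (op ⦋q⦌)
        ((VR (wordDist S ι) K : SSet.{u}).δ i (N τ)) =
        (VR (wordDist S ι) K : SSet.{u}).δ i τ := by
      conv_rhs => rw [← hNτ τ]
      rfl
    rw [h1]
  · dsimp only
    have h1 : (⟨N ((translate S ι K g).app (op ⦋q + 1⦌) τ), hN0 _⟩ :
        {τ : (VR (wordDist S ι) K : SSet.{u}) _⦋q + 1⦌ // τ.1 0 = 1}) = ⟨N τ, hN0 τ⟩ :=
      Subtype.ext (hNg g τ)
    rw [h1]
    exact mul_assoc _ _ _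

/-- If spheres in `G_χ` of dimension `q` can be filled, then a family on the `q`-skeleton extends to
the `(q + 1)`-skeleton, after further subdivision. -/
lemma IsRaising.exists_succ (hS : S.Finite) (hgen : Subgroup.closure S = ⊤)
    (hι : Function.Injective ι)
    {F : ∀ s, (VR (wordDist S ι) K : SSet.{u}).obj (op s) →
      (sdP n).obj (SimplexCategory.toPartOrd.{u}.obj s) → G}
    (hF : IsRaising S ι χ K n q l c F) (hl : l ≤ l')
    (hE : ExtendsVR (posDist (wordDist S ι) χ) q l l') {t : G} (ht : χ (Additive.ofMul t) = c) :
    ∃ n' F', IsRaising S ι χ K n' (q + 1) l' c F' := by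
  obtain ⟨j, b, hb⟩ := hF.exists_equivariant_fill hS hgen hι hl hE ht
  let X : SSet.{u} := VR (wordDist S ι) K
  obtain ⟨F', hF'1, hF'2⟩ := exists_extend_skeleton (X := X) (Φ := labelSet G (n + j)) (q := q)
    (fun s σ w => F s σ (lastN n j w)) (fun s r θ σ hσ => funext fun w => by
      dsimp only
      rw [hF.natural s r θ σ hσ, ← lastN_map]
      rfl) b (fun τ i => funext fun v => (hb τ).2.2.1 i v)
  have hold : ∀ s σ, σ ∈ (X.skeleton (q + 1)).obj (op s) → ∀ w, F' s σ w = F s σ (lastN n j w) :=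
    fun s σ h w => congrFun (hF'1 s σ h) w
  have hnew : ∀ (s : SimplexCategory) (θ : s ⟶ ⦋q + 1⦌), ∀ τ ∈ X.nonDegenerate (q + 1), ∀ w,
      F' s (X.map θ.op τ) w = b τ (((sdP (n + j)).map (SimplexCategory.toPartOrd.map θ)).hom w) :=
    fun s θ τ h w => congrFun (hF'2 s θ τ h) w
  refine ⟨n + j, F', fun s r θ σ hσ w => ?_, fun g s σ hσ w => ?_, fun s σ hσ w w' hw => ?_,
    fun s σ hσ w => ?_⟩
  · rcases exists_of_mem_skeleton_succ hσ with h | ⟨τ, hτ, η, hη, rfl⟩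
    · rw [hold _ _ h, hold _ _ (Subfunctor.map _ θ.op h), lastN_map]
      exact hF.natural s r θ σ h _
    · have h1 : X.map θ.op (X.map η.op τ) = X.map (θ ≫ η).op τ := by
        rw [op_comp, Functor.map_comp_apply]
      refine (congrArg (fun x => F' s x w) h1).trans ((hnew _ _ _ hτ w).trans ?_)
      rw [hnew _ _ _ hτ, Functor.map_comp, Functor.map_comp]
      rfl
  · rcases exists_of_mem_skeleton_succ hσ with h | ⟨τ, hτ, η, hη, rfl⟩
    · rw [hold _ _ h, hold _ _ (skeleton_le_preimage (translate S ι K g) _ _ h)]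
      exact hF.equivariant g s σ h _
    · have hτg : (translate S ι K g).app (op ⦋q + 1⦌) τ ∈ X.nonDegenerate (q + 1) := by
        intro hd
        apply hτ
        obtain ⟨m, hm, θ, y, hy⟩ := hd
        refine ⟨m, hm, θ, (translate S ι K g⁻¹).app _ y, ?_⟩
        rw [← NatTrans.naturality_apply, hy]
        exact Subtype.ext (funext fun i => inv_mul_cancel_left _ _)
      rw [NatTrans.naturality_apply (translate S ι K g), hnew _ _ _ hτ]
      exact (hnew _ _ _ hτg w).trans ((hb τ).2.2.2 g _)
  · rcases exists_of_mem_skeleton_succ hσ with h | ⟨τ, hτ, η, hη, rfl⟩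
    · rw [hold _ _ h, hold _ _ h]
      exact ((hF.labelling s σ h).mono hl) _ _ (lastN_mono n j hw)
    · rw [hnew _ _ _ hτ, hnew _ _ _ hτ]
      exact (hb τ).1 _ _ (((sdP (n + j)).map (SimplexCategory.toPartOrd.map η)).hom.monotone hw)
  · rcases exists_of_mem_skeleton_succ hσ with h | ⟨τ, hτ, η, hη, rfl⟩
    · rw [hold _ _ h]
      exact hF.val_add_le s σ h _
    · rw [hnew _ _ _ hτ]
      refine le_trans (add_le_add (le_val fun i => ?_) le_rfl) ((hb τ).2.1 _)
      obtain ⟨i, rfl⟩ := SimplexCategory.epi_iff_surjective.1 hη i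
      exact val_le χ (X.map η.op τ).1 i

end Raise

/-! ### The equivariant map given by the labels -/

section Descend

open scoped Simplicial

variable {G : Type u} [Group G] {H : Type v} [Group H] {S : Set H} {ι : G →* H}
  {χ : Additive G →+ ℝ} {m K n l : ℕ} {c : ℝ}

/-- A family of labels that raises the value assembles to an equivariant simplicial map. -/
lemma IsRaising.exists_map
    {F : ∀ s, (VR (wordDist S ι) K : SSet.{u}).obj (op s) →
      (sdP n).obj (SimplexCategory.toPartOrd.{u}.obj s) → G}
    (hF : IsRaising S ι χ K n m l c F) (hl : l ≤ K) (hc : 0 < c) :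
    ∃ φ : (sdIter n).obj (sk m (VR (wordDist S ι) K : SSet.{u})) ⟶
        sk m (VR (wordDist S ι) K : SSet.{u}),
      IsEquivariant S ι φ ∧ RaisesVal (wordDist S ι) χ φ := by
  have := sdIter_isLeftAdjoint.{u} n
  have hlab : ∀ (s : SimplexCategory) (σ : (sk m (VR (wordDist S ι) K : SSet.{u})).obj (op s)),
      IsLabelling (wordDist S ι) K (F s σ.1) := fun s σ => (hF.labelling s σ.1 σ.2).mono hl
  -- a simplex of large dimension is degenerate, so its labels factor through a small simplex
  have hsk : ∀ (s : SimplexCategory) (σ : (sk m (VR (wordDist S ι) K : SSet.{u})).obj (op s))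
      (p : SimplexCategoryᵒᵖ) (x : (nv ((sdP n).obj (SimplexCategory.toPartOrd.{u}.obj s))).obj p),
      (labelVR (F s σ.1) (hlab s σ)).app p x ∈
        ((VR (wordDist S ι) K : SSet.{u}).skeleton (m + 1)).obj p := by
    have key : ∀ q ≤ m + 1, ∀ (s : SimplexCategory)
        (σ : (sk m (VR (wordDist S ι) K : SSet.{u})).obj (op s)),
        σ.1 ∈ ((VR (wordDist S ι) K : SSet.{u}).skeleton q).obj (op s) → ∀ p x,
        (labelVR (F s σ.1) (hlab s σ)).app p x ∈
          ((VR (wordDist S ι) K : SSet.{u}).skeleton (m + 1)).obj p := by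
      intro q hq
      induction q with
      | zero =>
        intro s σ h
        rw [SSet.skeleton_zero] at h
        exact h.elim
      | succ q ih =>
        intro s σ h p x
        rcases exists_of_mem_skeleton_succ h with h | ⟨τ, -, θ, -, h⟩
        · exact ih (by omega) s σ h p x
        · have hτ : τ ∈ ((VR (wordDist S ι) K : SSet.{u}).skeleton (m + 1)).obj (op ⦋q⦌) :=
            SSet.mem_skeleton _ _ (by omega)
          have hh : HeightLE ((sdP n).obj (ord.{u} q)) m := by
            obtain ⟨r, hr, h⟩ := (heightLE_ord.{u} q).sdP n
            exact ⟨r, hr, fun a => (h a).trans (by omega)⟩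
          have h1 := labelVR_mem_skeleton hh (F ⦋q⦌ τ) (hlab ⦋q⦌ ⟨τ, hτ⟩) p
            ((nvMap ((sdP n).map (SimplexCategory.toPartOrd.map θ))).app p x)
          convert h1 using 1
          refine Subtype.ext (funext fun i => ?_)
          rw [labelVR_app, labelVR_app, h]
          exact hF.natural s ⦋q⦌ θ τ hτ _
    exact fun s σ => key (m + 1) le_rfl s σ σ.2
  let g : ∀ s : SimplexCategory, (sk m (VR (wordDist S ι) K : SSet.{u})).obj (op s) →
      ((sdIter n).obj (SSet.stdSimplex.{u}.obj s) ⟶ sk m (VR (wordDist S ι) K : SSet.{u})) :=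
    fun s σ => (sdIter n).map (stdToNerve s) ≫ sdNerveIter _ n ≫ labelSk _ (hlab s σ) (hsk s σ)
  obtain ⟨φ, hφ⟩ := exists_desc_of_isLeftAdjoint (sdIter.{u} n) g (fun {s r} θ σ => by
    have h1 : labelSk _ (hlab r _) (hsk r
        ((sk m (VR (wordDist S ι) K : SSet.{u})).map θ.op σ)) =
        nvMap ((sdP n).map (SimplexCategory.toPartOrd.map θ)) ≫ labelSk _ (hlab s σ) (hsk s σ) := by
      ext p x
      exact Subtype.ext (Subtype.ext (funext fun i => hF.natural r s θ σ.1 σ.2 _))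
    dsimp only [g]
    rw [h1, ← Category.assoc (sdNerveIter _ n), ← sdNerveIter_naturality, Category.assoc,
      ← Category.assoc, ← Functor.map_comp, ← stdToNerve_naturality, Functor.map_comp,
      Category.assoc])
  refine ⟨φ, fun t => ?_, fun q σ p τ => ?_⟩
  · refine hom_ext_of_isLeftAdjoint (sdIter.{u} n) fun s σ => ?_
    have h1 : SSet.yonedaEquiv.symm σ ≫ skMap m (translate S ι K t) =
        SSet.yonedaEquiv.symm ((skMap m (translate S ι K t)).app (op s) σ) := rfl
    rw [← Category.assoc, ← Functor.map_comp, h1, hφ, ← Category.assoc, hφ]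
    dsimp only [g]
    rw [Category.assoc, Category.assoc]
    congr 2
    ext p x
    exact Subtype.ext (Subtype.ext (funext fun i => hF.equivariant t s σ.1 σ.2 _))
  · rw [hφ]
    refine lt_of_lt_of_le (lt_add_of_pos_right _ hc) (le_val fun i => ?_)
    exact hF.val_add_le ⦋q⦌ σ.1 σ.2 _

end Descend

section Main

variable {G : Type u} [Group G] {H : Type v} [Group H] {S : Set H} {ι : G →* H}
  {χ : Additive G →+ ℝ} {m : ℕ}

lemma exists_val_pos (hχ : χ ≠ 0) : ∃ t : G, 0 < χ (Additive.ofMul t) := by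
  by_contra! h
  refine hχ (AddMonoidHom.ext fun g => le_antisymm (h g.toMul) ?_)
  have := h g.toMul⁻¹
  rw [ofMul_inv, map_neg] at this
  simpa using this

/-- If the homotopy groups of the half space vanish along a finite sequence of values, then there
are equivariant maps that raise the value. -/
theorem exists_raisesVal (hS : S.Finite) (hgen : Subgroup.closure S = ⊤)
    (hι : Function.Injective ι) (hχ : χ ≠ 0) (k : Fin (m + 1) → ℕ)
    (hk : ∀ q : Fin m, ∃ h : k q.castSucc ≤ k q.succ, PiVanishes (posDist (wordDist S ι) χ) q h) :
    ∃ K : ℕ, ∀ k ≥ K, ∃ (n : ℕ)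
      (φ : (sdIter n).obj (sk m (VR (wordDist S ι) k : SSet.{u})) ⟶
        sk m (VR (wordDist S ι) k : SSet.{u})),
      IsEquivariant S ι φ ∧ RaisesVal (wordDist S ι) χ φ := by
  obtain ⟨t, ht⟩ := exists_val_pos hχ
  refine ⟨k (Fin.last m), fun K hK => ?_⟩
  have key : ∀ q : Fin (m + 1), ∃ n F,
      IsRaising S ι χ K n q (k q) (χ (Additive.ofMul t)) F := by
    intro q
    induction q using Fin.induction with
    | zero =>
      obtain ⟨F, hF⟩ := exists_isRaising_zero (S := S) (ι := ι) (χ := χ) (K := K) (l := k 0) t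
      exact ⟨0, F, hF⟩
    | succ q ih =>
      obtain ⟨n, F, hF⟩ := ih
      obtain ⟨h, hE⟩ := hk q
      rw [piVanishes_iff] at hE
      exact hF.exists_succ hS hgen hι h hE rfl
  obtain ⟨n, F, hF⟩ := key (Fin.last m)
  obtain ⟨φ, hφ⟩ := hF.exists_map hK ht
  exact ⟨n, φ, hφ⟩

/-- Each value is chosen so that the homotopy groups for the preceding value vanish in it. -/
lemma IsTypeF.exists_sequence {T : Type u} {d : T → T → ℕ} {m : ℕ} (h : IsTypeF d m) :
    ∃ k : Fin (m + 1) → ℕ, ∀ q : Fin m, ∃ h : k q.castSucc ≤ k q.succ, PiVanishes d q h := by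
  have h' : ∀ q k, ∃ l, q < m → ∃ h : k ≤ l, PiVanishes d q h := fun q k => by
    by_cases hq : q < m
    · obtain ⟨l, hl⟩ := h q hq k
      exact ⟨l, fun _ => hl⟩
    · exact ⟨0, fun h => absurd h hq⟩
  choose f hf using h'
  let a : ℕ → ℕ := fun n => n.rec 0 f
  exact ⟨fun q => a q, fun q => hf q (a q) q.2⟩

end Main

end BNSR

end

theorem theoremE {G : Type u} [Group G] {H : Type v} [Group H] (S : Set H) (hS : S.Finite)
    (hgen : Subgroup.closure S = ⊤) (ι : G →* H) (hι : Function.Injective ι)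
    (m : ℕ) (hG : BNSR.IsTypeF (BNSR.wordDist S ι) m)
    (χ : Additive G →+ ℝ) (hχ : χ ≠ 0) :
    List.TFAE [
      -- `χ ∈ Σ^m(G)`
      BNSR.IsTypeF (BNSR.posDist (BNSR.wordDist S ι) χ) m,
      -- `π_q(VR_{k_q} G_χ)` vanishes in `π_q(VR_{k_{q+1}} G_χ)` for `q = 0, …, m - 1`
      ∃ k : Fin (m + 1) → ℕ, ∀ q : Fin m, ∃ h : k q.castSucc ≤ k q.succ,
        BNSR.PiVanishes (BNSR.posDist (BNSR.wordDist S ι) χ) q h,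
      -- for large `k` there is a `G`-equivariant map that raises the `χ`-value
      ∃ K : ℕ, ∀ k ≥ K, ∃ (n : ℕ)
        (φ : (BNSR.sdIter n).obj (BNSR.sk m (BNSR.VR (BNSR.wordDist S ι) k : SSet.{u})) ⟶
          BNSR.sk m (BNSR.VR (BNSR.wordDist S ι) k : SSet.{u})),
        BNSR.IsEquivariant S ι φ ∧ BNSR.RaisesVal (BNSR.wordDist S ι) χ φ] := by
  tfae_have 1 → 2 := fun h => h.exists_sequence
  tfae_have 2 → 3 := fun ⟨k, hk⟩ => BNSR.exists_raisesVal hS hgen hι hχ k hk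
  tfae_have 3 → 1 := BNSR.isTypeF_of_raisesVal hS hgen hι hG
  tfae_finish
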